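/- **Constraints.** A constraint is a function $f:\{0,1\}^k\to\mathbb{R}^{\ge 0}$ ($k$ is its arity); a binary constraint is written $(f(00),f(01),f(10),f(11))$, and $\mathit{Implies}=(1,1,0,1)$. Let $\mathcal{U}$ be the set of all unary constraints. A constraint $f$ is *degenerate* if $f(x_1,\dots,x_k)=\prod_{i=1}^k u_i(x_i)$ for some unary $u_1,\dots,u_k$. $\mathcal{IM}_{\mathrm{opt}}$ is the set of all constraints that are finite products of unary constraints $u(x_i)$ and constraints $g(x_i,x_j)$, $i\ne j$, with $g=(1,1,\lambda,1)$, $0\le\lambda<1$. A constraint $f$ has *imp support* if $\{x : f(x)\neq 0\}$ is the set of solutions of a conjunction of a positive number of relations of the forms $x_i=0$, $x_i=1$, and $\mathit{Implies}(x_i,x_j)$ with $i\neq j$. **Problems.** For a set $\mathcal{F}$ of constraints, an instance of $\mathrm{MAX\text{-}PROD\text{-}CSP}(\mathcal{F})$ is a finite set $H$ of pairs $\langle h,(x_{i_1},\dots,x_{i_k})\rangle$ on Boolean variables $x_1,\dots,x_n$, with $h\in\mathcal{F}$ of arity $k$; a solution is an assignment $\sigma$ of truth values to $x_1,\dots,x_n$,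 and its measure, to be maximized, is $\prod_{\langle h,(x_{i_1},\dots,x_{i_k})\rangle\in H}h(\sigma(x_{i_1}),\dots,\sigma(x_{i_k}))$. $\mathrm{MAX\text{-}PROD\text{-}CSP}^*(g,\mathcal{F})$ denotes $\mathrm{MAX\text{-}PROD\text{-}CSP}(\{g\}\cup\mathcal{F}\cup\mathcal{U})$. An instance is presented as a finite sequence of real numbers ($n$ in unary, and for every element of $H$ the indices and the table of values of $h$); its size $|x|$ is the sum of the lengths of these numbers, where the length of a real $r$ is $1+\lceil|\log_2|r||\rceil$, and $1$ if $r=0$. **Reductions.** For a maximization problem with measure $m$ and optimum value $m^*(x)$, a solution $y$ for $x$ is $\alpha$-approximate if $1/\alpha\le m(x,y)/m^*(x)\le\alpha$ when $m^*(x)\neq0$, and $m(x,y)=0$ when $m^*(x)=0$. A randomized approximation scheme takes $(x,\varepsilon)$, where $x$ is an instance and $0<\varepsilon<1$, and outputs with probability at least $3/4$ a $2^{\varepsilon}$-approximate solution for $x$. A problem $P$ is *APT-reducible* to a problem $Q$ if there are a randomized oracle program $N$ (a program over finitely many stacks of real numbers with finitely many real constants, the field operations, comparisons, coin tosses and oracle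 calls, where every step takes unit time except that writing a number takes its length) and a polynomial $p$ such that, for every randomized approximation scheme $M$ for $Q$ (of any running time) used as an oracle, every instance $x$ of $P$ and every $\varepsilon\in(0,1)$: (i) the output of $N$ on $(x,\varepsilon)$ is, with probability at least $3/4$, a $2^\varepsilon$-approximate solution for $x$; (ii) every oracle call is a pair $(w,\delta)$ with $w$ an instance of $Q$, $0<\delta<1$ and $1/\delta\le p(|x|,1/\varepsilon)$, and it is answered by a fresh outcome of $M$ on $(w,\delta)$; (iii) $N$ always halts within time $p(|x|,1/\varepsilon)$. **Lemma.** Let $\mathcal{F}$ be any set of constraints. If $f\in\mathcal{IM}_{\mathrm{opt}}$ is non-degenerate and does not have imp support, then $\mathrm{MAX\text{-}PROD\text{-}CSP}^*(\mathit{Implies},\mathcal{F})$ is APT-reducible to $\mathrm{MAX\text{-}PROD\text{-}CSP}^*(f,\mathcal{F})$. -/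

import Mathlib

open scoped NNReal ENNReal

noncomputable section

namespace MaxProd

/-! ### Constraints -/

/-- A nonnegative-real-weighted constraint: a function `{0,1}^k → ℝ≥0`, where `k` is its arity. -/
structure Constraint where
  arity : ℕ
  val : (Fin arity → Bool) → ℝ≥0

/-- The two-place function `(a, b, c, d)`, listed as the values at `00, 01, 10, 11`. -/
def table2 (a b c d : ℝ≥0) : Bool → Bool → ℝ≥0
  | false, false => a
  | false, true => b
  | true, false => c
  | true, true => d

/-- `Implies = (1, 1, 0, 1)`. -/
def Implies : Constraint where
  arity := 2
  val x := table2 1 1 0 1 (x 0) (x 1)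

/-- The set of all unary constraints. -/
def Unary : Set Constraint := {f | f.arity = 1}

/-- Degenerate constraints: products of unary constraints applied to different variables. -/
def Degenerate (f : Constraint) : Prop :=
  ∃ u : Fin f.arity → Bool → ℝ≥0, ∀ x, f.val x = ∏ i, u i (x i)

/-- The admissible factors of a constraint in `IM_opt`: a unary constraint applied to a variable,
or `(1, 1, l, 1)` with `0 ≤ l < 1` applied to two distinct variables. -/
inductive IMFactor (k : ℕ) : Type
  | unary (i : Fin k) (u : Bool → ℝ≥0)
  | imp (i j : Fin k) (hij : i ≠ j) (l : ℝ≥0) (hl : l < 1)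

def IMFactor.eval {k : ℕ} (x : Fin k → Bool) : IMFactor k → ℝ≥0
  | .unary i u => u (x i)
  | .imp i j _ l _ => table2 1 1 l 1 (x i) (x j)

/-- The set `IM_opt`: all finite products of admissible factors. -/
def IMopt : Set Constraint :=
  {f | ∃ L : List (IMFactor f.arity), ∀ x, f.val x = (L.map (IMFactor.eval x)).prod}

/-- The relations `Δ₀(x_i)`, `Δ₁(x_i)` and `Implies(x_i, x_j)`, where `x_i`, `x_j` are distinct
variables. -/
inductive ImpAtom (k : ℕ) : Type
  | zero (i : Fin k)
  | one (i : Fin k)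
  | implies (i j : Fin k) (hij : i ≠ j)

def ImpAtom.Holds {k : ℕ} (x : Fin k → Bool) : ImpAtom k → Prop
  | .zero i => x i = false
  | .one i => x i = true
  | .implies i j _ => x i = true → x j = true

/-- `f` has imp support: `{x | f x ≠ 0}` is a conjunction of a positive number of relations
`Δ₀(x_i)`, `Δ₁(x_i)`, `Implies(x_i, x_j)`. -/
def HasImpSupport (f : Constraint) : Prop :=
  ∃ L : List (ImpAtom f.arity), L ≠ [] ∧ ∀ x, f.val x ≠ 0 ↔ ∀ a ∈ L, a.Holds x

/-! ### Maximization problems -/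

/-- The length of a real number, `1 + ⌈|log₂ |r||⌉` (and `1` for `r = 0`): the number of binary
places that its order of magnitude takes. -/
def len (r : ℝ) : ℕ := 1 + ⌈|Real.logb 2 r|⌉₊

/-- A maximization problem with instance set `Inst`. Solutions are bit strings, and an instance is
handed to a machine as a finite sequence of real numbers. -/
structure MaxProblem where
  Inst : Type
  sol : Inst → Set (List Bool)
  meas : Inst → List Bool → ℝ≥0
  meas_eq_zero : ∀ x, ∀ y ∉ sol x, meas x y = 0
  code : Inst → List ℝ
  code_injective : Function.Injective code

/-- The size `|x|` of an instance: the total length of the numbers in its code. -/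
def MaxProblem.size (P : MaxProblem) (x : P.Inst) : ℕ := ((P.code x).map len).sum

/-- `y` is an `α`-approximate solution for `x`; `v` is the optimum value `m*(x)`. -/
def MaxProblem.IsApprox (P : MaxProblem) (α : ℝ) (x : P.Inst) (y : List Bool) : Prop :=
  y ∈ P.sol x ∧ ∃ v, IsGreatest (P.meas x '' P.sol x) v ∧
    (v = 0 → P.meas x y = 0) ∧
    (v ≠ 0 → 1 / α ≤ (P.meas x y : ℝ) / v ∧ (P.meas x y : ℝ) / v ≤ α)

/-! ### The problem MAX-PROD-CSP -/

/-- An element `⟨h, (x_{i_1}, …, x_{i_k})⟩` on the variables `x_0, …, x_{n-1}`. -/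
structure Applied (n : ℕ) where
  con : Constraint
  scope : Fin con.arity → Fin n

/-- An instance of MAX-PROD-CSP(F): a number `n` of variables and a finite set of constraint
applications, given as a list without repetitions. -/
structure CSPInst (F : Set Constraint) where
  n : ℕ
  cons : List (Applied n)
  nodup : cons.Nodup
  mem : ∀ c ∈ cons, c.con ∈ F

/-- `{0,1}^k` in lexicographic order. -/
def points : (k : ℕ) → List (Fin k → Bool)
  | 0 => [Fin.elim0]
  | k + 1 => (points k).map (Fin.cons false) ++ (points k).map (Fin.cons true)

/-- The values of a constraint in lexicographic order. -/
def Constraint.table (f : Constraint) : List ℝ := (points f.arity).map fun x => (f.val x : ℝ)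

/-- The code of `⟨h, (x_{i_1}, …, x_{i_k})⟩`: the indices and the table of `h`, each closed by the
separator `-1`, which occurs nowhere else. -/
def Applied.code {n : ℕ} (c : Applied n) : List ℝ :=
  List.ofFn (fun j => ((c.scope j : ℕ) : ℝ)) ++ -1 :: (c.con.table ++ [-1])

/-- The code of an instance: `n` in unary, the separator `-1`, and the codes of the elements. -/
def CSPInst.code {F : Set Constraint} (x : CSPInst F) : List ℝ :=
  List.replicate x.n 1 ++ -1 :: x.cons.flatMap Applied.code

/-- The product of the values of all constraints under the assignment `σ`. -/
def CSPInst.value {F : Set Constraint} (x : CSPInst F) (σ : Fin x.n → Bool) : ℝ≥0 :=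
  (x.cons.map fun c => c.con.val fun j => σ (c.scope j)).prod

lemma sep_inj {a b c d : List ℝ} (ha : (-1 : ℝ) ∉ a) (hb : (-1 : ℝ) ∉ b)
    (h : a ++ -1 :: c = b ++ -1 :: d) : a = b ∧ c = d := by
  induction a generalizing b with
  | nil =>
    cases b with
    | nil => simpa using h
    | cons y b =>
      simp only [List.nil_append, List.cons_append, List.cons.injEq] at h
      exact absurd (h.1 ▸ List.mem_cons_self) hb
  | cons x a ih =>
    cases b with
    | nil =>
      simp only [List.nil_append, List.cons_append, List.cons.injEq] at h
      exact absurd (h.1 ▸ List.mem_cons_self) ha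
    | cons y b =>
      simp only [List.cons_append, List.cons.injEq, List.mem_cons, not_or] at *
      obtain ⟨h1, h2⟩ := ih ha.2 hb.2 h.2
      exact ⟨⟨h.1, h1⟩, h2⟩

lemma mem_points : ∀ (k : ℕ) (x : Fin k → Bool), x ∈ points k
  | 0, x => by simp [points, eq_iff_true_of_subsingleton]
  | k + 1, x => by
    have h := mem_points k (Fin.tail x)
    have e := Fin.cons_self_tail x
    simp only [points, List.mem_append, List.mem_map]
    cases hx : x 0
    · exact Or.inl ⟨_, h, by rw [← hx]; exact e⟩
    · exact Or.inr ⟨_, h, by rw [← hx]; exact e⟩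

lemma neg_one_not_mem_scope {n k : ℕ} (s : Fin k → Fin n) :
    (-1 : ℝ) ∉ List.ofFn (fun j => ((s j : ℕ) : ℝ)) := by
  rw [List.mem_ofFn]
  rintro ⟨j, hj⟩
  have : (0 : ℝ) ≤ ((s j : ℕ) : ℝ) := Nat.cast_nonneg _
  linarith

lemma neg_one_not_mem_table (f : Constraint) : (-1 : ℝ) ∉ f.table := by
  simp only [Constraint.table, List.mem_map, not_exists, not_and]
  intro x _ hx
  have := (f.val x).2
  change (0 : ℝ) ≤ (f.val x : ℝ) at this
  linarith

lemma applied_inj {n : ℕ} {c d : Applied n} {r s : List ℝ}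
    (h : c.code ++ r = d.code ++ s) : c = d ∧ r = s := by
  simp only [Applied.code, List.append_assoc, List.cons_append, List.nil_append] at h
  obtain ⟨h1, h2⟩ := sep_inj (neg_one_not_mem_scope _) (neg_one_not_mem_scope _) h
  obtain ⟨h3, h4⟩ := sep_inj (neg_one_not_mem_table _) (neg_one_not_mem_table _) h2
  refine ⟨?_, h4⟩
  obtain ⟨⟨k, f⟩, u⟩ := c
  obtain ⟨⟨l, g⟩, v⟩ := d
  have hkl : k = l := by simpa using congrArg List.length h1
  subst hkl
  have huv : u = v := by
    have := List.ofFn_injective h1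
    funext j
    have hj := congrFun this j
    exact Fin.ext (by exact_mod_cast hj)
  have hfg : f = g := by
    funext x
    have := List.map_inj_left.1 h3 x (mem_points k x)
    exact_mod_cast this
  subst huv hfg
  rfl

lemma applied_code_ne_nil {n : ℕ} (c : Applied n) : c.code ≠ [] := by
  simp [Applied.code]

lemma flatMap_code_inj {n : ℕ} : ∀ {L K : List (Applied n)},
    L.flatMap Applied.code = K.flatMap Applied.code → L = K
  | [], [], _ => rfl
  | [], d :: K, h => by simp [applied_code_ne_nil] at h
  | c :: L, [], h => by simp [applied_code_ne_nil] at h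
  | c :: L, d :: K, h => by
    simp only [List.flatMap_cons] at h
    obtain ⟨h1, h2⟩ := applied_inj h
    rw [h1, flatMap_code_inj h2]

lemma csp_code_injective (F : Set Constraint) :
    Function.Injective (CSPInst.code : CSPInst F → List ℝ) := by
  rintro ⟨n, L, hL, hL'⟩ ⟨m, K, hK, hK'⟩ h
  have aux : ∀ k : ℕ, (-1 : ℝ) ∉ List.replicate k (1 : ℝ) := by
    intro k hk
    have := List.eq_of_mem_replicate hk
    norm_num at this
  obtain ⟨h1, h2⟩ := sep_inj (aux _) (aux _) h
  have hnm : n = m := by simpa using congrArg List.length h1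
  subst hnm
  have := flatMap_code_inj h2
  subst this
  rfl

/-- MAX-PROD-CSP(F). A solution is a truth assignment, written as the bit string
`σ(x_0) … σ(x_{n-1})`. -/
def maxProdCSP (F : Set Constraint) : MaxProblem where
  Inst := CSPInst F
  sol x := {y | y.length = x.n}
  meas x y := if h : y.length = x.n then x.value fun i => y.get (i.cast h.symm) else 0
  meas_eq_zero _ _ h := dif_neg h
  code := CSPInst.code
  code_injective := csp_code_injective F

/-- MAX-PROD-CSP*(F) is MAX-PROD-CSP(F ∪ U), where `U` is the set of all unary constraints. -/
def maxProdCSPStar (F : Set Constraint) : MaxProblem := maxProdCSP (F ∪ Unary)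

/-! ### Randomized oracle machines over the real numbers

The memory consists of stacks (one-ended tapes) of real numbers. A program uses finitely many of
them and finitely many real constants. -/

/-- The field operations. Division by zero gives zero. -/
inductive Op
  | add | sub | mul | div

def Op.eval : Op → ℝ → ℝ → ℝ
  | .add => (· + ·)
  | .sub => (· - ·)
  | .mul => (· * ·)
  | .div => (· / ·)

abbrev Store := ℕ → List ℝ

/-- The top of stack `a`; it reads as zero if the stack is empty. -/
def Store.top (s : Store) (a : ℕ) : ℝ := (s a).headD 0

def Store.push (s : Store) (a : ℕ) (r : ℝ) : Store := Function.update s a (r :: s a)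

/-- Tests: "the top of `a` is at most the top of `b`", and "stack `a` is empty". -/
inductive Test
  | le (a b : ℕ)
  | empty (a : ℕ)

def Test.Holds (s : Store) : Test → Prop
  | .le a b => s.top a ≤ s.top b
  | .empty a => s a = []

/-- Programs. -/
inductive Prog
  /-- Do nothing. -/
  | nop
  /-- Push the constant `r` on stack `a`. -/
  | push (r : ℝ) (a : ℕ)
  /-- Remove the top of stack `a`. -/
  | pop (a : ℕ)
  /-- Push the top of `a` on `b`. -/
  | copy (a b : ℕ)
  /-- Push the result of an operation on the tops of `a` and `b` on stack `c`. -/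
  | arith (o : Op) (a b c : ℕ)
  /-- Push a uniformly random bit on stack `a`. -/
  | flip (a : ℕ)
  /-- Ask the oracle the question on stack `q`, which is erased; the answer replaces the content
  of stack `a`. -/
  | query (q a : ℕ)
  | seq (P Q : Prog)
  | branch (t : Test) (P Q : Prog)
  /-- Repeat `P` as long as the test holds. -/
  | loop (t : Test) (P : Prog)

/-- A configuration: the programs still to be executed in turn, the memory, and the time used. -/
structure Config where
  todo : List Prog
  store : Store
  clock : ℕ

/-- An oracle: it takes the code of an instance and an error tolerance, and draws a bit string. -/
abbrev Oracle := List ℝ → ℝ → PMF (List Bool)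

/-- A bit string as a stack content. -/
def bits (y : List Bool) : List ℝ := y.map fun b => if b then 1 else 0

open Classical in
/-- One step. It takes one unit of time, except that writing the number `r` takes `len r` units.
A question consists of the error tolerance, on top, and the code of an instance. Different oracle
calls and coin tosses are independent. -/
def step (M : Oracle) (c : Config) : PMF Config :=
  match c.todo with
  | [] => PMF.pure c
  | .nop :: k => PMF.pure ⟨k, c.store, c.clock + 1⟩
  | .push r a :: k => PMF.pure ⟨k, c.store.push a r, c.clock + len r⟩
  | .pop a :: k => PMF.pure ⟨k, Function.update c.store a (c.store a).tail, c.clock + 1⟩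
  | .copy a b :: k =>
      PMF.pure ⟨k, c.store.push b (c.store.top a), c.clock + len (c.store.top a)⟩
  | .arith o a b d :: k =>
      PMF.pure ⟨k, c.store.push d (o.eval (c.store.top a) (c.store.top b)),
        c.clock + len (o.eval (c.store.top a) (c.store.top b))⟩
  | .flip a :: k =>
      (PMF.uniformOfFintype Bool).map fun b =>
        ⟨k, c.store.push a (if b then 1 else 0), c.clock + 1⟩
  | .query q a :: k =>
      (M (c.store q).tail (c.store.top q)).map fun y =>
        ⟨k, Function.update (Function.update c.store q []) a (bits y), c.clock + 1⟩
  | .seq P Q :: k => PMF.pure ⟨P :: Q :: k, c.store, c.clock + 1⟩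
  | .branch t P Q :: k =>
      PMF.pure ⟨(if t.Holds c.store then P else Q) :: k, c.store, c.clock + 1⟩
  | .loop t P :: k =>
      PMF.pure ⟨if t.Holds c.store then P :: .loop t P :: k else k, c.store, c.clock + 1⟩

/-- The distribution of the configuration after `t` steps. A configuration with nothing left to
execute is final and does not change any more. -/
def run (M : Oracle) (c : Config) : ℕ → PMF Config
  | 0 => PMF.pure c
  | t + 1 => (run M c t).bind (step M)

/-- The initial configuration: `ε` and the code of the instance on stack `0`, all other stacks
empty. -/
def start (N : Prog) (ε : ℝ) (w : List ℝ) : Config :=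
  ⟨[N], Function.update (fun _ => []) 0 (ε :: w), 0⟩

/-- `M` is a randomized approximation scheme for `Q` (with no bound on its running time). -/
def IsScheme (Q : MaxProblem) (M : Oracle) : Prop :=
  ∀ (w : Q.Inst) (δ : ℝ), 0 < δ → δ < 1 →
    3 / 4 ≤ (M (Q.code w) δ).toOuterMeasure {y | Q.IsApprox (2 ^ δ) w y}

/-- `P` is APT-reducible to `Q`. One program `N` and one polynomial `p` serve all oracles.
The output is read off stack `1`. -/
def APTReduces (P Q : MaxProblem) : Prop :=
  ∃ (N : Prog) (p : MvPolynomial (Fin 2) ℝ), ∀ M : Oracle, IsScheme Q M →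
    ∀ (x : P.Inst) (ε : ℝ), 0 < ε → ε < 1 →
      -- every oracle call is `(w, δ)` with `0 < δ < 1` and `1/δ ≤ p(|x|, 1/ε)`
      (∀ t, ∀ c ∈ (run M (start N ε (P.code x)) t).support,
        ∀ q a k, c.todo = .query q a :: k →
          ∃ (w : Q.Inst) (δ : ℝ), c.store q = δ :: Q.code w ∧ 0 < δ ∧ δ < 1 ∧
            1 / δ ≤ MvPolynomial.eval ![(P.size x : ℝ), 1 / ε] p) ∧
      -- on every computation path, `N` halts in time at most `p(|x|, 1/ε)`, and its output is a
      -- `2^ε`-approximate solution for `x` with probability at least `3/4`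
      ∃ t, (∀ c ∈ (run M (start N ε (P.code x)) t).support,
          c.todo = [] ∧ (c.clock : ℝ) ≤ MvPolynomial.eval ![(P.size x : ℝ), 1 / ε] p) ∧
        3 / 4 ≤ (run M (start N ε (P.code x)) t).toOuterMeasure
          {c | ∃ y, c.store 1 = bits y ∧ P.IsApprox (2 ^ ε) x y}

end MaxProd

end

noncomputable section

namespace MaxProd

/-! ### Deterministic computations -/

/-! The zero set of a product of admissible factors is a conjunction of imp atoms, so without imp
support `f` has no zeros at all (`IMopt.val_ne_zero`). As `f` is not degenerate, some factor
`(1,1,l,1)` occurs, on positions `i`, `j` say. Fixing all other positions to `false` leaves a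
positive binary function that is strictly log-supermodular: every factor satisfies the weak
inequality, and the chosen one satisfies it strictly (`IMopt.exists_pin`). Multiplication by unary
constraints turns it into a constant times `(1,1,λ,1)` with `0 < λ < 1`, and `m` copies give
`(1,1,λ^m,1)`, a softened `Implies`.

An instance is a set, so the copies have to be different applications. Each copy on `x`, `y` runs
through a fresh variable `v`, as `(x,v)` and `(v,y)`; the maximum over `v` of the product of the two
tables is the table on `(x,y)` (`table2_trans_le`, `table2_trans_self`). The unary corrections on
`x` and `y` are scaled by ever larger numbers, which changes the measure by a constant factor only
(`Partial.Valid.copy`, `Partial.Represents.copy`). The remaining positions of `f` receive one new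
variable, forced to `false` by the unary constraint `(1,0)`.

Let `Z ≥ 1` bound the product of the other constraints from above, and `1/Z` bound its nonzero
values from below. If `λ^m Z² < 1/2`, then an assignment that violates an implication is worse by a
factor above 2 than any assignment of positive measure for the given instance. As `2^ε < 2`, a
`2^ε`-approximate solution respects all implications whenever the optimum is nonzero, and there both
measures agree up to a constant. Hence one oracle call with the same `ε` suffices, and the error
probability is inherited (`Pinnable.le_of_result`, `Pinnable.isApprox_firstBits`). A zero optimum
makes every assignment acceptable.

The rest is a machine that does this in polynomial time. It multiplies `r + 1 + 1/r` over all table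
entries to get `Z`, which is at most `4^|x|`, and writes copies for each implication until `Z² λ^k`
drops below `1/2`. That takes linearly many copies in `|x|` (`Pinnable.exists_copies`), and all
numbers written have polynomial length (`Pinnable.bounds`). Everything apart from the single query
is deterministic (`Pinnable.run_program`). -/

/-- A step that involves neither coins nor the oracle. -/
def DetStep (a b : Config) : Prop :=
  (∀ M, step M a = PMF.pure b) ∧ a.todo ≠ [] ∧ ∀ q x k, a.todo ≠ .query q x :: k

/-- `DetPath n a b`: a deterministic computation of `n` steps leads from `a` to `b`. -/
inductive DetPath : ℕ → Config → Config → Prop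
  | refl (a : Config) : DetPath 0 a a
  | head {n : ℕ} {a b c : Config} : DetStep a b → DetPath n b c → DetPath (n + 1) a c

lemma DetPath.trans {n m : ℕ} {a b c : Config} (h : DetPath n a b) (h' : DetPath m b c) :
    DetPath (n + m) a c := by
  induction h with
  | refl => simpa using h'
  | @head n _ _ _ hs _ ih =>
    rw [show n + 1 + m = n + m + 1 by omega]
    exact .head hs (ih h')

lemma run_add (M : Oracle) (c : Config) (s t : ℕ) :
    run M c (s + t) = (run M c s).bind fun c' => run M c' t := by
  induction t with
  | zero => simp [run]
  | succ t ih =>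
    change (run M c (s + t)).bind (step M) = _
    rw [ih, PMF.bind_bind]
    rfl

lemma run_one (M : Oracle) (c : Config) : run M c 1 = step M c := by
  simp [run]

lemma run_of_todo_eq_nil (M : Oracle) {c : Config} (h : c.todo = []) (t : ℕ) :
    run M c t = PMF.pure c := by
  induction t with
  | zero => rfl
  | succ t ih =>
    simp only [run, ih, PMF.pure_bind]
    obtain ⟨l, s, n⟩ := c
    simp only at h
    subst h
    rfl

lemma DetPath.run_eq (M : Oracle) {n : ℕ} {a b : Config} (h : DetPath n a b) :
    run M a n = PMF.pure b := by
  induction h with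
  | refl => rfl
  | @head n a b c hs _ ih =>
    rw [Nat.add_comm, run_add, run_one, hs.1 M, PMF.pure_bind, ih]

/-- Serves the condition on oracle calls: none can occur on a deterministic stretch. -/
lemma DetPath.run_lt (M : Oracle) {n : ℕ} {a b : Config} (h : DetPath n a b) :
    ∀ t < n, ∀ c ∈ (run M a t).support, ∀ q x k, c.todo ≠ .query q x :: k := by
  induction h with
  | refl => intro t ht; omega
  | @head n a b c hs _ ih =>
    intro t ht c' hc'
    cases t with
    | zero =>
      simp only [run, PMF.support_pure, Set.mem_singleton_iff] at hc'
      subst hc'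
      exact hs.2.2
    | succ t =>
      rw [Nat.add_comm, run_add, run_one, hs.1 M, PMF.pure_bind] at hc'
      exact ih t (by omega) c' hc'

/-- Final configurations are stationary, so computations of different lengths can all be inspected
at one common time. -/
lemma DetPath.run_of_final (M : Oracle) {n : ℕ} {a b : Config} (h : DetPath n a b)
    (hb : b.todo = []) {t : ℕ} (ht : n ≤ t) : run M a t = PMF.pure b := by
  obtain ⟨u, rfl⟩ := Nat.exists_eq_add_of_le ht
  rw [run_add, h.run_eq M, PMF.pure_bind, run_of_todo_eq_nil M hb]

/-! ### Costs of deterministic programs -/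

/-- `Runs B P s s' c`: the program `P` turns the store `s` into `s'` deterministically, with time
and number of steps at most `c * B`. -/
def Runs (B : ℕ) (P : Prog) (s s' : Store) (c : ℕ) : Prop :=
  ∀ k t₀, ∃ n t₁, n ≤ c * B ∧ t₁ ≤ t₀ + c * B ∧ DetPath n ⟨P :: k, s, t₀⟩ ⟨k, s', t₁⟩

lemma Runs.mono {B : ℕ} {P : Prog} {s s' : Store} {c d : ℕ} (h : Runs B P s s' c) (hcd : c ≤ d) :
    Runs B P s s' d := by
  intro k t₀
  obtain ⟨n, t₁, h1, h2, h3⟩ := h k t₀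
  have := Nat.mul_le_mul_right B hcd
  exact ⟨n, t₁, by omega, by omega, h3⟩

/-- With `B` above all lengths written, every step costs at most `B`, and the accounting of time
reduces to counting steps. -/
lemma runs_atom {B : ℕ} {P : Prog} {s s' : Store} {d : ℕ} (hB : 1 ≤ B) (hd : d ≤ B)
    (h : ∀ k t, DetStep ⟨P :: k, s, t⟩ ⟨k, s', t + d⟩) : Runs B P s s' 1 := by
  intro k t
  exact ⟨1, t + d, by omega, by omega, .head (h k t) (.refl _)⟩

lemma Runs.seq {B : ℕ} {P Q : Prog} {s s' s'' : Store} {c d : ℕ} (hB : 1 ≤ B)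
    (h : Runs B P s s' c) (h' : Runs B Q s' s'' d) : Runs B (.seq P Q) s s'' (c + d + 1) := by
  intro k t₀
  obtain ⟨n, t₁, h1, h2, h3⟩ := h (Q :: k) (t₀ + 1)
  obtain ⟨m, t₂, h4, h5, h6⟩ := h' k t₁
  refine ⟨n + m + 1, t₂, ?_, ?_, .head ⟨fun M => rfl, by simp, by simp⟩ (h3.trans h6)⟩
  · ring_nf; omega
  · ring_nf; omega

lemma runs_branch_pos {B : ℕ} {t : Test} {P Q : Prog} {s s' : Store} {c : ℕ} (hB : 1 ≤ B)
    (ht : t.Holds s) (h : Runs B P s s' c) : Runs B (.branch t P Q) s s' (c + 1) := by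
  intro k t₀
  obtain ⟨n, t₁, h1, h2, h3⟩ := h k (t₀ + 1)
  refine ⟨n + 1, t₁, by ring_nf; omega, by ring_nf; omega,
    .head ⟨fun M => ?_, by simp, by simp⟩ h3⟩
  simp [step, ht]

lemma runs_branch_neg {B : ℕ} {t : Test} {P Q : Prog} {s s' : Store} {c : ℕ} (hB : 1 ≤ B)
    (ht : ¬ t.Holds s) (h : Runs B Q s s' c) : Runs B (.branch t P Q) s s' (c + 1) := by
  intro k t₀
  obtain ⟨n, t₁, h1, h2, h3⟩ := h k (t₀ + 1)
  refine ⟨n + 1, t₁, by ring_nf; omega, by ring_nf; omega,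
    .head ⟨fun M => ?_, by simp, by simp⟩ h3⟩
  simp [step, ht]

lemma runs_loop_done {B : ℕ} {t : Test} {P : Prog} {s : Store} (hB : 1 ≤ B)
    (ht : ¬ t.Holds s) : Runs B (.loop t P) s s 1 := by
  refine runs_atom hB hB fun k t₀ => ⟨fun M => ?_, by simp, by simp⟩
  simp [step, ht]

lemma runs_loop_step {B : ℕ} {t : Test} {P : Prog} {s s' s'' : Store} {c d : ℕ} (hB : 1 ≤ B)
    (ht : t.Holds s) (h : Runs B P s s' c) (h' : Runs B (.loop t P) s' s'' d) :
    Runs B (.loop t P) s s'' (c + d + 1) := by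
  intro k t₀
  obtain ⟨n, t₁, h1, h2, h3⟩ := h (.loop t P :: k) (t₀ + 1)
  obtain ⟨m, t₂, h4, h5, h6⟩ := h' k t₁
  refine ⟨n + m + 1, t₂, ?_, ?_, .head ⟨fun M => ?_, by simp, by simp⟩ (h3.trans h6)⟩
  · ring_nf; omega
  · ring_nf; omega
  · simp [step, ht]

/-- The effect of a straight-line program. -/
def Prog.ev : Prog → Store → Store
  | .push r a, s => s.push a r
  | .pop a, s => Function.update s a (s a).tail
  | .copy a b, s => s.push b (s.top a)
  | .arith o a b c, s => s.push c (o.eval (s.top a) (s.top b))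
  | .seq P Q, s => Q.ev (P.ev s)
  | _, s => s

/-- The program is a straight line, and the numbers that it writes have length at most `B`. -/
def Prog.Ok (B : ℕ) : Prog → Store → Prop
  | .nop, _ => True
  | .push r _, _ => len r ≤ B
  | .pop _, _ => True
  | .copy a _, s => len (s.top a) ≤ B
  | .arith o a b _, s => len (o.eval (s.top a) (s.top b)) ≤ B
  | .seq P Q, s => P.Ok B s ∧ Q.Ok B (P.ev s)
  | _, _ => False

/-- The number of steps of a straight-line program. -/
def Prog.count : Prog → ℕ
  | .seq P Q => P.count + Q.count + 1
  | _ => 1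

lemma Prog.Ok.runs {B : ℕ} (hB : 1 ≤ B) : ∀ {P : Prog} {s : Store}, P.Ok B s →
    Runs B P s (P.ev s) P.count
  | .nop, s, _ => runs_atom hB hB fun k t => ⟨fun M => rfl, by simp, by simp⟩
  | .push r a, s, h => runs_atom hB h fun k t => ⟨fun M => rfl, by simp, by simp⟩
  | .pop a, s, _ => runs_atom hB hB fun k t => ⟨fun M => rfl, by simp, by simp⟩
  | .copy a b, s, h => runs_atom hB h fun k t => ⟨fun M => rfl, by simp, by simp⟩
  | .arith o a b c, s, h => runs_atom hB h fun k t => ⟨fun M => rfl, by simp, by simp⟩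
  | .seq P Q, s, h => Runs.seq hB (Prog.Ok.runs hB h.1) (Prog.Ok.runs hB h.2)

/-- Sequential composition of a list of programs. -/
def seqs (l : List Prog) : Prog := l.foldr .seq .nop

/-! ### The memory of the reduction -/

/-- The stacks used by the reduction; stack `15` stays empty. -/
structure Mem where
  (inp out q e z t v vs ns a b xs ys w k g o h : List ℝ)

/-- Stack 3 keeps `ε`, 4 the product `Z`, 5 the next scale `T`, 6 and 7 the number of variables as a
number and in unary, 8 the original number in unary. Scopes and tables pass through 9 and 10, pairs
of implications lie on 11 and 12, 13 holds the weight of a violated implication, 14 is scratch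
space, 16 a loop flag, 17 the pinned variable, 18 the threshold `1/2`. -/
def Mem.store (m : Mem) : Store
  | 0 => m.inp
  | 1 => m.out
  | 2 => m.q
  | 3 => m.e
  | 4 => m.z
  | 5 => m.t
  | 6 => m.v
  | 7 => m.vs
  | 8 => m.ns
  | 9 => m.a
  | 10 => m.b
  | 11 => m.xs
  | 12 => m.ys
  | 13 => m.w
  | 14 => m.k
  | 16 => m.g
  | 17 => m.o
  | 18 => m.h
  | _ => []

/-- All stacks from 19 on are empty in every memory, so finitely many comparisons decide. -/
lemma Mem.update_store {m m' : Mem} {i : ℕ} {l : List ℝ} (hi : m'.store i = l)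
    (h : ∀ j, j < 19 → j ≠ i → m'.store j = m.store j) :
    Function.update m.store i l = m'.store := by
  funext j
  by_cases hj : j = i
  · subst hj; simp [hi]
  · rw [Function.update_of_ne hj]
    by_cases h19 : j < 19
    · exact (h j h19 hj).symm
    · obtain ⟨r, rfl⟩ := Nat.exists_eq_add_of_le (Nat.le_of_not_lt h19)
      rw [Nat.add_comm]
      rfl

section
variable (m : Mem) (l : List ℝ)

lemma Mem.upd_inp : Function.update m.store 0 l = {m with inp := l : Mem}.store :=
  Mem.update_store rfl fun j hj h => by interval_cases j <;> first | rfl | exact absurd rfl h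
lemma Mem.upd_out : Function.update m.store 1 l = {m with out := l : Mem}.store :=
  Mem.update_store rfl fun j hj h => by interval_cases j <;> first | rfl | exact absurd rfl h
lemma Mem.upd_q : Function.update m.store 2 l = {m with q := l : Mem}.store :=
  Mem.update_store rfl fun j hj h => by interval_cases j <;> first | rfl | exact absurd rfl h
lemma Mem.upd_e : Function.update m.store 3 l = {m with e := l : Mem}.store :=
  Mem.update_store rfl fun j hj h => by interval_cases j <;> first | rfl | exact absurd rfl h
lemma Mem.upd_z : Function.update m.store 4 l = {m with z := l : Mem}.store :=
  Mem.update_store rfl fun j hj h => by interval_cases j <;> first | rfl | exact absurd rfl h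
lemma Mem.upd_t : Function.update m.store 5 l = {m with t := l : Mem}.store :=
  Mem.update_store rfl fun j hj h => by interval_cases j <;> first | rfl | exact absurd rfl h
lemma Mem.upd_v : Function.update m.store 6 l = {m with v := l : Mem}.store :=
  Mem.update_store rfl fun j hj h => by interval_cases j <;> first | rfl | exact absurd rfl h
lemma Mem.upd_vs : Function.update m.store 7 l = {m with vs := l : Mem}.store :=
  Mem.update_store rfl fun j hj h => by interval_cases j <;> first | rfl | exact absurd rfl h
lemma Mem.upd_ns : Function.update m.store 8 l = {m with ns := l : Mem}.store :=
  Mem.update_store rfl fun j hj h => by interval_cases j <;> first | rfl | exact absurd rfl h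
lemma Mem.upd_a : Function.update m.store 9 l = {m with a := l : Mem}.store :=
  Mem.update_store rfl fun j hj h => by interval_cases j <;> first | rfl | exact absurd rfl h
lemma Mem.upd_b : Function.update m.store 10 l = {m with b := l : Mem}.store :=
  Mem.update_store rfl fun j hj h => by interval_cases j <;> first | rfl | exact absurd rfl h
lemma Mem.upd_xs : Function.update m.store 11 l = {m with xs := l : Mem}.store :=
  Mem.update_store rfl fun j hj h => by interval_cases j <;> first | rfl | exact absurd rfl h
lemma Mem.upd_ys : Function.update m.store 12 l = {m with ys := l : Mem}.store :=
  Mem.update_store rfl fun j hj h => by interval_cases j <;> first | rfl | exact absurd rfl h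
lemma Mem.upd_w : Function.update m.store 13 l = {m with w := l : Mem}.store :=
  Mem.update_store rfl fun j hj h => by interval_cases j <;> first | rfl | exact absurd rfl h
lemma Mem.upd_k : Function.update m.store 14 l = {m with k := l : Mem}.store :=
  Mem.update_store rfl fun j hj h => by interval_cases j <;> first | rfl | exact absurd rfl h
lemma Mem.upd_g : Function.update m.store 16 l = {m with g := l : Mem}.store :=
  Mem.update_store rfl fun j hj h => by interval_cases j <;> first | rfl | exact absurd rfl h
lemma Mem.upd_o : Function.update m.store 17 l = {m with o := l : Mem}.store :=
  Mem.update_store rfl fun j hj h => by interval_cases j <;> first | rfl | exact absurd rfl h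
lemma Mem.upd_h : Function.update m.store 18 l = {m with h := l : Mem}.store :=
  Mem.update_store rfl fun j hj h => by interval_cases j <;> first | rfl | exact absurd rfl h
end

attribute [simp] Mem.upd_inp Mem.upd_out Mem.upd_q Mem.upd_e Mem.upd_z Mem.upd_t Mem.upd_v
  Mem.upd_vs Mem.upd_ns Mem.upd_a Mem.upd_b Mem.upd_xs Mem.upd_ys Mem.upd_w Mem.upd_k Mem.upd_g
  Mem.upd_o Mem.upd_h

/-- `Does B P m m' c`: `Runs` for memories. -/
def Does (B : ℕ) (P : Prog) (m m' : Mem) (c : ℕ) : Prop := Runs B P m.store m'.store c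

/-- Reduces a straight-line program to two computations that the simplifier can carry out: its
effect and the lengths it writes. -/
lemma Does.of_ok {B : ℕ} (hB : 1 ≤ B) {P : Prog} {m m' : Mem} {c : ℕ} (h : P.Ok B m.store)
    (he : P.ev m.store = m'.store) (hc : P.count ≤ c) : Does B P m m' c := by
  have := h.runs hB
  rw [he] at this
  exact this.mono hc

lemma Does.seq {B : ℕ} (hB : 1 ≤ B) {P Q : Prog} {m m' m'' : Mem} {c d : ℕ}
    (h : Does B P m m' c) (h' : Does B Q m' m'' d) : Does B (.seq P Q) m m'' (c + d + 1) :=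
  Runs.seq hB h h'

lemma does_seqs_nil {B : ℕ} (hB : 1 ≤ B) (m : Mem) : Does B (seqs []) m m 1 :=
  Does.of_ok hB trivial rfl le_rfl

lemma does_seqs_cons {B : ℕ} (hB : 1 ≤ B) {P : Prog} {l : List Prog} {m m' m'' : Mem} {c d : ℕ}
    (h : Does B P m m' c) (h' : Does B (seqs l) m' m'' d) :
    Does B (seqs (P :: l)) m m'' (c + d + 1) :=
  Runs.seq hB h h'

/-! ### Loops that empty a stack -/

/-- Repeat `P` until stack `i` is empty; stack `16` serves as a flag. -/
def untilEmpty (i : ℕ) (P : Prog) : Prog :=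
  .seq (.loop (.empty 16) (.branch (.empty i) (.push 1 16) P)) (.pop 16)

lemma len_one : len 1 = 1 := by simp [len]
lemma len_zero : len 0 = 1 := by simp [len]
lemma len_neg_one : len (-1) = 1 := by simp [len]

/-- The loop of `untilEmpty`, run from a memory with empty flag until the flag is set. -/
def UntilLoop (B i : ℕ) (P : Prog) (m m' : Mem) (c : ℕ) : Prop :=
  Does B (.loop (.empty 16) (.branch (.empty i) (.push 1 16) P)) m {m' with g := [1]} c

lemma untilLoop_done {B : ℕ} (hB : 1 ≤ B) {i : ℕ} {P : Prog} {m : Mem} (hg : m.g = [])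
    (hi : m.store i = []) : UntilLoop B i P m m 4 := by
  have h1 : Does B (.push 1 16) m {m with g := [1]} 1 :=
    Does.of_ok hB (by simpa [Prog.Ok, len_one] using hB) (by simp [Prog.ev, Store.push, Mem.store, hg])
      le_rfl
  have h2 : Runs B (.branch (.empty i) (.push 1 16) P) m.store _ 2 := runs_branch_pos hB hi h1
  exact runs_loop_step hB (t := .empty 16) (s := m.store) hg h2
    (runs_loop_done hB (by simp [Test.Holds, Mem.store]))

lemma untilLoop_step {B : ℕ} (hB : 1 ≤ B) {i : ℕ} {P : Prog} {m m' m'' : Mem} {c d : ℕ}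
    (hg : m.g = []) (hi : m.store i ≠ []) (h : Does B P m m' c) (h' : UntilLoop B i P m' m'' d) :
    UntilLoop B i P m m'' (c + d + 2) := by
  have h2 : Runs B (.branch (.empty i) (.push 1 16) P) m.store m'.store (c + 1) :=
    runs_branch_neg hB hi h
  exact Runs.mono (runs_loop_step hB (t := .empty 16) (s := m.store) hg h2 h') (by omega)

lemma UntilLoop.does {B : ℕ} (hB : 1 ≤ B) {i : ℕ} {P : Prog} {m m' : Mem} {c : ℕ}
    (hg : m'.g = []) (h : UntilLoop B i P m m' c) : Does B (untilEmpty i P) m m' (c + 2) := by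
  refine Does.seq hB h (Does.of_ok (c := 1) hB trivial ?_ le_rfl)
  obtain ⟨⟩ := m'
  simp only at hg
  subst hg
  simp [Prog.ev, Mem.store]

/-! ### Pinning a constraint of `IM_opt` to two variables -/

/-- The point with entries `x`, `y` at the positions `i`, `j` and `o` elsewhere. -/
def pin {k : ℕ} {α : Type} (i j : Fin k) (x y o : α) : Fin k → α :=
  fun p => if p = i then x else if p = j then y else o

lemma pin_comp {k : ℕ} {α β : Type} (i j : Fin k) (x y o : α) (σ : α → β) :
    (fun p => σ (pin i j x y o p)) = pin i j (σ x) (σ y) (σ o) := by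
  funext p
  simp only [pin]
  split_ifs <;> rfl

/-- The zero set of a factor, as a list of atoms. -/
def IMFactor.atoms {k : ℕ} : IMFactor k → List (ImpAtom k)
  | .unary i u => (if u false = 0 then [.one i] else []) ++ (if u true = 0 then [.zero i] else [])
  | .imp i j hij l _ => if l = 0 then [.implies i j hij] else []

lemma IMFactor.eval_ne_zero_iff {k : ℕ} (x : Fin k → Bool) (a : IMFactor k) :
    a.eval x ≠ 0 ↔ ∀ b ∈ a.atoms, b.Holds x := by
  cases a with
  | unary i u =>
    by_cases h0 : u false = 0 <;> by_cases h1 : u true = 0 <;> cases hx : x i <;>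
      simp [IMFactor.eval, IMFactor.atoms, ImpAtom.Holds, h0, h1, hx]
  | imp i j hij l hl =>
    by_cases h0 : l = 0 <;> cases hx : x i <;> cases hy : x j <;>
      simp [IMFactor.eval, IMFactor.atoms, ImpAtom.Holds, h0, hx, hy, table2]

/-- The support is the conjunction of the atoms of all factors; imp support can fail only because
that list is empty, and then there are no zeros. -/
lemma IMopt.val_ne_zero {f : Constraint} (hf : f ∈ IMopt) (himp : ¬ HasImpSupport f)
    (x : Fin f.arity → Bool) : f.val x ≠ 0 := by
  obtain ⟨L, hL⟩ := hf
  have key : ∀ y, f.val y ≠ 0 ↔ ∀ b ∈ L.flatMap IMFactor.atoms, b.Holds y := by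
    intro y
    rw [hL, ne_eq, List.prod_eq_zero_iff]
    simp only [List.mem_map, not_exists, not_and, List.mem_flatMap, forall_exists_index, and_imp]
    constructor
    · intro h b a ha hb
      exact (a.eval_ne_zero_iff y).1 (h a ha) b hb
    · intro h a ha
      exact (a.eval_ne_zero_iff y).2 fun b hb => h b a ha hb
  by_contra h0
  refine himp ⟨_, fun h => ?_, key⟩
  rw [h] at key
  exact (key x).2 (by simp) h0

/-- Log-supermodularity of a single factor. Equality holds unless the factor is an implication on
both `i` and `j`, in either direction; then the claim is `l ≤ 1`. -/
lemma IMFactor.eval_pin {k : ℕ} (i j : Fin k) (hij : i ≠ j) (a : IMFactor k) :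
    a.eval (pin i j false true false) * a.eval (pin i j true false false) ≤
      a.eval (pin i j false false false) * a.eval (pin i j true true false) := by
  cases a with
  | unary p u =>
    by_cases hi : p = i <;> by_cases hj : p = j <;> subst_vars <;>
      simp_all [IMFactor.eval, pin, mul_comm]
  | imp p r hpr l hl =>
    have := hl.le
    by_cases hi : p = i <;> by_cases hj : p = j <;> by_cases hi' : r = i <;> by_cases hj' : r = j <;>
      simp_all [IMFactor.eval, pin, table2]

lemma IMopt.exists_pin {f : Constraint} (hf : f ∈ IMopt) (hdeg : ¬ Degenerate f)
    (h0 : ∀ x, f.val x ≠ 0) : ∃ i j : Fin f.arity, i ≠ j ∧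
      f.val (pin i j false true false) * f.val (pin i j true false false) <
        f.val (pin i j false false false) * f.val (pin i j true true false) := by
  obtain ⟨L, hL⟩ := hf
  have hex : ∃ i j hij l hl, IMFactor.imp i j hij l hl ∈ L := by
    by_contra hno
    push Not at hno
    -- Without implication factors, collecting the unary factors at each position exhibits `f` as
    -- degenerate.
    refine hdeg ⟨fun i b => (L.map fun a => match a with
      | .unary p u => if p = i then u b else 1
      | .imp _ _ _ _ _ => 1).prod, fun x => ?_⟩
    rw [hL]
    clear hL
    induction L with
    | nil => simp
    | cons a L ih =>
      cases a with
      | imp i j hij l hl => exact absurd List.mem_cons_self (hno i j hij l hl)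
      | unary p u =>
        simp only [List.map_cons, List.prod_cons, Finset.prod_mul_distrib]
        rw [ih fun i j hij l hl h => hno i j hij l hl (List.mem_cons_of_mem _ h)]
        simp [IMFactor.eval]
  obtain ⟨i, j, hij, l, hl, hmem⟩ := hex
  refine ⟨i, j, hij, ?_⟩
  have hle : ∀ K : List (IMFactor f.arity),
      (K.map (IMFactor.eval (pin i j false true false))).prod *
        (K.map (IMFactor.eval (pin i j true false false))).prod ≤
      (K.map (IMFactor.eval (pin i j false false false))).prod *
        (K.map (IMFactor.eval (pin i j true true false))).prod := by
    intro K
    induction K with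
    | nil => simp
    | cons a K ih =>
      simp only [List.map_cons, List.prod_cons]
      have := mul_le_mul' (IMFactor.eval_pin i j hij a) ih
      calc _ = _ := mul_mul_mul_comm _ _ _ _
        _ ≤ _ := this
        _ = _ := mul_mul_mul_comm _ _ _ _
  obtain ⟨K₁, K₂, rfl⟩ := List.append_of_mem hmem
  have h1 := h0 (pin i j false true false)
  have h2 := h0 (pin i j true false false)
  simp only [hL, List.map_append, List.map_cons, List.prod_append, List.prod_cons] at h1 h2 ⊢
  have e1 : IMFactor.eval (pin i j false true false) (.imp i j hij l hl) = 1 := by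
    simp [IMFactor.eval, pin, hij.symm, table2]
  have e2 : IMFactor.eval (pin i j true false false) (.imp i j hij l hl) = l := by
    simp [IMFactor.eval, pin, hij.symm, table2]
  have e3 : IMFactor.eval (pin i j false false false) (.imp i j hij l hl) = 1 := by
    simp [IMFactor.eval, pin, table2]
  have e4 : IMFactor.eval (pin i j true true false) (.imp i j hij l hl) = 1 := by
    simp [IMFactor.eval, pin, hij.symm, table2]
  rw [e1, e2] at *
  -- The weak inequality for the factors before and after the strict one is multiplied by `l < 1`;
  -- positivity keeps the result strict.
  rw [e3, e4]
  have hK₁ := hle K₁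
  have hK₂ := hle K₂
  generalize (K₁.map (IMFactor.eval (pin i j false true false))).prod = a1 at *
  generalize (K₁.map (IMFactor.eval (pin i j true false false))).prod = a2 at *
  generalize (K₂.map (IMFactor.eval (pin i j false true false))).prod = b1 at *
  generalize (K₂.map (IMFactor.eval (pin i j true false false))).prod = b2 at *
  have hpos : 0 < a1 * a2 * (b1 * b2) := by
    simp only [mul_eq_zero, not_or, ne_eq] at h1 h2
    exact pos_iff_ne_zero.2 (by simp [h1, h2])
  calc a1 * (1 * b1) * (a2 * (l * b2)) = l * (a1 * a2 * (b1 * b2)) := by ring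
    _ < 1 * (a1 * a2 * (b1 * b2)) := by gcongr
    _ ≤ _ := by
      rw [one_mul]
      refine (mul_le_mul' hK₁ hK₂).trans (le_of_eq (by ring))

/-! ### Constraint applications with natural numbers as variables -/

/-- The number of variables grows during the construction; natural numbers as variables avoid
transporting scopes between different `Fin n`. -/
structure Raw where
  con : Constraint
  scope : Fin con.arity → ℕ

def Raw.code (c : Raw) : List ℝ :=
  List.ofFn (fun j => (c.scope j : ℝ)) ++ -1 :: (c.con.table ++ [-1])

def Raw.eval (c : Raw) (σ : ℕ → Bool) : ℝ≥0 := c.con.val fun j => σ (c.scope j)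

def Applied.raw {n : ℕ} (c : Applied n) : Raw := ⟨c.con, fun j => c.scope j⟩

def rawValue (L : List Raw) (σ : ℕ → Bool) : ℝ≥0 := (L.map fun c => c.eval σ).prod

lemma rawValue_cons (c : Raw) (L : List Raw) (σ : ℕ → Bool) :
    rawValue (c :: L) σ = c.eval σ * rawValue L σ := by simp [rawValue]

lemma rawValue_append (K L : List Raw) (σ : ℕ → Bool) :
    rawValue (K ++ L) σ = rawValue K σ * rawValue L σ := by simp [rawValue]

lemma Raw.eval_congr {c : Raw} {σ τ : ℕ → Bool} (h : ∀ j, σ (c.scope j) = τ (c.scope j)) :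
    c.eval σ = c.eval τ := by
  simp only [Raw.eval, h]

lemma rawValue_congr {L : List Raw} {σ τ : ℕ → Bool}
    (h : ∀ c ∈ L, ∀ j, σ (c.scope j) = τ (c.scope j)) : rawValue L σ = rawValue L τ := by
  simp only [rawValue]
  congr 1
  exact List.map_congr_left fun c hc => Raw.eval_congr (h c hc)

/-- The unary constraint `(u, v)` applied to `x`. -/
def unaryRaw (u v : ℝ≥0) (x : ℕ) : Raw := ⟨⟨1, fun p => if p 0 then v else u⟩, fun _ => x⟩

lemma unaryRaw_eval (u v : ℝ≥0) (x : ℕ) (σ : ℕ → Bool) :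
    (unaryRaw u v x).eval σ = if σ x then v else u := rfl

/-- A positive constraint together with two positions at which its pinning is strictly
log-supermodular. -/
structure Pinnable where
  f : Constraint
  i : Fin f.arity
  j : Fin f.arity
  ne : i ≠ j
  pos : ∀ x, f.val x ≠ 0
  lt : f.val (pin i j false true false) * f.val (pin i j true false false) <
        f.val (pin i j false false false) * f.val (pin i j true true false)

namespace Pinnable
variable (G : Pinnable)

def bin (x y : Bool) : ℝ≥0 := G.f.val (pin G.i G.j x y false)

lemma bin_ne_zero (x y : Bool) : G.bin x y ≠ 0 := G.pos _

/-- The weights `alpha` (for `x = 1`) and `beta` (for `y = 1`) are the solution of the two equations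
that make the values at `01` and `11` equal to the value at `00`; `lam` is what is then left at
`10`, relative to `base`. -/
def base : ℝ≥0 := G.bin false false
def alpha : ℝ≥0 := G.bin false true / G.bin true true
def beta : ℝ≥0 := G.bin false false / G.bin false true
def lam : ℝ≥0 := G.bin false true * G.bin true false / (G.bin false false * G.bin true true)

lemma base_pos : 0 < G.base := pos_iff_ne_zero.2 (G.bin_ne_zero _ _)
lemma alpha_pos : 0 < G.alpha := pos_iff_ne_zero.2 (div_ne_zero (G.bin_ne_zero _ _) (G.bin_ne_zero _ _))
lemma beta_pos : 0 < G.beta := pos_iff_ne_zero.2 (div_ne_zero (G.bin_ne_zero _ _) (G.bin_ne_zero _ _))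
lemma lam_pos : 0 < G.lam := pos_iff_ne_zero.2 (div_ne_zero (mul_ne_zero (G.bin_ne_zero _ _)
  (G.bin_ne_zero _ _)) (mul_ne_zero (G.bin_ne_zero _ _) (G.bin_ne_zero _ _)))
lemma lam_lt_one : G.lam < 1 := by
  rw [lam, div_lt_one (pos_iff_ne_zero.2 (mul_ne_zero (G.bin_ne_zero _ _) (G.bin_ne_zero _ _)))]
  exact G.lt

lemma bin_normalize (x y : Bool) :
    G.bin x y * ((if x then G.alpha else 1) * (if y then G.beta else 1)) =
      G.base * table2 1 1 G.lam 1 x y := by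
  have h1 := G.bin_ne_zero false true
  have h2 := G.bin_ne_zero true true
  have h3 := G.bin_ne_zero false false
  cases x <;> cases y <;> simp [base, alpha, beta, lam, table2] <;> field_simp

/-- The pinned constraint, applied to `x` and `y`; the variable `o` is to have the value
`false`. -/
def app (x y o : ℕ) : Raw := ⟨G.f, pin G.i G.j x y o⟩

lemma app_eval (x y o : ℕ) {σ : ℕ → Bool} (ho : σ o = false) :
    (G.app x y o).eval σ = G.bin (σ x) (σ y) := by
  simp only [Raw.eval, app, bin]
  rw [pin_comp, ho]

/-- One copy of `(1, 1, lam, 1)` on `x`, `y`, through the new variable `v`. The unary constraints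
on `x` and `y` are told apart from all others by their value at `false`. -/
def copyApps (x y o v : ℕ) (T : ℝ≥0) : List Raw :=
  [G.app v y o, G.app x v o, unaryRaw 1 (G.alpha * G.beta) v,
    unaryRaw (T + 1) ((T + 1) * G.beta) y, unaryRaw T (T * G.alpha) x]

/-- The new variable is second argument in one application and first in the other, hence its
correction `alpha * beta`; `T` and `T + 1` come out as a constant. -/
lemma copyApps_value (x y o v : ℕ) (T : ℝ≥0) {σ : ℕ → Bool} (ho : σ o = false) :
    rawValue (G.copyApps x y o v T) σ = T * (T + 1) * G.base * G.base *
      (table2 1 1 G.lam 1 (σ x) (σ v) * table2 1 1 G.lam 1 (σ v) (σ y)) := by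
  have h1 := G.bin_normalize (σ x) (σ v)
  have h2 := G.bin_normalize (σ v) (σ y)
  simp only [copyApps, rawValue_cons, app_eval _ _ _ _ ho, unaryRaw_eval]
  simp only [rawValue, List.map_nil, List.prod_nil]
  calc _ = T * (T + 1) * (G.bin (σ x) (σ v) *
        ((if σ x then G.alpha else 1) * (if σ v then G.beta else 1))) *
        (G.bin (σ v) (σ y) * ((if σ v then G.alpha else 1) * (if σ y then G.beta else 1))) := by
        split_ifs <;> ring
    _ = _ := by rw [h1, h2]; ring

end Pinnable

/-- A violation `x = 1`, `y = 0` is a violation on one of the two legs, whatever the middle value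
is. -/
lemma table2_trans_le {l : ℝ≥0} (hl : l ≤ 1) (x y z : Bool) :
    table2 1 1 l 1 x z * table2 1 1 l 1 z y ≤ table2 1 1 l 1 x y := by
  cases x <;> cases y <;> cases z <;> simp [table2, hl]

lemma table2_trans_self {l : ℝ≥0} (x y : Bool) :
    table2 1 1 l 1 x y * table2 1 1 l 1 y y = table2 1 1 l 1 x y := by
  cases x <;> cases y <;> simp [table2]

/-! ### The instance produced by the reduction -/

/-- Constraint applications, the number of variables in use, and a number above all values at
`false … false`. -/
structure Partial where
  L : List Raw
  v : ℕ
  T : ℝ≥0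

namespace Pinnable
variable (G : Pinnable)

def copy (o x y : ℕ) (s : Partial) : Partial :=
  ⟨G.copyApps x y o s.v s.T ++ s.L, s.v + 1, s.T + 2⟩

def copies (o m : ℕ) (x y : ℕ) (s : Partial) : Partial := (G.copy o x y)^[m] s

def replaceAll (o m : ℕ) (l : List (ℕ × ℕ)) (s : Partial) : Partial :=
  l.foldl (fun s p => G.copies o m p.1 p.2 s) s

end Pinnable

/-! ### Distinctness of the applications -/

/-- The syntactic invariant of the construction. -/
structure Partial.Valid (G : Pinnable) (S : Set Constraint) (o : ℕ) (s : Partial) : Prop where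
  nodup : s.L.Nodup
  scope_lt : ∀ c ∈ s.L, ∀ j, c.scope j < s.v
  val_lt : ∀ c ∈ s.L, c.con.val (fun _ => false) < s.T
  mem : ∀ c ∈ s.L, c.con ∈ S
  o_lt : o < s.v
  one_lt : 1 < s.T
  base_lt : G.base < s.T

lemma pin_self {k : ℕ} (i j : Fin k) {α : Type} (x : α) : pin i j x x x = fun _ => x := by
  funext p; simp [pin]

/-- Applications that contain the new variable are new; the two unary constraints on old variables
are new because their values at `false` exceed all earlier ones. -/
lemma Partial.Valid.copy {G : Pinnable} {S : Set Constraint} {o : ℕ} {s : Partial}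
    (h : s.Valid G S o) (hS : G.f ∈ S) (hU : Unary ⊆ S) {x y : ℕ} (hx : x < s.v) (hy : y < s.v) :
    (G.copy o x y s).Valid G S o := by
  have hb : G.f.val (fun _ => false) = G.base := by
    rw [Pinnable.base, Pinnable.bin, pin_self]
  have hvi : ∀ a, (G.app s.v a o).scope G.i = s.v := fun a => by simp [Pinnable.app, pin]
  have hvj : ∀ a, (G.app a s.v o).scope G.j = s.v := fun a => by
    simp [Pinnable.app, pin, G.ne.symm]
  have f1 : unaryRaw s.T (s.T * G.alpha) x ∉ s.L := fun hm => by
    have := h.val_lt _ hm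
    simp [unaryRaw] at this
  have f2 : unaryRaw (s.T + 1) ((s.T + 1) * G.beta) y ∉ unaryRaw s.T (s.T * G.alpha) x :: s.L := by
    intro hm
    have : (unaryRaw (s.T + 1) ((s.T + 1) * G.beta) y).con.val (fun _ => false) < s.T + 1 := by
      rcases List.mem_cons.1 hm with he | hm
      · rw [he]; simp [unaryRaw]
      · exact (h.val_lt _ hm).trans (by simp)
    simp [unaryRaw] at this
  have old : ∀ c ∈ unaryRaw (s.T + 1) ((s.T + 1) * G.beta) y :: unaryRaw s.T (s.T * G.alpha) x :: s.L,
      ∀ j, c.scope j < s.v := by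
    intro c hc
    rcases List.mem_cons.1 hc with rfl | hc
    · intro j; exact hy
    rcases List.mem_cons.1 hc with rfl | hc
    · intro j; exact hx
    exact h.scope_lt c hc
  have f3 : unaryRaw 1 (G.alpha * G.beta) s.v ∉
      unaryRaw (s.T + 1) ((s.T + 1) * G.beta) y :: unaryRaw s.T (s.T * G.alpha) x :: s.L := fun hm =>
    lt_irrefl _ (old _ hm (0 : Fin 1))
  -- Two different positions force arity at least 2.
  have hfU : ∀ a b u v z, G.app a b o ≠ unaryRaw u v z := by
    intro a b u v z he
    have h1 : G.f.arity = 1 := congrArg (fun c : Raw => c.con.arity) he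
    apply G.ne
    have hi := G.i.2
    have hj := G.j.2
    ext
    omega
  have f4 : G.app x s.v o ∉ unaryRaw 1 (G.alpha * G.beta) s.v ::
      unaryRaw (s.T + 1) ((s.T + 1) * G.beta) y :: unaryRaw s.T (s.T * G.alpha) x :: s.L := by
    intro hm
    rcases List.mem_cons.1 hm with he | hm
    · exact hfU _ _ _ _ _ he
    · have := old _ hm G.j
      rw [hvj] at this
      exact lt_irrefl _ this
  have f5 : G.app s.v y o ∉ G.app x s.v o :: unaryRaw 1 (G.alpha * G.beta) s.v ::
      unaryRaw (s.T + 1) ((s.T + 1) * G.beta) y :: unaryRaw s.T (s.T * G.alpha) x :: s.L := by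
    intro hm
    -- Position `i` carries the new variable in one application and the older `x` in the other.
    rcases List.mem_cons.1 hm with he | hm
    · simp only [Pinnable.app, Raw.mk.injEq, heq_eq_eq, true_and] at he
      have := congrFun he G.i
      simp [pin] at this
      omega
    rcases List.mem_cons.1 hm with he | hm
    · exact hfU _ _ _ _ _ he
    · have := old _ hm G.i
      rw [hvi] at this
      exact lt_irrefl _ this
  have ho := h.o_lt
  have hT : s.T < s.T + 2 := by simp
  have hpin : ∀ a b, a < s.v + 1 → b < s.v + 1 → ∀ j, (G.app a b o).scope j < s.v + 1 := by
    intro a b ha hb j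
    simp only [Pinnable.app, pin]
    split_ifs <;> omega
  refine ⟨?_, ?_, ?_, ?_, by simp [Pinnable.copy]; omega, h.one_lt.trans hT, h.base_lt.trans hT⟩
  · simp only [Pinnable.copy, Pinnable.copyApps, List.cons_append, List.nil_append]
    exact .cons f5 (.cons f4 (.cons f3 (.cons f2 (.cons f1 h.nodup))))
  · intro c hc
    simp only [Pinnable.copy, Pinnable.copyApps, List.cons_append, List.nil_append,
      List.mem_cons] at hc ⊢
    rcases hc with rfl | rfl | rfl | hc
    · exact hpin _ _ (by omega) (by omega)
    · exact hpin _ _ (by omega) (by omega)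
    · intro j; simp [unaryRaw]
    · exact fun j => (old c (by simpa using hc) j).trans (by omega)
  · intro c hc
    simp only [Pinnable.copy, Pinnable.copyApps, List.cons_append, List.nil_append,
      List.mem_cons] at hc ⊢
    rcases hc with rfl | rfl | rfl | rfl | rfl | hc
    · simp only [Pinnable.app, hb]; exact h.base_lt.trans hT
    · simp only [Pinnable.app, hb]; exact h.base_lt.trans hT
    · simpa [unaryRaw] using h.one_lt.trans hT
    · simp only [unaryRaw]
      simp
    · simp [unaryRaw]
    · exact (h.val_lt c hc).trans hT
  · intro c hc
    simp only [Pinnable.copy, Pinnable.copyApps, List.cons_append, List.nil_append,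
      List.mem_cons] at hc ⊢
    rcases hc with rfl | rfl | rfl | rfl | rfl | hc
    · exact hS
    · exact hS
    · exact hU rfl
    · exact hU rfl
    · exact hU rfl
    · exact h.mem c hc

lemma Pinnable.copies_v (G : Pinnable) (o m x y : ℕ) (s : Partial) :
    (G.copies o m x y s).v = s.v + m := by
  induction m generalizing s with
  | zero => rfl
  | succ m ih =>
    rw [Pinnable.copies, Function.iterate_succ_apply]
    exact (ih _).trans (by simp [Pinnable.copy]; omega)

lemma Pinnable.copies_T (G : Pinnable) (o m x y : ℕ) (s : Partial) :
    (G.copies o m x y s).T = s.T + 2 * m := by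
  induction m generalizing s with
  | zero => simp [Pinnable.copies]
  | succ m ih =>
    rw [Pinnable.copies, Function.iterate_succ_apply]
    refine (ih _).trans ?_
    simp only [Pinnable.copy]
    push_cast
    ring

lemma Partial.Valid.copies {G : Pinnable} {S : Set Constraint} {o : ℕ} {s : Partial}
    (h : s.Valid G S o) (hS : G.f ∈ S) (hU : Unary ⊆ S) (m : ℕ) {x y : ℕ}
    (hx : x < s.v) (hy : y < s.v) : (G.copies o m x y s).Valid G S o := by
  induction m generalizing s with
  | zero => exact h
  | succ m ih =>
    rw [Pinnable.copies, Function.iterate_succ_apply]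
    exact ih (h.copy hS hU hx hy) (hx.trans (by simp [Pinnable.copy]))
      (hy.trans (by simp [Pinnable.copy]))

lemma Partial.Valid.replaceAll {G : Pinnable} {S : Set Constraint} {o : ℕ} (hS : G.f ∈ S)
    (hU : Unary ⊆ S) (m : ℕ) {l : List (ℕ × ℕ)} {s : Partial} (h : s.Valid G S o)
    (hl : ∀ p ∈ l, p.1 < s.v ∧ p.2 < s.v) : (G.replaceAll o m l s).Valid G S o := by
  induction l generalizing s with
  | nil => exact h
  | cons p l ih =>
    have hp := hl p (by simp)
    refine ih (h.copies hS hU m hp.1 hp.2) fun r hr => ?_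
    have := hl r (by simp [hr])
    rw [Pinnable.copies_v]
    omega

/-! ### The weight that the gadgets represent -/

/-- `s` represents the weight `H` up to the scale `C`: on assignments with `σ o = false`, `C * H` is
the largest value over all choices of the variables from `o + 1` on. -/
structure Partial.Represents (o : ℕ) (s : Partial) (H : (ℕ → Bool) → ℝ≥0) (C : ℝ≥0) : Prop where
  lt : o < s.v
  pos : 0 < C
  scope_lt : ∀ c ∈ s.L, ∀ j, c.scope j < s.v
  le : ∀ σ, σ o = false → rawValue s.L σ ≤ C * H σ
  attained : ∀ σ, σ o = false → ∃ τ, (∀ i ≤ o, τ i = σ i) ∧ rawValue s.L τ = C * H σ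

/-- Older applications do not see the new variable, so maximizing over it affects only the new
factor. -/
lemma Partial.Represents.copy {G : Pinnable} {o : ℕ} {s : Partial} {H : (ℕ → Bool) → ℝ≥0}
    {C : ℝ≥0} (h : s.Represents o H C) (hT : 0 < s.T) {x y : ℕ} (hx : x < o) (hy : y < o) :
    (G.copy o x y s).Represents o (fun σ => table2 1 1 G.lam 1 (σ x) (σ y) * H σ)
      (s.T * (s.T + 1) * G.base * G.base * C) := by
  have hlt := h.lt
  refine ⟨by simp [Pinnable.copy]; omega, ?_, ?_, ?_, ?_⟩
  · have := G.base_pos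
    have := h.pos
    positivity
  · intro c hc
    simp only [Pinnable.copy, Pinnable.copyApps, List.cons_append, List.nil_append,
      List.mem_cons] at hc ⊢
    rcases hc with rfl | rfl | rfl | rfl | rfl | hc
    · intro j; simp only [Pinnable.app, pin]; split_ifs <;> omega
    · intro j; simp only [Pinnable.app, pin]; split_ifs <;> omega
    · intro j; simp [unaryRaw]
    · intro j; simp only [unaryRaw]; omega
    · intro j; simp only [unaryRaw]; omega
    · intro j; have := h.scope_lt c hc j; omega
  · intro σ hσ
    simp only [Pinnable.copy, rawValue_append, G.copyApps_value x y o s.v s.T hσ]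
    calc _ ≤ s.T * (s.T + 1) * G.base * G.base * table2 1 1 G.lam 1 (σ x) (σ y) * (C * H σ) := by
          gcongr
          · exact table2_trans_le G.lam_lt_one.le _ _ _
          · exact h.le σ hσ
      _ = _ := by ring
  · intro σ hσ
    obtain ⟨τ, h1, h2⟩ := h.attained σ hσ
    -- The middle variable copies `y`: the leg from `x` then has the full weight and the leg to `y`
    -- has weight 1.
    refine ⟨Function.update τ s.v (σ y), fun i hi => ?_, ?_⟩
    · rw [Function.update_of_ne (by omega), h1 i hi]
    · have hne : ∀ i, i ≤ o → Function.update τ s.v (σ y) i = σ i := fun i hi => by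
        rw [Function.update_of_ne (by omega), h1 i hi]
      simp only [Pinnable.copy, rawValue_append]
      rw [G.copyApps_value x y o s.v s.T (by rw [hne o le_rfl, hσ]), hne x hx.le, hne y hy.le,
        Function.update_self, table2_trans_self,
        rawValue_congr (τ := τ) fun c hc j => Function.update_of_ne (h.scope_lt c hc j).ne _ _, h2]
      ring

lemma table2_pow (l : ℝ≥0) (m : ℕ) (x y : Bool) :
    table2 1 1 l 1 x y ^ m = table2 1 1 (l ^ m) 1 x y := by
  cases x <;> cases y <;> simp [table2]

lemma Partial.Represents.copies {G : Pinnable} {o : ℕ} {s : Partial} {H : (ℕ → Bool) → ℝ≥0}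
    {C : ℝ≥0} (h : s.Represents o H C) (hT : 0 < s.T) (m : ℕ) {x y : ℕ} (hx : x < o) (hy : y < o) :
    ∃ C', (G.copies o m x y s).Represents o
      (fun σ => table2 1 1 (G.lam ^ m) 1 (σ x) (σ y) * H σ) C' := by
  simp only [← table2_pow]
  induction m generalizing s H C with
  | zero => exact ⟨C, by simpa [Pinnable.copies] using h⟩
  | succ m ih =>
    obtain ⟨C', h'⟩ := ih (h.copy (G := G) hT hx hy) (hT.trans (by simp [Pinnable.copy]))
    refine ⟨C', ?_⟩
    rw [Pinnable.copies, Function.iterate_succ_apply]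
    simp only [pow_succ, mul_assoc]
    exact h'

/-- The weight of the conjunction of implications, softened to `l`. -/
def softWeight (l : ℝ≥0) (p : List (ℕ × ℕ)) (σ : ℕ → Bool) : ℝ≥0 :=
  (p.map fun p => table2 1 1 l 1 (σ p.1) (σ p.2)).prod

lemma Partial.Represents.replaceAll {G : Pinnable} {o m : ℕ} {l : List (ℕ × ℕ)} {s : Partial}
    {H : (ℕ → Bool) → ℝ≥0} {C : ℝ≥0} (h : s.Represents o H C) (hT : 0 < s.T)
    (hl : ∀ p ∈ l, p.1 < o ∧ p.2 < o) :
    ∃ C', (G.replaceAll o m l s).Represents o (fun σ => softWeight (G.lam ^ m) l σ * H σ) C' := by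
  induction l generalizing s H C with
  | nil => exact ⟨C, by simpa [Pinnable.replaceAll, softWeight] using h⟩
  | cons p l ih =>
    have hp := hl p (by simp)
    obtain ⟨C₁, h₁⟩ := h.copies (G := G) hT m hp.1 hp.2
    obtain ⟨C₂, h₂⟩ := ih h₁ (by rw [Pinnable.copies_T]; positivity) fun r hr => hl r (by simp [hr])
    refine ⟨C₂, ?_⟩
    have he : (fun σ => softWeight (G.lam ^ m) (p :: l) σ * H σ) = fun σ =>
        softWeight (G.lam ^ m) l σ * (table2 1 1 (G.lam ^ m) 1 (σ p.1) (σ p.2) * H σ) := by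
      funext σ
      simp only [softWeight, List.map_cons, List.prod_cons]
      ring
    rw [he]
    exact h₂

/-! ### Separating the implications from the other constraints -/

/-- The table of `Implies`. -/
def impTable : List ℝ := [1, 1, 0, 1]

lemma Implies_table : Implies.table = impTable := by
  simp [Constraint.table, Implies, points, impTable, table2]

lemma eq_of_table_eq {f g : Constraint} (hk : f.arity = g.arity) (h : f.table = g.table) : f = g := by
  obtain ⟨k, f⟩ := f
  obtain ⟨l, g⟩ := g
  simp only at hk
  subst hk
  congr 1
  funext x
  have := List.map_inj_left.1 h x (mem_points k x)
  exact_mod_cast this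

lemma points_length (k : ℕ) : (points k).length = 2 ^ k := by
  induction k with
  | zero => rfl
  | succ k ih => simp [points, ih, pow_succ]; ring

/-- A table of arity `k` has `2 ^ k` entries, so the table determines the arity. This lets the
machine recognize `Implies` from the table alone. -/
lemma eq_Implies_of_table {f : Constraint} (h : f.table = impTable) : f = Implies := by
  refine eq_of_table_eq ?_ (h.trans Implies_table.symm)
  have h2 : f.table.length = 2 ^ 2 := by rw [h]; rfl
  rw [Constraint.table, List.length_map, points_length] at h2
  exact Nat.pow_right_injective le_rfl h2

/-- The first two variables of an application. -/
def Raw.pair (c : Raw) : ℕ × ℕ := ((List.ofFn c.scope).getD 0 0, (List.ofFn c.scope).getD 1 0)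

open Classical in
/-- The applications of other constraints than `Implies`, last first. -/
def others (L : List Raw) : List Raw := (L.filter fun c => c.con.table ≠ impTable).reverse

open Classical in
/-- The pairs to which `Implies` is applied, last first. -/
def impPairs (L : List Raw) : List (ℕ × ℕ) :=
  ((L.filter fun c => c.con.table = impTable).map Raw.pair).reverse

lemma others_cons_of_ne {c : Raw} {L : List Raw} (h : c.con.table ≠ impTable) :
    others (c :: L) = others L ++ [c] := by simp [others, h]

lemma others_cons_of_eq {c : Raw} {L : List Raw} (h : c.con.table = impTable) :
    others (c :: L) = others L := by simp [others, h]

lemma impPairs_cons_of_ne {c : Raw} {L : List Raw} (h : c.con.table ≠ impTable) :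
    impPairs (c :: L) = impPairs L := by simp [impPairs, h]

lemma impPairs_cons_of_eq {c : Raw} {L : List Raw} (h : c.con.table = impTable) :
    impPairs (c :: L) = impPairs L ++ [c.pair] := by simp [impPairs, h]

lemma mem_others {c : Raw} {L : List Raw} : c ∈ others L ↔ c ∈ L ∧ c.con.table ≠ impTable := by
  simp [others]

lemma impPairs_length_le (L : List Raw) : (impPairs L).length ≤ L.length := by
  simpa [impPairs] using List.length_filter_le _ L

lemma impPairs_lt {L : List Raw} {n : ℕ} (hL : ∀ c ∈ L, ∀ j, c.scope j < n) :
    ∀ p ∈ impPairs L, p.1 < n ∧ p.2 < n := by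
  intro p hp
  simp only [impPairs, List.mem_reverse, List.mem_map, List.mem_filter, decide_eq_true_eq] at hp
  obtain ⟨⟨f, u⟩, ⟨hc, ht⟩, rfl⟩ := hp
  obtain rfl := eq_Implies_of_table ht
  exact ⟨hL _ hc (0 : Fin 2), hL _ hc (1 : Fin 2)⟩

lemma rawValue_split (L : List Raw) (σ : ℕ → Bool) :
    rawValue L σ = softWeight 0 (impPairs L) σ * rawValue (others L) σ := by
  induction L with
  | nil => simp [rawValue, softWeight, impPairs, others]
  | cons c L ih =>
    rw [rawValue_cons, ih]
    by_cases h : c.con.table = impTable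
    · rw [others_cons_of_eq h, impPairs_cons_of_eq h]
      have : c.eval σ = table2 1 1 0 1 (σ c.pair.1) (σ c.pair.2) := by
        obtain ⟨f, u⟩ := c
        obtain rfl := eq_Implies_of_table h
        rfl
      rw [this]
      simp only [softWeight, List.map_append, List.prod_append, List.map_cons, List.map_nil,
        List.prod_cons, List.prod_nil]
      ring
    · rw [others_cons_of_ne h, impPairs_cons_of_ne h, rawValue_append, rawValue_cons]
      simp only [rawValue, List.map_nil, List.prod_nil]
      ring

/-! ### Extreme values and softened implications -/

/-- A bound for the values of a constraint and for the inverses of its nonzero values. -/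
def spread (f : Constraint) : ℝ≥0 :=
  ((points f.arity).map fun x => 1 + f.val x + (f.val x)⁻¹).prod

lemma one_le_prod_map {α : Type} (l : List α) (u : α → ℝ≥0) (h : ∀ a ∈ l, 1 ≤ u a) :
    1 ≤ (l.map u).prod := by
  induction l with
  | nil => simp
  | cons a l ih =>
    simp only [List.map_cons, List.prod_cons]
    exact one_le_mul (h a (by simp)) (ih fun b hb => h b (by simp [hb]))

lemma le_prod_map {α : Type} {l : List α} {u : α → ℝ≥0} (h : ∀ a ∈ l, 1 ≤ u a) {a : α}
    (ha : a ∈ l) : u a ≤ (l.map u).prod := by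
  induction l with
  | nil => simp at ha
  | cons b l ih =>
    simp only [List.map_cons, List.prod_cons]
    rcases List.mem_cons.1 ha with rfl | ha
    · exact le_mul_of_one_le_right' (one_le_prod_map l u fun b hb => h b (by simp [hb]))
    · exact (ih (fun b hb => h b (by simp [hb])) ha).trans
        (le_mul_of_one_le_left' (h b (by simp)))

lemma le_spread (f : Constraint) (x : Fin f.arity → Bool) :
    1 + f.val x + (f.val x)⁻¹ ≤ spread f :=
  le_prod_map (u := fun x => 1 + f.val x + (f.val x)⁻¹)
    (fun a _ => by rw [add_assoc]; exact le_self_add) (mem_points _ x)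

lemma one_le_spread (f : Constraint) : 1 ≤ spread f :=
  one_le_prod_map _ _ fun a _ => by rw [add_assoc]; exact le_self_add

lemma val_le_spread (f : Constraint) (x : Fin f.arity → Bool) : f.val x ≤ spread f :=
  le_trans (le_add_right le_add_self) (le_spread f x)

lemma one_le_spread_mul (f : Constraint) {x : Fin f.arity → Bool} (h : f.val x ≠ 0) :
    1 ≤ spread f * f.val x := by
  calc 1 = (f.val x)⁻¹ * f.val x := (inv_mul_cancel₀ h).symm
    _ ≤ _ := by gcongr; exact le_add_self.trans (le_spread f x)

def totalSpread (L : List Raw) : ℝ≥0 := (L.map fun c => spread c.con).prod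

lemma one_le_totalSpread (L : List Raw) : 1 ≤ totalSpread L :=
  one_le_prod_map _ _ fun _ _ => one_le_spread _

lemma val_le_totalSpread {L : List Raw} {c : Raw} (hc : c ∈ L) (x : Fin c.con.arity → Bool) :
    c.con.val x ≤ totalSpread L :=
  (val_le_spread _ _).trans
    (le_prod_map (u := fun c : Raw => spread c.con) (fun _ _ => one_le_spread _) hc)

lemma rawValue_others_le (L : List Raw) (σ : ℕ → Bool) : rawValue (others L) σ ≤ totalSpread L := by
  induction L with
  | nil => simp [others, rawValue, totalSpread]
  | cons c L ih =>
    have e : totalSpread (c :: L) = spread c.con * totalSpread L := by simp [totalSpread]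
    rw [e]
    by_cases h : c.con.table = impTable
    · rw [others_cons_of_eq h]
      exact ih.trans (le_mul_of_one_le_left' (one_le_spread _))
    · rw [others_cons_of_ne h, rawValue_append, rawValue_cons, mul_comm]
      refine mul_le_mul' ?_ ih
      simpa [rawValue, Raw.eval] using val_le_spread c.con _

/-- The lower half of the gap argument: nonzero products are at least the inverse of the spread.
Factors of the spread that belong to implications are at least 1 and do no harm. -/
lemma one_le_totalSpread_mul {L : List Raw} {σ : ℕ → Bool} (h0 : rawValue (others L) σ ≠ 0) :
    1 ≤ totalSpread L * rawValue (others L) σ := by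
  induction L with
  | nil => simp [others, rawValue, totalSpread]
  | cons c L ih =>
    have e : totalSpread (c :: L) = spread c.con * totalSpread L := by simp [totalSpread]
    rw [e]
    by_cases h : c.con.table = impTable
    · rw [others_cons_of_eq h] at h0 ⊢
      rw [mul_assoc]
      exact one_le_mul (one_le_spread _) (ih h0)
    · have e2 : rawValue (others (c :: L)) σ = c.eval σ * rawValue (others L) σ := by
        rw [others_cons_of_ne h, rawValue_append, rawValue_cons]
        simp [rawValue, mul_comm]
      rw [e2] at h0 ⊢
      rw [mul_mul_mul_comm]
      exact one_le_mul (one_le_spread_mul _ (left_ne_zero_of_mul h0))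
        (ih (right_ne_zero_of_mul h0))

lemma softWeight_of_ne_zero {p : List (ℕ × ℕ)} {σ : ℕ → Bool} (h : softWeight 0 p σ ≠ 0)
    (l : ℝ≥0) : softWeight l p σ = 1 := by
  induction p with
  | nil => simp [softWeight]
  | cons r p ih =>
    simp only [softWeight, List.map_cons, List.prod_cons] at h ih ⊢
    rw [ih (right_ne_zero_of_mul h), mul_one]
    have := left_ne_zero_of_mul h
    revert this
    cases σ r.1 <;> cases σ r.2 <;> simp [table2]

lemma softWeight_le_one {l : ℝ≥0} (hl : l ≤ 1) (p : List (ℕ × ℕ)) (σ : ℕ → Bool) :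
    softWeight l p σ ≤ 1 := by
  induction p with
  | nil => simp [softWeight]
  | cons r p ih =>
    simp only [softWeight, List.map_cons, List.prod_cons] at ih ⊢
    refine mul_le_one' ?_ ih
    cases σ r.1 <;> cases σ r.2 <;> simp [table2, hl]

/-- One violated implication contributes the factor `l`, all others at most 1. -/
lemma softWeight_of_eq_zero {p : List (ℕ × ℕ)} {σ : ℕ → Bool} (h : softWeight 0 p σ = 0)
    {l : ℝ≥0} (hl : l ≤ 1) : softWeight l p σ ≤ l := by
  induction p with
  | nil => simp [softWeight] at h
  | cons r p ih =>
    have h1 := softWeight_le_one hl p σ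
    simp only [softWeight, List.map_cons, List.prod_cons] at h h1 ih ⊢
    rcases mul_eq_zero.1 h with h | h
    · have : table2 1 1 l 1 (σ r.1) (σ r.2) = l := by
        revert h
        cases σ r.1 <;> cases σ r.2 <;> simp [table2]
      rw [this]
      exact mul_le_of_le_one_right' h1
    · have : table2 1 1 l 1 (σ r.1) (σ r.2) ≤ 1 := by
        cases σ r.1 <;> cases σ r.2 <;> simp [table2, hl]
      exact (mul_le_of_le_one_left' this).trans (ih h)

/-! ### Correctness of the construction -/

namespace Pinnable
variable (G : Pinnable)

/-- The constraints other than `Implies`, and a variable `n` pinned to `false`. -/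
def initial (n : ℕ) (L : List Raw) : Partial :=
  ⟨unaryRaw 1 0 n :: others L, n + 1, totalSpread L + G.base⟩

def result (n m : ℕ) (L : List Raw) : Partial := G.replaceAll n m (impPairs L) (G.initial n L)

lemma initial_valid {n : ℕ} {L : List Raw} {S : Set Constraint} (hL : L.Nodup)
    (hn : ∀ c ∈ L, ∀ j, c.scope j < n) (hS : ∀ c ∈ L, c.con ≠ Implies → c.con ∈ S)
    (hU : Unary ⊆ S) : (G.initial n L).Valid G S n := by
  have hb := G.base_pos
  -- The summand `base` makes the starting scale strictly larger than all given values; the spread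
  -- makes it strictly larger than `base`.
  have hone : 1 < totalSpread L + G.base :=
    lt_add_of_le_of_pos (one_le_totalSpread L) hb
  refine ⟨?_, ?_, ?_, ?_, by simp [initial], hone, ?_⟩
  · refine .cons ?_ ?_
    · intro h
      exact lt_irrefl _ (hn _ (mem_others.1 h).1 (0 : Fin 1))
    · exact List.nodup_reverse.2 (hL.filter _)
  · intro c hc
    rcases List.mem_cons.1 hc with rfl | hc
    · intro j; simp [unaryRaw, initial]
    · intro j
      have := hn _ (mem_others.1 hc).1 j
      simp only [initial]
      omega
  · intro c hc
    rcases List.mem_cons.1 hc with rfl | hc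
    · simpa [unaryRaw, initial] using hone
    · exact lt_add_of_le_of_pos (val_le_totalSpread (mem_others.1 hc).1 _) hb
  · intro c hc
    rcases List.mem_cons.1 hc with rfl | hc
    · exact hU rfl
    · obtain ⟨h1, h2⟩ := mem_others.1 hc
      exact hS c h1 fun h => h2 (h ▸ Implies_table)
  · exact lt_add_of_pos_left _ (zero_lt_one.trans_le (one_le_totalSpread L))

lemma initial_represents {n : ℕ} {L : List Raw} (hn : ∀ c ∈ L, ∀ j, c.scope j < n) :
    (G.initial n L).Represents n (rawValue (others L)) 1 := by
  have e : ∀ σ : ℕ → Bool, σ n = false →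
      rawValue (G.initial n L).L σ = 1 * rawValue (others L) σ := by
    intro σ hσ
    simp [initial, rawValue_cons, unaryRaw_eval, hσ]
  refine ⟨by simp [initial], one_pos, ?_, fun σ hσ => (e σ hσ).le, fun σ hσ =>
    ⟨σ, fun _ _ => rfl, e σ hσ⟩⟩
  intro c hc
  rcases List.mem_cons.1 hc with rfl | hc
  · intro j; simp [unaryRaw, initial]
  · intro j
    have := hn _ (mem_others.1 hc).1 j
    simp only [initial]
    omega

/-- Needed to exclude assignments with `true` at the pinned variable, on which `Partial.Represents`
says nothing. -/
lemma mem_result (n m : ℕ) (L : List Raw) : unaryRaw 1 0 n ∈ (G.result n m L).L := by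
  have h1 : ∀ m x y s, unaryRaw 1 0 n ∈ s.L → unaryRaw 1 0 n ∈ (G.copies n m x y s).L := by
    intro m x y
    induction m with
    | zero => intro s h; exact h
    | succ m ih =>
      intro s h
      rw [copies, Function.iterate_succ_apply]
      exact ih _ (List.mem_append_right _ h)
  have h2 : ∀ l s, unaryRaw 1 0 n ∈ s.L → unaryRaw 1 0 n ∈ (G.replaceAll n m l s).L := by
    intro l
    induction l with
    | nil => intro s h; exact h
    | cons p l ih => intro s h; exact ih _ (h1 _ _ _ _ h)
  exact h2 _ _ (by simp [initial])

/-- A good assignment for the constructed instance is good for the given one. -/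
lemma le_of_result {n m : ℕ} {L : List Raw} (hn : ∀ c ∈ L, ∀ j, c.scope j < n)
    (hm : G.lam ^ m * (totalSpread L * totalSpread L) < 1 / 2) {K : ℝ≥0} (hK : K < 2)
    {σ : ℕ → Bool} (hσ : ∀ τ, rawValue (G.result n m L).L τ ≤ K * rawValue (G.result n m L).L σ)
    (τ : ℕ → Bool) : rawValue L τ ≤ K * rawValue L σ := by
  obtain ⟨C, hC⟩ := (G.initial_represents hn).replaceAll (G := G) (m := m)
    (add_pos_of_nonneg_of_pos zero_le G.base_pos) (impPairs_lt hn)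
  change (G.result n m L).Represents n _ C at hC
  have hl : G.lam ^ m ≤ 1 := pow_le_one₀ zero_le G.lam_lt_one.le
  by_cases h0 : rawValue L τ = 0
  · rw [h0]; exact zero_le
  -- The given applications do not mention variable `n`, so it may be set to `false`.
  have hτ' : rawValue L (Function.update τ n false) = rawValue L τ :=
    rawValue_congr fun c hc j => Function.update_of_ne (hn c hc j).ne _ _
  rw [← hτ'] at h0 ⊢
  generalize hτ : Function.update τ n false = ρ at h0 ⊢
  have hρ : ρ n = false := by rw [← hτ]; simp
  -- The auxiliary variables are chosen optimally for the competitor `ρ`, which satisfies all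
  -- implications and thus has soft weight 1.
  obtain ⟨ρ', -, h2⟩ := hC.attained ρ hρ
  rw [rawValue_split] at h0
  have hρs := softWeight_of_ne_zero (left_ne_zero_of_mul h0)
  rw [hρs, one_mul] at h2
  have hVρ : rawValue L ρ = rawValue (others L) ρ := by rw [rawValue_split, hρs, one_mul]
  have h3 := hσ ρ'
  rw [h2] at h3
  have hpos : 0 < rawValue (others L) ρ := pos_iff_ne_zero.2 (right_ne_zero_of_mul h0)
  -- Otherwise the constraint `(1,0)` gives `σ` measure zero, against a positive competitor.
  have hσn : σ n = false := by
    by_contra hc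
    have hz : rawValue (G.result n m L).L σ = 0 := by
      rw [rawValue, List.prod_eq_zero_iff]
      refine List.mem_map.2 ⟨_, G.mem_result n m L, ?_⟩
      simp [unaryRaw_eval, hc]
    rw [hz, mul_zero] at h3
    exact absurd h3 (not_le.2 (mul_pos hC.pos hpos))
  have h4 := h3.trans (mul_le_mul' (le_refl K) (hC.le σ hσn))
  -- The unknown scale `C` cancels.
  have h5 : rawValue (others L) ρ ≤ K * (softWeight (G.lam ^ m) (impPairs L) σ *
      rawValue (others L) σ) := by
    refine le_of_mul_le_mul_left (h4.trans (le_of_eq ?_)) hC.pos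
    ring
  rw [hVρ]
  -- If `σ` violated an implication, its weight would be at most half that of `ρ`, contradicting the
  -- approximation factor `K < 2`.
  by_cases hs : softWeight 0 (impPairs L) σ = 0
  · exfalso
    have h6 : rawValue (others L) ρ ≤ K * (1 / 2 * rawValue (others L) ρ) := by
      refine h5.trans (mul_le_mul' le_rfl ?_)
      calc _ ≤ G.lam ^ m * totalSpread L :=
            mul_le_mul' (softWeight_of_eq_zero hs hl) (rawValue_others_le L σ)
        _ ≤ G.lam ^ m * totalSpread L * (totalSpread L * rawValue (others L) ρ) :=
            le_mul_of_one_le_right' (one_le_totalSpread_mul hpos.ne')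
        _ = G.lam ^ m * (totalSpread L * totalSpread L) * rawValue (others L) ρ := by ring
        _ ≤ _ := mul_le_mul' hm.le le_rfl
    have h7 : K * (1 / 2 * rawValue (others L) ρ) < 2 * (1 / 2 * rawValue (others L) ρ) := by
      refine mul_lt_mul_of_pos_right hK ?_
      positivity
    have h8 : 2 * (1 / 2 * rawValue (others L) ρ) = rawValue (others L) ρ := by
      rw [← mul_assoc]; norm_num
    rw [h8] at h7
    exact absurd (h6.trans_lt h7) (lt_irrefl _)
  · rw [softWeight_of_ne_zero hs, one_mul] at h5
    rwa [rawValue_split L σ, softWeight_of_ne_zero hs, one_mul]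

end Pinnable

/-! ### Instances -/

lemma Applied.raw_injective {n : ℕ} : Function.Injective (Applied.raw : Applied n → Raw) := by
  rintro ⟨f, u⟩ ⟨g, v⟩ h
  simp only [Applied.raw, Raw.mk.injEq] at h
  obtain ⟨rfl, h⟩ := h
  congr 1
  funext j
  exact Fin.ext (congrFun (eq_of_heq h) j)

/-- The applications of an instance. -/
def CSPInst.raws {F : Set Constraint} (x : CSPInst F) : List Raw := x.cons.map Applied.raw

lemma CSPInst.raws_scope_lt {F : Set Constraint} (x : CSPInst F) :
    ∀ c ∈ x.raws, ∀ j, c.scope j < x.n := by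
  intro c hc
  simp only [CSPInst.raws, List.mem_map] at hc
  obtain ⟨c, -, rfl⟩ := hc
  exact fun j => (c.scope j).2

lemma CSPInst.code_eq {F : Set Constraint} (x : CSPInst F) :
    x.code = List.replicate x.n 1 ++ -1 :: x.raws.flatMap Raw.code := by
  simp only [CSPInst.code, CSPInst.raws, List.flatMap_map]
  rfl

/-- The assignment given by a bit string. -/
def assignment (y : List Bool) : ℕ → Bool := fun i => y.getD i false

lemma CSPInst.meas_eq {F : Set Constraint} (x : CSPInst F) {y : List Bool} (hy : y.length = x.n) :
    (maxProdCSP F).meas x y = rawValue x.raws (assignment y) := by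
  simp only [maxProdCSP, dif_pos hy, CSPInst.value, rawValue, CSPInst.raws, List.map_map]
  congr 1
  refine List.map_congr_left fun c _ => ?_
  simp only [Function.comp, Raw.eval, Applied.raw, assignment]
  congr 1
  funext j
  rw [List.getD_eq_getElem _ _ (by rw [hy]; exact (c.scope j).2)]
  rfl

lemma CSPInst.exists_meas {F : Set Constraint} (x : CSPInst F) (σ : ℕ → Bool) :
    ∃ y : List Bool, y.length = x.n ∧ (maxProdCSP F).meas x y = rawValue x.raws σ := by
  refine ⟨List.ofFn fun i : Fin x.n => σ i, by simp, ?_⟩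
  rw [x.meas_eq (by simp)]
  refine rawValue_congr fun c hc j => ?_
  have := x.raws_scope_lt c hc j
  simp [assignment, this]

/-- There are finitely many solutions, so an optimum exists; the upper bound on the ratio is
automatic for a maximum, and the case of optimum zero follows from maximality. -/
lemma CSPInst.isApprox {F : Set Constraint} (x : CSPInst F) {K : ℝ≥0} (hK : 1 ≤ K) {y : List Bool}
    (hy : y.length = x.n)
    (h : ∀ τ, rawValue x.raws τ ≤ K * rawValue x.raws (assignment y)) :
    (maxProdCSP F).IsApprox K x y := by
  have hfin : ((maxProdCSP F).meas x '' (maxProdCSP F).sol x).Finite :=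
    (List.finite_length_eq Bool x.n).image _
  obtain ⟨v, hv⟩ := hfin.exists_maximal ⟨_, y, hy, rfl⟩
  have hgr : IsGreatest ((maxProdCSP F).meas x '' (maxProdCSP F).sol x) v :=
    ⟨hv.1, fun u hu => (le_total u v).elim id fun h => hv.2 hu h⟩
  have hle : (maxProdCSP F).meas x y ≤ v := hgr.2 ⟨y, hy, rfl⟩
  refine ⟨hy, v, hgr, fun h0 => le_antisymm (h0 ▸ hle) zero_le, fun h0 => ?_⟩
  have hv' : v ≤ K * (maxProdCSP F).meas x y := by
    obtain ⟨z, hz, rfl⟩ := hgr.1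
    rw [x.meas_eq hz, x.meas_eq hy]
    exact h _
  have hvp : (0 : ℝ) < v := by exact_mod_cast pos_iff_ne_zero.2 h0
  have hKp : (1 : ℝ) ≤ K := by exact_mod_cast hK
  constructor
  · rw [div_le_div_iff₀ (by linarith) hvp, one_mul, mul_comm]
    exact_mod_cast hv'
  · rw [div_le_iff₀ hvp]
    have h1 : ((maxProdCSP F).meas x y : ℝ) ≤ v := by exact_mod_cast hle
    nlinarith

lemma CSPInst.le_of_isApprox {F : Set Constraint} (x : CSPInst F) {K : ℝ≥0} (hK : 1 ≤ K)
    {y : List Bool} (h : (maxProdCSP F).IsApprox K x y) (τ : ℕ → Bool) :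
    rawValue x.raws τ ≤ K * rawValue x.raws (assignment y) := by
  obtain ⟨hy, v, hv, -, h2⟩ := h
  rw [← x.meas_eq hy]
  obtain ⟨z, hz, he⟩ := x.exists_meas τ
  rw [← he]
  refine (hv.2 ⟨z, hz, rfl⟩).trans ?_
  by_cases h0 : v = 0
  · rw [h0]; exact zero_le
  have h3 := (h2 h0).1
  have hvp : (0 : ℝ) < v := by exact_mod_cast pos_iff_ne_zero.2 h0
  have hKp : (1 : ℝ) ≤ K := by exact_mod_cast hK
  rw [div_le_div_iff₀ (by linarith) hvp, one_mul, mul_comm] at h3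
  exact_mod_cast h3

/-- The instance formed by a valid list of applications. -/
def Partial.inst {G : Pinnable} {S : Set Constraint} {o : ℕ} (s : Partial) (h : s.Valid G S o) :
    CSPInst S where
  n := s.v
  cons := s.L.pmap (fun c hc => ⟨c.con, fun j => ⟨c.scope j, hc j⟩⟩) h.scope_lt
  nodup := by
    refine h.nodup.pmap ?_
    rintro ⟨f, u⟩ _ ⟨g, v⟩ _ he
    have := congrArg Applied.raw he
    exact this
  mem := by
    intro c hc
    obtain ⟨d, hd, rfl⟩ := List.mem_pmap.1 hc
    exact h.mem d hd

lemma Partial.inst_raws {G : Pinnable} {S : Set Constraint} {o : ℕ} (s : Partial)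
    (h : s.Valid G S o) : (s.inst h).raws = s.L := by
  simp only [CSPInst.raws, Partial.inst, List.map_pmap, Applied.raw]
  exact List.pmap_eq_map h.scope_lt |>.trans (List.map_id' _)

lemma Partial.inst_code {G : Pinnable} {S : Set Constraint} {o : ℕ} (s : Partial)
    (h : s.Valid G S o) :
    (s.inst h).code = List.replicate s.v 1 ++ -1 :: s.L.flatMap Raw.code := by
  rw [CSPInst.code_eq, Partial.inst_raws]
  rfl

/-- The first `n` bits of a string, filled up by zeros. -/
def firstBits (n : ℕ) (y : List Bool) : List Bool := List.ofFn fun i : Fin n => y.getD i false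

lemma Pinnable.result_valid (G : Pinnable) {F S : Set Constraint} (x : CSPInst F) (m : ℕ)
    (hf : G.f ∈ S) (hU : Unary ⊆ S) (hF : ∀ c ∈ F, c ≠ Implies → c ∈ S) :
    (G.result x.n m x.raws).Valid G S x.n := by
  refine Partial.Valid.replaceAll hf hU m (G.initial_valid ?_ x.raws_scope_lt ?_ hU) ?_
  · exact x.nodup.map Applied.raw_injective
  · intro c hc
    obtain ⟨d, hd, rfl⟩ := List.mem_map.1 hc
    exact hF _ (x.mem d hd)
  · intro p hp
    have := impPairs_lt x.raws_scope_lt p hp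
    simp only [Pinnable.initial]
    omega

/-- The old variables come first in the constructed instance, so restricting a solution means
truncating its bit string. -/
lemma Pinnable.isApprox_firstBits (G : Pinnable) {F S : Set Constraint} (x : CSPInst F) {m : ℕ}
    (h : (G.result x.n m x.raws).Valid G S x.n)
    (hm : G.lam ^ m * (totalSpread x.raws * totalSpread x.raws) < 1 / 2) {K : ℝ≥0} (hK : 1 ≤ K)
    (hK2 : K < 2) {y : List Bool} (hy : (maxProdCSP S).IsApprox K (Partial.inst _ h) y) :
    (maxProdCSP F).IsApprox K x (firstBits x.n y) := by
  have h1 := CSPInst.le_of_isApprox _ hK hy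
  rw [Partial.inst_raws] at h1
  refine x.isApprox hK (by simp [firstBits]) fun τ => ?_
  have h2 := G.le_of_result x.raws_scope_lt hm hK2 h1 τ
  rwa [rawValue_congr (σ := assignment y) (τ := assignment (firstBits x.n y))] at h2
  intro c hc j
  have := x.raws_scope_lt c hc j
  simp [assignment, firstBits, this]

/-! ### Lengths -/

lemma one_le_len (r : ℝ) : 1 ≤ len r := by simp [len]

lemma len_le_of_bounds {r : ℝ} {N : ℕ} (h0 : 0 < r) (h1 : 1 ≤ r * 2 ^ N) (h2 : r ≤ 2 ^ N) :
    len r ≤ N + 1 := by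
  have hN : (0 : ℝ) < 2 ^ N := by positivity
  have e : Real.logb 2 ((2 : ℝ) ^ N) = N := by
    rw [← Real.rpow_natCast, Real.logb_rpow] <;> norm_num
  have hle : Real.logb 2 r ≤ N := by
    rw [← e]; exact Real.logb_le_logb_of_le (by norm_num) h0 h2
  have hge : -(N : ℝ) ≤ Real.logb 2 r := by
    rw [← e, ← Real.logb_inv]
    refine Real.logb_le_logb_of_le (by norm_num) (by positivity) ?_
    rw [inv_le_iff_one_le_mul₀ hN]
    exact h1
  have : ⌈|Real.logb 2 r|⌉₊ ≤ N := Nat.ceil_le.2 (abs_le.2 ⟨hge, hle⟩)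
  simp only [len]
  omega

lemma len_le_of_one_le {r : ℝ} {N : ℕ} (h1 : 1 ≤ r) (h2 : r ≤ 2 ^ N) : len r ≤ N + 1 :=
  len_le_of_bounds (by linarith) (one_le_mul_of_one_le_of_one_le h1 (one_le_pow₀ (by norm_num))) h2

lemma abs_logb_lt_len (r : ℝ) : |Real.logb 2 r| + 1 ≤ len r := by
  simp only [len]
  push_cast
  linarith [Nat.le_ceil |Real.logb 2 r|]

/-- The summand 1 in `len` provides the factor 2, which absorbs the sums in `growth_le`. -/
lemma le_two_pow_len {r : ℝ} (h : 0 < r) : 2 * r ≤ 2 ^ len r := by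
  have h1 := abs_logb_lt_len r
  have h2 : Real.logb 2 r + 1 ≤ len r := by linarith [le_abs_self (Real.logb 2 r)]
  have h3 : (2 : ℝ) ^ (Real.logb 2 r + 1) ≤ 2 ^ (len r : ℝ) :=
    Real.rpow_le_rpow_of_exponent_le (by norm_num) h2
  rw [Real.rpow_add (by norm_num), Real.rpow_logb (by norm_num) (by norm_num) h,
    Real.rpow_natCast, Real.rpow_one] at h3
  linarith

lemma len_inv (r : ℝ) : len r⁻¹ = len r := by
  simp [len, Real.logb_inv]

/-- The factor by which a table entry enters the spread. -/
def growth (r : ℝ) : ℝ := r + (1 + 1 / r)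

lemma one_le_growth {r : ℝ} (h : 0 ≤ r) : 1 ≤ growth r := by
  have : 0 ≤ 1 / r := by positivity
  simp only [growth]; linarith

lemma growth_le {r : ℝ} (h : 0 ≤ r) : growth r ≤ 4 ^ len r := by
  have hl : (2 : ℝ) ≤ 2 ^ len r := by
    calc (2 : ℝ) = 2 ^ 1 := by norm_num
      _ ≤ _ := pow_le_pow_right₀ (by norm_num) (one_le_len r)
  have e : (4 : ℝ) ^ len r = 2 ^ len r * 2 ^ len r := by rw [← mul_pow]; norm_num
  rw [e]
  rcases h.eq_or_lt with rfl | h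
  · simp only [growth]; norm_num; nlinarith
  · have h1 := le_two_pow_len h
    have h2 := le_two_pow_len (inv_pos.2 h)
    rw [len_inv] at h2
    simp only [growth, one_div]
    nlinarith

/-! ### Reading the input -/

/-- Multiply the top of `z` by the growth of the top of `inp`. -/
def absorb : Prog := seqs [.push 1 14, .arith .div 14 0 13, .arith .add 14 13 13,
  .arith .add 0 13 13, .arith .mul 4 13 14, .pop 4, .copy 14 4, .pop 14, .pop 14, .pop 13, .pop 13,
  .pop 13]

/-- All intermediate results of `absorb` are controlled by the final product, since each factor is
at least 1. -/
lemma growth_lens {r z : ℝ} {N B : ℕ} (hr : 0 ≤ r) (hz : 1 ≤ z) (h : z * growth r ≤ 2 ^ N)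
    (hB : N + 1 ≤ B) : len r ≤ B ∧ len (1 / r) ≤ B ∧ len (1 + 1 / r) ≤ B ∧ len (growth r) ≤ B ∧
      len (z * growth r) ≤ B := by
  have hg := one_le_growth hr
  have hgN : growth r ≤ 2 ^ N := le_trans (le_mul_of_one_le_left (by linarith) hz) h
  have hi : 0 ≤ 1 / r := by positivity
  have hN : (1 : ℝ) ≤ 2 ^ N := one_le_pow₀ (by norm_num)
  have hr2 : r ≤ 2 ^ N := by simp only [growth] at hgN; linarith
  have hi2 : 1 / r ≤ 2 ^ N := by simp only [growth] at hgN; linarith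
  have hlr : len r ≤ N + 1 := by
    rcases hr.eq_or_lt with rfl | hr
    · simp [len_zero]
    · refine len_le_of_bounds hr ?_ hr2
      rw [div_le_iff₀ hr] at hi2
      linarith
  refine ⟨hlr.trans hB, ?_, ?_, ?_, ?_⟩
  · rw [one_div, len_inv]; omega
  · exact (len_le_of_one_le (by linarith) (by simp only [growth] at hgN; linarith)).trans hB
  · exact (len_le_of_one_le hg hgN).trans hB
  · exact (len_le_of_one_le (one_le_mul_of_one_le_of_one_le hz hg) h).trans hB

lemma does_absorb {B N : ℕ} (hB : N + 1 ≤ B) {m : Mem} {r z : ℝ} {I : List ℝ}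
    (hi : m.inp = r :: I) (hz : m.z = [z]) (hr : 0 ≤ r) (hz1 : 1 ≤ z)
    (h : z * growth r ≤ 2 ^ N) :
    Does B absorb m {m with z := [z * growth r]} 25 := by
  obtain ⟨h1, h2, h3, h4, h5⟩ := growth_lens hr hz1 h hB
  have hB1 : 1 ≤ B := by omega
  refine Does.of_ok hB1 ?_ ?_ (by simp [absorb, Prog.count, seqs])
  · simp only [growth] at h4 h5
    simp [absorb, seqs, Prog.Ok, Prog.ev, Store.push, Store.top, Mem.store, Op.eval, hi, hz,
      len_one, hB1]
    simp only [one_div] at *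
    simp_all
  · simp [absorb, seqs, Prog.ev, Store.push, Store.top, Mem.store, Op.eval, hi, hz, growth]

/-- Stack 15 is empty and reads as zero: the loop runs while the input entry is nonnegative and
stops at the separator `-1`. The other readers use the same guard. -/
def readUnary : Prog := .loop (.le 15 0) (seqs [.push 1 8, .push 1 7, .arith .add 6 0 14, .pop 6,
  .copy 14 6, .pop 14, .pop 0])

lemma does_readUnary {B : ℕ} (hB : 1 ≤ B) {m : Mem} {n v : ℕ} {I : List ℝ}
    (hi : m.inp = List.replicate n 1 ++ -1 :: I) (hv : m.v = [(v : ℝ)])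
    (hlen : ∀ u ≤ v + n, len (u : ℝ) ≤ B) :
    Does B readUnary m {m with
      inp := -1 :: I, v := [((v + n : ℕ) : ℝ)], vs := List.replicate n 1 ++ m.vs,
      ns := List.replicate n 1 ++ m.ns} (16 * n + 1) := by
  induction n generalizing m v with
  | zero =>
    have e : {m with
        inp := -1 :: I, v := [((v + 0 : ℕ) : ℝ)], vs := List.replicate 0 1 ++ m.vs,
        ns := List.replicate 0 1 ++ m.ns} = m := by
      obtain ⟨⟩ := m
      simp only [List.replicate_zero, List.nil_append] at hi hv ⊢
      subst hi hv
      simp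
    rw [e]
    refine runs_loop_done hB ?_
    simp [Test.Holds, Store.top, Mem.store, hi]
  | succ n ih =>
    have hb : Does B (seqs [.push 1 8, .push 1 7, .arith .add 6 0 14, .pop 6,
        .copy 14 6, .pop 14, .pop 0]) m {m with
          inp := List.replicate n 1 ++ -1 :: I, v := [((v + 1 : ℕ) : ℝ)], vs := 1 :: m.vs,
          ns := 1 :: m.ns} 15 := by
      have := hlen (v + 1) (by omega)
      push_cast at this
      refine Does.of_ok hB ?_ ?_ (by simp [Prog.count, seqs])
      · simp [seqs, Prog.Ok, Prog.ev, Store.push, Store.top, Mem.store, Op.eval, hi, hv,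
          List.replicate_succ, len_one, hB, this]
      · simp [seqs, Prog.ev, Store.push, Store.top, Mem.store, Op.eval, hi, hv,
          List.replicate_succ]
    have h2 := ih (m := {m with
          inp := List.replicate n 1 ++ -1 :: I, v := [((v + 1 : ℕ) : ℝ)], vs := 1 :: m.vs,
          ns := 1 :: m.ns}) (v := v + 1) rfl rfl (fun u hu => hlen u (by omega))
    have h3 := runs_loop_step (t := .le 15 0) hB
      (by simp [Test.Holds, Store.top, Mem.store, hi, List.replicate_succ]) hb h2
    simp only [List.replicate_succ', List.append_assoc, List.cons_append, List.nil_append,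
      Nat.add_assoc v 1 n, Nat.add_comm 1 n] at h3 ⊢
    exact h3.mono (by omega)

def readScope : Prog := .loop (.le 15 0) (seqs [.copy 0 9, .pop 0])

lemma does_readScope {B : ℕ} (hB : 1 ≤ B) {m : Mem} {l I : List ℝ}
    (hi : m.inp = l ++ -1 :: I) (h0 : ∀ r ∈ l, 0 ≤ r) (hl : ∀ r ∈ l, len r ≤ B) :
    Does B readScope m {m with inp := -1 :: I, a := l.reverse ++ m.a} (6 * l.length + 1) := by
  induction l generalizing m with
  | nil =>
    have e : {m with inp := -1 :: I, a := ([] : List ℝ).reverse ++ m.a} = m := by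
      obtain ⟨⟩ := m
      simp only [List.nil_append] at hi
      subst hi
      simp
    rw [e]
    refine runs_loop_done hB ?_
    simp [Test.Holds, Store.top, Mem.store, hi]
  | cons r l ih =>
    have hb : Does B (seqs [.copy 0 9, .pop 0]) m {m with inp := l ++ -1 :: I, a := r :: m.a} 5 := by
      refine Does.of_ok hB ?_ ?_ (by simp [Prog.count, seqs])
      · simp [seqs, Prog.Ok, Store.top, Mem.store, hi, hl]
      · simp [seqs, Prog.ev, Store.push, Store.top, Mem.store, hi]
    have h2 := ih (m := {m with inp := l ++ -1 :: I, a := r :: m.a}) rfl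
      (fun r hr => h0 r (by simp [hr])) (fun r hr => hl r (by simp [hr]))
    have h3 := runs_loop_step (t := .le 15 0) hB
      (by simp [Test.Holds, Store.top, Mem.store, hi, h0]) hb h2
    simp only [List.reverse_cons, List.append_assoc, List.length_cons]
    exact h3.mono (by omega)

def readTable : Prog := .loop (.le 15 0) (seqs [absorb, .copy 0 10, .pop 0])

lemma does_readTable {B N : ℕ} (hB : N + 1 ≤ B) {m : Mem} {l I : List ℝ} {z : ℝ}
    (hi : m.inp = l ++ -1 :: I) (hz : m.z = [z]) (hz1 : 1 ≤ z) (h0 : ∀ r ∈ l, 0 ≤ r)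
    (h : z * (l.map growth).prod ≤ 2 ^ N) :
    Does B readTable m {m with
      inp := -1 :: I, b := l.reverse ++ m.b, z := [z * (l.map growth).prod]}
      (34 * l.length + 1) := by
  have hB1 : 1 ≤ B := by omega
  induction l generalizing m z with
  | nil =>
    have e : {m with
      inp := -1 :: I, b := ([] : List ℝ).reverse ++ m.b,
      z := [z * (([] : List ℝ).map growth).prod]} = m := by
      obtain ⟨⟩ := m
      simp only [List.nil_append] at hi hz
      subst hi hz
      simp
    rw [e]
    refine runs_loop_done hB1 ?_
    simp [Test.Holds, Store.top, Mem.store, hi]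
  | cons r l ih =>
    simp only [List.map_cons, List.prod_cons, ← mul_assoc] at h ⊢
    have hr := h0 r (by simp)
    have hg := one_le_growth hr
    have hp : 1 ≤ (l.map growth).prod := by
      have h0' : ∀ r ∈ l, 0 ≤ r := fun r hr => h0 r (by simp [hr])
      clear * - h0'
      induction l with
      | nil => simp
      | cons r l ih =>
        simp only [List.map_cons, List.prod_cons]
        exact one_le_mul_of_one_le_of_one_le (one_le_growth (h0' r (by simp)))
          (ih fun r hr => h0' r (by simp [hr]))
    have hzg : z * growth r ≤ 2 ^ N :=
      le_trans (le_mul_of_one_le_right (by positivity) hp) h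
    have hb1 := does_absorb hB hi hz hr hz1 hzg
    have hlr := (growth_lens hr hz1 hzg hB).1
    have hb2 : Does B (seqs [.copy 0 10, .pop 0]) {m with z := [z * growth r]}
        {m with inp := l ++ -1 :: I, b := r :: m.b, z := [z * growth r]} 5 := by
      refine Does.of_ok hB1 ?_ ?_ (by simp [Prog.count, seqs])
      · simp [seqs, Prog.Ok, Store.top, Mem.store, hi, hlr]
      · simp [seqs, Prog.ev, Store.push, Store.top, Mem.store, hi]
    have hb := does_seqs_cons hB1 hb1 hb2
    have h2 := ih (m := {m with inp := l ++ -1 :: I, b := r :: m.b, z := [z * growth r]}) rfl rfl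
      (one_le_mul_of_one_le_of_one_le hz1 hg) (fun r hr => h0 r (by simp [hr])) h
    have h3 := runs_loop_step (t := .le 15 0) hB1
      (by simp [Test.Holds, Store.top, Mem.store, hi, hr]) hb h2
    simp only [List.reverse_cons, List.append_assoc, List.length_cons]
    exact h3.mono (by omega)

/-- If the content of stack `10` is `l`, erase it and continue with `P`; otherwise leave it alone
and continue with `Q`. -/
def matchStack : List ℝ → Prog → Prog → Prog
  | [], P, Q => .branch (.empty 10) P Q
  | r :: l, P, Q => .branch (.empty 10) Q (.seq (.push r 14) (.branch (.le 10 14)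
      (.branch (.le 14 10) (.seq (.pop 14) (.seq (.pop 10) (matchStack l P (.seq (.push r 10) Q))))
        (.seq (.pop 14) Q)) (.seq (.pop 14) Q)))

lemma does_push_k {B : ℕ} (hB : 1 ≤ B) (m : Mem) {r : ℝ} (hr : len r ≤ B) :
    Does B (.push r 14) m {m with k := r :: m.k} 1 :=
  Does.of_ok hB (by simpa [Prog.Ok] using hr) (by simp [Prog.ev, Store.push, Mem.store]) le_rfl

lemma does_pop_k {B : ℕ} (hB : 1 ≤ B) (m : Mem) (r : ℝ) :
    Does B (.pop 14) {m with k := r :: m.k} m 1 :=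
  Does.of_ok hB trivial (by simp [Prog.ev, Mem.store]) le_rfl

lemma does_matchStack_eq {B : ℕ} (hB : 1 ≤ B) {P : Prog} {m m' : Mem} {c : ℕ} {l : List ℝ}
    (hl : ∀ r ∈ l, len r ≤ B) (Q : Prog) (hb : m.b = l) (h : Does B P {m with b := []} m' c) :
    Does B (matchStack l P Q) m m' (c + 9 * l.length + 1) := by
  induction l generalizing m Q with
  | nil =>
    have e : {m with b := []} = m := by
      obtain ⟨⟩ := m
      simp only at hb
      rw [hb]
    rw [e] at h
    exact runs_branch_pos hB hb h
  | cons r l ih =>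
    have h1 := ih (m := {m with b := l}) (fun r hr => hl r (by simp [hr])) (.seq (.push r 10) Q)
      rfl h
    have h2 : Does B (.pop 10) m {m with b := l} 1 :=
      Does.of_ok hB trivial (by simp [Prog.ev, Mem.store, hb]) le_rfl
    have h3 := Does.seq hB (does_pop_k hB m r) (Does.seq hB h2 h1)
    have h4 := runs_branch_pos (t := .le 14 10) (Q := .seq (.pop 14) Q) hB
      (by simp [Test.Holds, Store.top, Mem.store, hb]) h3
    have h5 := runs_branch_pos (t := .le 10 14) (Q := .seq (.pop 14) Q) hB
      (by simp [Test.Holds, Store.top, Mem.store, hb]) h4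
    have h6 := Does.seq hB (does_push_k hB m (hl r (by simp))) h5
    have h7 := runs_branch_neg (t := .empty 10) (P := Q) hB
      (by simp [Test.Holds, Mem.store, hb]) h6
    exact h7.mono (by simp only [List.length_cons]; omega)

/-- Two comparisons decide equality of reals. The failure branch must find the stack unchanged. -/
lemma does_matchStack_ne {B : ℕ} (hB : 1 ≤ B) (P : Prog) {Q : Prog} {m m' : Mem} {c : ℕ}
    {l : List ℝ} (hl : ∀ r ∈ l, len r ≤ B) (hb : m.b ≠ l) (h : Does B Q m m' c) :
    Does B (matchStack l P Q) m m' (c + 11 * l.length + 1) := by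
  induction l generalizing m Q c with
  | nil => exact runs_branch_neg hB hb h
  | cons r l ih =>
    rcases hmb : m.b with - | ⟨r', b⟩
    · exact Runs.mono (runs_branch_pos (t := .empty 10) hB (by simpa [Test.Holds, Mem.store] using hmb) h)
        (by simp only [List.length_cons]; omega)
    have hneg : ¬ (Test.empty 10).Holds m.store := by simp [Test.Holds, Mem.store, hmb]
    have hq := Does.seq hB (does_pop_k hB m r) h
    by_cases h1 : r' ≤ r
    · by_cases h2 : r ≤ r'
      · obtain rfl := le_antisymm h1 h2
        have hpush : Does B (.push r' 10) {m with b := b} m 1 := by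
          refine Does.of_ok hB (by simpa [Prog.Ok] using hl r' (by simp)) ?_ le_rfl
          obtain ⟨⟩ := m
          simp only at hmb
          subst hmb
          simp [Prog.ev, Store.push, Mem.store]
        have hpop : Does B (.pop 10) m {m with b := b} 1 :=
          Does.of_ok hB trivial (by simp [Prog.ev, Mem.store, hmb]) le_rfl
        -- An entry that matched has been removed; the continuation for failure is extended by
        -- pushing it back.
        have h3 := ih (m := {m with b := b}) (fun r hr => hl r (by simp [hr]))
          (fun he => hb (by rw [hmb]; exact congrArg _ he)) (Does.seq hB hpush h)
        have h4 := Does.seq hB (does_pop_k hB m r') (Does.seq hB hpop h3)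
        have h5 := runs_branch_pos (t := .le 14 10) (Q := .seq (.pop 14) Q) hB
          (by simp [Test.Holds, Store.top, Mem.store, hmb]) h4
        have h6 := runs_branch_pos (t := .le 10 14) (Q := .seq (.pop 14) Q) hB
          (by simp [Test.Holds, Store.top, Mem.store, hmb]) h5
        have h7 := Does.seq hB (does_push_k hB m (hl r' (by simp))) h6
        exact (runs_branch_neg hB hneg h7).mono (by simp only [List.length_cons]; omega)
      · have h5 := runs_branch_neg (t := .le 14 10) (P := .seq (.pop 14) (.seq (.pop 10)
          (matchStack l P (.seq (.push r 10) Q)))) hB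
          (by simpa [Test.Holds, Store.top, Mem.store, hmb] using h2) hq
        have h6 := runs_branch_pos (t := .le 10 14) (Q := .seq (.pop 14) Q) hB
          (by simpa [Test.Holds, Store.top, Mem.store, hmb] using h1) h5
        have h7 := Does.seq hB (does_push_k hB m (hl r (by simp))) h6
        exact (runs_branch_neg hB hneg h7).mono (by simp only [List.length_cons]; omega)
    · have h6 := runs_branch_neg (t := .le 10 14) (P := .branch (.le 14 10) (.seq (.pop 14)
          (.seq (.pop 10) (matchStack l P (.seq (.push r 10) Q)))) (.seq (.pop 14) Q)) hB
          (by simpa [Test.Holds, Store.top, Mem.store, hmb] using h1) hq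
      have h7 := Does.seq hB (does_push_k hB m (hl r (by simp))) h6
      exact (runs_branch_neg hB hneg h7).mono (by simp only [List.length_cons]; omega)

/-- Move the content of stack `i` to stack `j`, in reversed order. -/
def moveStack (i j : ℕ) : Prog := untilEmpty i (seqs [.copy i j, .pop i])

/-- `M` presents the memory as a function of the two stacks involved, so that one proof serves every
pair of stacks. -/
lemma does_moveStack {B : ℕ} (hB : 1 ≤ B) {i j : ℕ} (M : List ℝ → List ℝ → Mem)
    (hg : ∀ a b, (M a b).g = []) (hi : ∀ a b, (M a b).store i = a)
    (hj : ∀ a b, (M a b).store j = b)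
    (ui : ∀ a b l, Function.update (M a b).store i l = (M l b).store)
    (uj : ∀ a b l, Function.update (M a b).store j l = (M a l).store)
    {l : List ℝ} (hl : ∀ r ∈ l, len r ≤ B) (l' : List ℝ) :
    Does B (moveStack i j) (M l l') (M [] (l.reverse ++ l')) (7 * l.length + 6) := by
  refine UntilLoop.does hB (hg _ _) (c := 7 * l.length + 4) ?_
  induction l generalizing l' with
  | nil => exact untilLoop_done hB (hg _ _) (hi _ _)
  | cons r l ih =>
    have hb : Does B (seqs [.copy i j, .pop i]) (M (r :: l) l') (M l (r :: l')) 5 := by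
      refine Does.of_ok hB ?_ ?_ (by simp [Prog.count, seqs])
      · simp [seqs, Prog.Ok, Store.top, hi, hl]
      · simp [seqs, Prog.ev, Store.push, Store.top, hi, hj, uj, ui]
    have h2 := untilLoop_step hB (hg _ _) (by simp [hi]) hb
      (ih (fun r hr => hl r (by simp [hr])) (r :: l'))
    simp only [List.reverse_cons, List.append_assoc, List.length_cons]
    exact Runs.mono h2 (by omega)

/-! ### Parsing the constraint applications -/

/-- Store the two variables of an implication. -/
def storePair : Prog := seqs [.copy 9 12, .pop 9, .copy 9 11, .pop 9]

/-- Write the application that has been read to the question. -/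
def writeBack : Prog := seqs [.push (-1) 2, moveStack 10 2, .push (-1) 2, moveStack 9 2]

def block : Prog := seqs [readScope, .pop 0, readTable, .pop 0,
  matchStack impTable.reverse storePair writeBack]

def parse : Prog := untilEmpty 0 block

lemma coe_spread (f : Constraint) : (spread f : ℝ) = (f.table.map growth).prod := by
  rw [spread, NNReal.coe_list_prod, Constraint.table, List.map_map, List.map_map]
  congr 1
  refine List.map_congr_left fun x _ => ?_
  simp only [Function.comp, growth]
  push_cast
  ring

lemma does_pop_inp {B : ℕ} (hB : 1 ≤ B) {m : Mem} {r : ℝ} {I : List ℝ} (h : m.inp = r :: I) :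
    Does B (.pop 0) m {m with inp := I} 1 :=
  Does.of_ok hB trivial (by simp [Prog.ev, Mem.store, h]) le_rfl

lemma does_push_q {B : ℕ} (hB : 1 ≤ B) (m : Mem) {r : ℝ} (hr : len r ≤ B) :
    Does B (.push r 2) m {m with q := r :: m.q} 1 :=
  Does.of_ok hB (by simpa [Prog.Ok] using hr) (by simp [Prog.ev, Store.push, Mem.store]) le_rfl

lemma does_storePair {B : ℕ} (hB : 1 ≤ B) {m : Mem} {x y : ℝ} (ha : m.a = [y, x])
    (hx : len x ≤ B) (hy : len y ≤ B) :
    Does B storePair m {m with a := [], xs := x :: m.xs, ys := y :: m.ys} 9 := by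
  refine Does.of_ok hB ?_ ?_ (by simp [storePair, Prog.count, seqs])
  · simp [storePair, seqs, Prog.Ok, Prog.ev, Store.push, Store.top, Mem.store, ha, hx, hy]
  · simp [storePair, seqs, Prog.ev, Store.push, Store.top, Mem.store, ha]

lemma does_writeBack {B : ℕ} (hB : 1 ≤ B) {m : Mem} (hg : m.g = []) (ha : ∀ r ∈ m.a, len r ≤ B)
    (hb : ∀ r ∈ m.b, len r ≤ B) :
    Does B writeBack m {m with
      a := [], b := [], q := m.a.reverse ++ -1 :: (m.b.reverse ++ -1 :: m.q)}
      (7 * m.a.length + 7 * m.b.length + 19) := by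
  have h1 := does_push_q hB m (r := -1) (by rw [len_neg_one]; exact hB)
  have h2 := does_moveStack hB (i := 10) (j := 2) (fun a b => {m with b := a, q := b})
    (fun _ _ => hg) (fun _ _ => rfl) (fun _ _ => rfl) (fun _ _ _ => by simp) (fun _ _ _ => by simp)
    hb (-1 :: m.q)
  have h3 := does_push_q hB {m with b := [], q := m.b.reverse ++ -1 :: m.q} (r := -1)
    (by rw [len_neg_one]; exact hB)
  have h4 := does_moveStack hB (i := 9) (j := 2) (fun a b => {m with b := [], a := a, q := b})
    (fun _ _ => hg) (fun _ _ => rfl) (fun _ _ => rfl) (fun _ _ _ => by simp) (fun _ _ _ => by simp)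
    ha (-1 :: (m.b.reverse ++ -1 :: m.q))
  exact Runs.mono (does_seqs_cons hB h1 (does_seqs_cons hB h2 (does_seqs_cons hB h3
    (does_seqs_cons hB h4 (does_seqs_nil hB _))))) (by omega)

lemma others_cons (c : Raw) (L : List Raw) : others (c :: L) = others L ++ others [c] := by
  by_cases h : c.con.table = impTable <;> simp [others, h]

lemma impPairs_cons (c : Raw) (L : List Raw) : impPairs (c :: L) = impPairs L ++ impPairs [c] := by
  by_cases h : c.con.table = impTable <;> simp [impPairs, h]

/-- The first entries of a list of pairs, as real numbers. -/
def fsts (l : List (ℕ × ℕ)) : List ℝ := l.map fun p => (p.1 : ℝ)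

/-- The second entries of a list of pairs, as real numbers. -/
def snds (l : List (ℕ × ℕ)) : List ℝ := l.map fun p => (p.2 : ℝ)

lemma fsts_append (l k : List (ℕ × ℕ)) : fsts (l ++ k) = fsts l ++ fsts k := by simp [fsts]
lemma snds_append (l k : List (ℕ × ℕ)) : snds (l ++ k) = snds l ++ snds k := by simp [snds]

lemma len_le_of_mem_table {f : Constraint} {N B : ℕ} (hB : N + 1 ≤ B)
    (h : (spread f : ℝ) ≤ 2 ^ N) : ∀ r ∈ f.table, len r ≤ B := by
  intro r hr
  simp only [Constraint.table, List.mem_map] at hr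
  obtain ⟨x, -, rfl⟩ := hr
  have hx : growth (f.val x) ≤ spread f := by
    have := NNReal.coe_le_coe.2 (le_spread f x)
    push_cast at this
    simp only [growth, one_div]
    linarith
  refine (growth_lens (z := 1) (f.val x).2 le_rfl ?_ hB).1
  rw [one_mul]
  exact hx.trans h

/-- Reading onto a stack reverses a list, hence the comparison with the reversed table of `Implies`.
Implications are set aside as pairs, while other applications are reversed a second time and arrive
in the question unchanged. -/
lemma does_block {B N : ℕ} (hB : N + 1 ≤ B) {m : Mem} {c : Raw} {I : List ℝ} {z : ℝ}
    (hi : m.inp = c.code ++ I) (ha : m.a = []) (hb : m.b = []) (hg : m.g = []) (hz : m.z = [z])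
    (hz1 : 1 ≤ z) (hzN : z * spread c.con ≤ 2 ^ N) (hs : ∀ j, len (c.scope j : ℝ) ≤ B) :
    Does B block m {m with
      inp := I, z := [z * spread c.con], q := (others [c]).flatMap Raw.code ++ m.q,
      xs := fsts (impPairs [c]) ++ m.xs, ys := snds (impPairs [c]) ++ m.ys}
      (60 * c.code.length) := by
  have hB1 : 1 ≤ B := by omega
  have hsp : (1 : ℝ) ≤ spread c.con := by exact_mod_cast one_le_spread c.con
  have htl := len_le_of_mem_table (f := c.con) hB
    (le_trans (le_mul_of_one_le_left (by linarith) hz1) hzN)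
  set sc := List.ofFn fun j => (c.scope j : ℝ) with hsc
  have hsl : ∀ r ∈ sc, len r ≤ B := by
    intro r hr
    rw [hsc, List.mem_ofFn] at hr
    obtain ⟨j, rfl⟩ := hr
    exact hs j
  have hi' : m.inp = sc ++ -1 :: (c.con.table ++ -1 :: I) := by
    rw [hi, Raw.code]; simp [hsc]
  have h1 := does_readScope hB1 hi' (fun r hr => by
    rw [hsc, List.mem_ofFn] at hr
    obtain ⟨j, rfl⟩ := hr
    positivity) hsl
  rw [ha, List.append_nil] at h1
  have h2 := does_pop_inp hB1 (m := {m with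
    inp := -1 :: (c.con.table ++ -1 :: I), a := sc.reverse}) rfl
  have h3 := does_readTable hB (m := {m with inp := c.con.table ++ -1 :: I, a := sc.reverse}) rfl
    hz hz1 (fun r hr => by
      simp only [Constraint.table, List.mem_map] at hr
      obtain ⟨x, -, rfl⟩ := hr
      exact (c.con.val x).2) (by rw [← coe_spread]; exact hzN)
  rw [← coe_spread] at h3
  have eb : c.con.table.reverse ++ m.b = c.con.table.reverse := by rw [hb, List.append_nil]
  simp only [eb] at h3
  have h4 := does_pop_inp hB1 (m := {m with
    inp := -1 :: I, a := sc.reverse, b := c.con.table.reverse, z := [z * spread c.con]}) rfl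
  have hlen : c.code.length = sc.length + c.con.table.length + 2 := by
    simp [Raw.code, hsc]
    omega
  have hpat : ∀ r ∈ impTable.reverse, len r ≤ B := by
    intro r hr
    simp only [impTable, List.mem_reverse, List.mem_cons, List.not_mem_nil, or_false] at hr
    rcases hr with rfl | rfl | rfl | rfl <;> simp [len_one, len_zero, hB1]
  have htpos : 1 ≤ c.con.table.length := by
    rw [Constraint.table, List.length_map, points_length]
    exact Nat.one_le_two_pow
  have h5 : Does B (matchStack impTable.reverse storePair writeBack)
      {m with inp := I, a := sc.reverse, b := c.con.table.reverse, z := [z * spread c.con]}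
      {m with
        inp := I, z := [z * spread c.con], q := (others [c]).flatMap Raw.code ++ m.q,
        xs := fsts (impPairs [c]) ++ m.xs, ys := snds (impPairs [c]) ++ m.ys}
      (7 * sc.length + 7 * c.con.table.length + 64) := by
    by_cases h : c.con.table = impTable
    · have hsc2 : sc = [(c.pair.1 : ℝ), (c.pair.2 : ℝ)] := by
        clear_value sc
        obtain ⟨f, u⟩ := c
        obtain rfl := eq_Implies_of_table h
        rw [hsc]
        rfl
      have h6 := does_storePair hB1 (m := {m with
        inp := I, a := sc.reverse, b := [], z := [z * spread c.con]}) (x := c.pair.1)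
        (y := c.pair.2) (by rw [hsc2]; rfl) (hsl _ (by simp [hsc2])) (hsl _ (by simp [hsc2]))
      have h7 := does_matchStack_eq hB1 (m := {m with
        inp := I, a := sc.reverse, b := c.con.table.reverse, z := [z * spread c.con]}) hpat
        writeBack (by rw [h]) h6
      have e1 : others [c] = [] := by simp [others, h]
      have e2 : impPairs [c] = [c.pair] := by simp [impPairs, h]
      rw [e1, e2]
      have e3 : {m with
        inp := I, a := [], b := [], z := [z * spread c.con], xs := (c.pair.1 : ℝ) :: m.xs,
        ys := (c.pair.2 : ℝ) :: m.ys} = {m with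
        inp := I, z := [z * spread c.con], q := ([] : List Raw).flatMap Raw.code ++ m.q,
        xs := fsts [c.pair] ++ m.xs, ys := snds [c.pair] ++ m.ys} := by
        simp [ha, hb, fsts, snds]
      rw [← e3]
      exact Runs.mono h7 (by simp [impTable])
    · have h6 := does_writeBack hB1 (m := {m with
        inp := I, a := sc.reverse, b := c.con.table.reverse, z := [z * spread c.con]}) hg
        (by simpa using hsl) (by simpa using htl)
      have h7 := does_matchStack_ne hB1 storePair (m := {m with
        inp := I, a := sc.reverse, b := c.con.table.reverse, z := [z * spread c.con]}) hpat
        (fun he => h (List.reverse_injective he)) h6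
      have e1 : others [c] = [c] := by simp [others, h]
      have e2 : impPairs [c] = [] := by simp [impPairs, h]
      rw [e1, e2]
      have e3 : {m with
        inp := I, a := [], b := [], z := [z * spread c.con],
        q := sc.reverse.reverse ++ -1 :: (c.con.table.reverse.reverse ++ -1 :: m.q)} = {m with
        inp := I, z := [z * spread c.con], q := [c].flatMap Raw.code ++ m.q,
        xs := fsts [] ++ m.xs, ys := snds [] ++ m.ys} := by
        simp [ha, hb, fsts, snds, Raw.code, hsc]
      rw [← e3]
      exact Runs.mono h7 (by simp [impTable])
  exact Runs.mono (does_seqs_cons hB1 h1 (does_seqs_cons hB1 h2 (does_seqs_cons hB1 h3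
    (does_seqs_cons hB1 h4 (does_seqs_cons hB1 h5 (does_seqs_nil hB1 _)))))) (by omega)

lemma does_parse {B N : ℕ} (hB : N + 1 ≤ B) {m : Mem} {L : List Raw} {z : ℝ}
    (hi : m.inp = L.flatMap Raw.code) (ha : m.a = []) (hb : m.b = []) (hg : m.g = [])
    (hz : m.z = [z]) (hz1 : 1 ≤ z) (hzN : z * totalSpread L ≤ 2 ^ N)
    (hs : ∀ c ∈ L, ∀ j, len (c.scope j : ℝ) ≤ B) :
    Does B parse m {m with
      inp := [], z := [z * totalSpread L], q := (others L).flatMap Raw.code ++ m.q,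
      xs := fsts (impPairs L) ++ m.xs, ys := snds (impPairs L) ++ m.ys}
      (62 * (L.flatMap Raw.code).length + 6) := by
  have hB1 : 1 ≤ B := by omega
  refine UntilLoop.does hB1 hg (c := 62 * (L.flatMap Raw.code).length + 4) ?_
  induction L generalizing m z with
  | nil =>
    have e : {m with
      inp := [], z := [z * totalSpread []], q := (others []).flatMap Raw.code ++ m.q,
      xs := fsts (impPairs []) ++ m.xs, ys := snds (impPairs []) ++ m.ys} = m := by
      obtain ⟨⟩ := m
      simp only [List.flatMap_nil] at hi hz
      subst hi hz
      simp [totalSpread, others, impPairs, fsts, snds]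
    rw [e]
    exact untilLoop_done hB1 hg hi
  | cons c L ih =>
    have ec : (totalSpread (c :: L) : ℝ) = spread c.con * totalSpread L := by simp [totalSpread]
    have hsp : (1 : ℝ) ≤ spread c.con := by exact_mod_cast one_le_spread c.con
    have hsL : (1 : ℝ) ≤ totalSpread L := by exact_mod_cast one_le_totalSpread L
    rw [ec, ← mul_assoc] at hzN
    have h1 := does_block hB (c := c) (by rw [hi, List.flatMap_cons]) ha hb hg hz hz1
      (le_trans (le_mul_of_one_le_right (by positivity) hsL) hzN) (hs c (by simp))
    have h2 := ih (m := {m with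
      inp := L.flatMap Raw.code, z := [z * spread c.con],
      q := (others [c]).flatMap Raw.code ++ m.q,
      xs := fsts (impPairs [c]) ++ m.xs, ys := snds (impPairs [c]) ++ m.ys}) rfl ha hb hg rfl
      (one_le_mul_of_one_le_of_one_le hz1 hsp) hzN (fun d hd => hs d (by simp [hd]))
    have hne : m.store 0 ≠ [] := by
      change m.inp ≠ []
      rw [hi]
      simp [Raw.code]
    have h3 := untilLoop_step hB1 hg hne h1 h2
    rw [others_cons, impPairs_cons, ec]
    simp only [List.flatMap_append, List.append_assoc, fsts_append, snds_append, ← mul_assoc]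
    refine Runs.mono h3 ?_
    have hl : 2 ≤ c.code.length := by simp [Raw.code]; omega
    simp only [List.flatMap_cons, List.length_append]
    omega

/-! ### Writing the gadgets -/

/-- Push the given numbers, and the tops of the given stacks, on the question, last item first. -/
def emit (l : List (ℝ ⊕ ℕ)) : Prog :=
  seqs (l.reverse.map (Sum.elim (fun r => .push r 2) (fun i => .copy i 2)))

def Mem.item (m : Mem) : ℝ ⊕ ℕ → ℝ := Sum.elim id (fun i => m.store.top i)

lemma Mem.item_set_q (m : Mem) (l : List ℝ) {a : ℝ ⊕ ℕ} (ha : a ≠ .inr 2) :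
    {m with q := l : Mem}.item a = m.item a := by
  cases a with
  | inl r => rfl
  | inr i =>
    have : i ≠ 2 := fun h => ha (by rw [h])
    simp only [Mem.item, Sum.elim_inr, Store.top, ← Mem.upd_q, Function.update_of_ne this]

/-- Stack 2 is excluded as a source because its top changes while the items are written. -/
lemma does_emit {B : ℕ} (hB : 1 ≤ B) {l : List (ℝ ⊕ ℕ)} {m : Mem} (h2 : .inr 2 ∉ l)
    (hl : ∀ a ∈ l, len (m.item a) ≤ B) :
    Does B (emit l) m {m with q := l.map m.item ++ m.q} (2 * l.length + 1) := by
  rw [emit]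
  have h2' : .inr 2 ∉ l.reverse := by simpa using h2
  have hl' : ∀ a ∈ l.reverse, len (m.item a) ≤ B := by simpa using hl
  rw [← List.length_reverse (as := l)]
  conv in l.map m.item => rw [← List.reverse_reverse l]
  generalize l.reverse = k at *
  clear h2 hl
  induction k generalizing m with
  | nil => simpa using does_seqs_nil hB m
  | cons a k ih =>
    have ha : a ≠ .inr 2 := fun h => h2' (by simp [h])
    have h1 : Does B (Sum.elim (fun r => .push r 2) (fun i => .copy i 2) a) m
        {m with q := m.item a :: m.q} 1 := by
      have := hl' a (by simp)
      cases a with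
      | inl r => exact does_push_q hB m this
      | inr i => exact Does.of_ok hB this (by simp [Prog.ev, Store.push, Mem.store, Mem.item]) le_rfl
    have hk : k.reverse.map ({m with q := m.item a :: m.q} : Mem).item = k.reverse.map m.item := by
      refine List.map_congr_left fun b hb => Mem.item_set_q _ _ fun h => h2' ?_
      rw [← h]
      simp only [List.mem_reverse] at hb
      simp [hb]
    have h3 := ih (m := {m with q := m.item a :: m.q}) (fun h => h2' (by simp [h]))
      (fun b hb => by
        rw [Mem.item_set_q _ _ fun h => h2' (by rw [← h]; simp [hb])]
        exact hl' b (by simp [hb]))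
    rw [hk] at h3
    have h4 := does_seqs_cons hB h1 h3
    simp only [List.reverse_cons, List.map_append, List.append_assoc, List.map_cons, List.map_nil,
      List.cons_append, List.nil_append, List.length_cons]
    exact Runs.mono h4 (by omega)

/-! ### One copy of the gadget -/

/-- The unary constraint `(t, t r)` on the variable on top of stack `i`; then increase `t`. -/
def scaledUnary (r : ℝ) (i : ℕ) : Prog :=
  seqs [.push r 14, .arith .mul 5 14 14,
    emit [.inr i, .inl (-1), .inr 5, .inr 14, .inl (-1)], .pop 14, .pop 14,
    .push 1 14, .arith .add 5 14 14, .pop 5, .copy 14 5, .pop 14, .pop 14]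

/-- Increase the number of variables. -/
def newVar : Prog :=
  seqs [.push 1 7, .push 1 14, .arith .add 6 14 14, .pop 6, .copy 14 6, .pop 14, .pop 14]

/-- Multiply the top of `w` by `r`. -/
def decay (r : ℝ) : Prog :=
  seqs [.push r 14, .arith .mul 13 14 14, .pop 13, .copy 14 13, .pop 14, .pop 14]

lemma unaryRaw_code (u v : ℝ≥0) (x : ℕ) :
    (unaryRaw u v x).code = [(x : ℝ), -1, (u : ℝ), (v : ℝ), -1] := by
  simp [Raw.code, unaryRaw, Constraint.table, points]

lemma does_scaledUnary {B : ℕ} (hB : 1 ≤ B) {m : Mem} {r T : ℝ≥0} {i x : ℕ}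
    (hi : i = 11 ∨ i = 12) (hx : m.store.top i = x) (ht : m.t = [(T : ℝ)]) (hr : len (r : ℝ) ≤ B)
    (hxl : len (x : ℝ) ≤ B)
    (hT : len (T : ℝ) ≤ B) (hTr : len (T * r : ℝ) ≤ B) (hT1 : len (T + 1 : ℝ) ≤ B) :
    Does B (scaledUnary r i) m {m with
      q := (unaryRaw T (T * r) x).code ++ m.q, t := [((T + 1 : ℝ≥0) : ℝ)]} 44 := by
  have h1 : Does B (.push r 14) m {m with k := (r : ℝ) :: m.k} 1 := does_push_k hB m hr
  have h2 : Does B (.arith .mul 5 14 14) {m with k := (r : ℝ) :: m.k}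
      {m with k := T * r :: (r : ℝ) :: m.k} 1 :=
    Does.of_ok hB (by simpa [Prog.Ok, Op.eval, Store.top, Mem.store, ht] using hTr)
      (by simp [Prog.ev, Op.eval, Store.push, Store.top, Mem.store, ht]) le_rfl
  have hit : ({m with k := T * r :: (r : ℝ) :: m.k} : Mem).item (.inr i) = x := by
    rw [← hx]
    rcases hi with rfl | rfl <;> rfl
  have hit5 : ({m with k := T * r :: (r : ℝ) :: m.k} : Mem).item (.inr 5) = T := by
    simp [Mem.item, Store.top, Mem.store, ht]
  have hit14 : ({m with k := T * r :: (r : ℝ) :: m.k} : Mem).item (.inr 14) = T * r := by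
    simp [Mem.item, Store.top, Mem.store]
  have hin : ∀ n : Mem, n.item (.inl (-1)) = -1 := fun _ => rfl
  have h3 := does_emit hB (m := {m with k := T * r :: (r : ℝ) :: m.k})
    (l := [.inr i, .inl (-1), .inr 5, .inr 14, .inl (-1)])
    (by rcases hi with rfl | rfl <;> simp)
    (by
      intro a ha
      simp only [List.mem_cons, List.not_mem_nil, or_false] at ha
      rcases ha with rfl | rfl | rfl | rfl | rfl
      · rwa [hit]
      · rw [hin, len_neg_one]; exact hB
      · rwa [hit5]
      · rwa [hit14]
      · rw [hin, len_neg_one]; exact hB)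
  simp only [List.map_cons, List.map_nil, hit, hin, hit5, hit14] at h3
  have h4 : Does B (seqs [.pop 14, .pop 14, .push 1 14, .arith .add 5 14 14, .pop 5, .copy 14 5,
      .pop 14, .pop 14]) {m with
        k := T * r :: (r : ℝ) :: m.k, q := (unaryRaw T (T * r) x).code ++ m.q}
      {m with q := (unaryRaw T (T * r) x).code ++ m.q, t := [((T + 1 : ℝ≥0) : ℝ)]} 17 := by
    refine Does.of_ok hB ?_ ?_ (by simp [Prog.count, seqs])
    · simp [seqs, Prog.Ok, Prog.ev, Store.push, Store.top, Mem.store, Op.eval, ht, len_one, hB, hT1]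
    · simp [seqs, Prog.ev, Store.push, Store.top, Mem.store, Op.eval, ht]
  rw [unaryRaw_code] at h4 ⊢
  push_cast at h4 ⊢
  exact Runs.mono (does_seqs_cons hB h1 (does_seqs_cons hB h2 (does_seqs_cons hB h3 h4)))
    (by simp)

lemma does_newVar {B : ℕ} (hB : 1 ≤ B) {m : Mem} {v : ℕ} (hv : m.v = [(v : ℝ)])
    (hvs : m.vs = List.replicate v 1) (hl : len ((v + 1 : ℕ) : ℝ) ≤ B) :
    Does B newVar m {m with
      v := [((v + 1 : ℕ) : ℝ)], vs := List.replicate (v + 1) 1} 15 := by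
  push_cast at hl
  refine Does.of_ok hB ?_ ?_ (by simp [newVar, Prog.count, seqs])
  · simp [newVar, seqs, Prog.Ok, Prog.ev, Store.push, Store.top, Mem.store, Op.eval, hv, len_one,
      hB, hl]
  · simp [newVar, seqs, Prog.ev, Store.push, Store.top, Mem.store, Op.eval, hv, hvs,
      List.replicate_succ]

lemma does_decay {B : ℕ} (hB : 1 ≤ B) {m : Mem} {w r : ℝ} (hw : m.w = [w])
    (hr : len r ≤ B) (hwr : len (w * r) ≤ B) :
    Does B (decay r) m {m with w := [w * r]} 13 := by
  refine Does.of_ok hB ?_ ?_ (by simp [decay, Prog.count, seqs])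
  · simp [decay, seqs, Prog.Ok, Prog.ev, Store.push, Store.top, Mem.store, Op.eval, hw, hr, hwr]
  · simp [decay, seqs, Prog.ev, Store.push, Store.top, Mem.store, Op.eval, hw]

namespace Pinnable
variable (G : Pinnable)

/-- The items of an application of the pinned constraint to the tops of the stacks `x`, `y`. -/
def items (x y : ℕ) : List (ℝ ⊕ ℕ) :=
  List.ofFn (fun p => .inr (pin G.i G.j x y 17 p)) ++ .inl (-1) :: (G.f.table.map .inl ++ [.inl (-1)])

lemma does_items {B : ℕ} (hB : 1 ≤ B) {m : Mem} {rx ry x y o : ℕ} (hrx : rx ≠ 2) (hry : ry ≠ 2)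
    (hx : m.store.top rx = x) (hy : m.store.top ry = y) (ho : m.o = [(o : ℝ)])
    (hlx : len (x : ℝ) ≤ B) (hly : len (y : ℝ) ≤ B) (hlo : len (o : ℝ) ≤ B)
    (ht : ∀ r ∈ G.f.table, len r ≤ B) :
    Does B (emit (G.items rx ry)) m {m with q := (G.app x y o).code ++ m.q}
      (2 * (G.f.arity + 2 ^ G.f.arity + 2) + 1) := by
  have hpin : ∀ p, m.item (.inr (pin G.i G.j rx ry 17 p)) = (pin G.i G.j x y o p : ℕ) := by
    intro p
    simp only [pin, Mem.item, Sum.elim_inr]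
    split_ifs
    · exact hx
    · exact hy
    · simp [Store.top, Mem.store, ho]
  have hmap : (G.items rx ry).map m.item = (G.app x y o).code := by
    simp only [items, Raw.code, app, List.map_append, List.map_ofFn, List.map_cons, List.map_nil,
      List.map_map]
    congr 1
    · congr 1
      funext p
      exact hpin p
    · congr 2
      exact List.map_id' _
  have h := does_emit hB (m := m) (l := G.items rx ry) ?_ ?_
  · rw [hmap] at h
    have hl : (G.items rx ry).length = G.f.arity + 2 ^ G.f.arity + 2 := by
      simp [items, Constraint.table, points_length]
      omega
    rwa [hl] at h
  · simp only [items, List.mem_append, List.mem_ofFn, List.mem_cons, List.mem_map]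
    rintro (⟨p, hp⟩ | hp | ⟨_, _, hp⟩ | hp)
    · simp only [pin, Sum.inr.injEq] at hp
      split_ifs at hp <;> simp_all
    · simp at hp
    · simp at hp
    · simp at hp
  · intro a ha
    simp only [items, List.mem_append, List.mem_ofFn, List.mem_cons, List.mem_map,
      List.not_mem_nil, or_false] at ha
    rcases ha with ⟨p, rfl⟩ | rfl | ⟨r, hr, rfl⟩ | rfl
    · rw [hpin]
      simp only [pin]
      split_ifs <;> assumption
    · change len (-1) ≤ B
      rw [len_neg_one]; exact hB
    · exact ht r hr
    · change len (-1) ≤ B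
      rw [len_neg_one]; exact hB

/-- Write one copy of the gadget for the variables on top of `xs` and `ys`. -/
def copyProg : Prog := seqs [scaledUnary G.alpha 11, scaledUnary G.beta 12,
  emit [.inr 6, .inl (-1), .inl 1, .inl (G.alpha * G.beta), .inl (-1)],
  emit (G.items 11 6), emit (G.items 6 12), newVar, decay G.lam]

/-- Bounds for the numbers that occur in the construction. -/
structure Bounds (B : ℕ) (tmax : ℝ≥0) (vmax : ℕ) (wmax : ℝ) : Prop where
  one : 1 ≤ B
  half : len (1 / 2) ≤ B
  table : ∀ r ∈ G.f.table, len r ≤ B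
  alpha : len (G.alpha : ℝ) ≤ B
  beta : len (G.beta : ℝ) ≤ B
  alpha_beta : len (G.alpha * G.beta : ℝ) ≤ B
  lam : len (G.lam : ℝ) ≤ B
  base : len (G.base : ℝ) ≤ B
  t : ∀ T : ℝ≥0, 1 ≤ T → T ≤ tmax →
    len (T : ℝ) ≤ B ∧ len (T * G.alpha : ℝ) ≤ B ∧ len (T * G.beta : ℝ) ≤ B
  v : ∀ v ≤ vmax, len (v : ℝ) ≤ B
  -- The weight is multiplied by `lam` only while it is at least `1/2`, so it never falls below `lam
  -- / 2`.
  w : ∀ w : ℝ, G.lam / 2 ≤ w → w ≤ wmax → len w ≤ B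

end Pinnable

/-- The memory that holds a partial construction. -/
def Mem.withPartial (m : Mem) (s : Partial) (w : List ℝ) : Mem :=
  {m with
    q := s.L.flatMap Raw.code, v := [(s.v : ℝ)], vs := List.replicate s.v 1, t := [(s.T : ℝ)],
    w := w}

namespace Pinnable
variable {G : Pinnable}

/-- The number of steps of `copyProg`. -/
def copyCost (G : Pinnable) : ℕ := 4 * (G.f.arity + 2 ^ G.f.arity + 2) + 200

/-- The question is a stack, so the members of `copyApps` are written from the last to the first,
with the number of variables increased only after the fresh index has been used. -/
lemma Bounds.does_copy {B : ℕ} {tmax : ℝ≥0} {vmax : ℕ} {wmax : ℝ} (h : G.Bounds B tmax vmax wmax)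
    {m : Mem} {s : Partial} {w : ℝ} {x y o : ℕ} {X Y : List ℝ} (hx : m.xs = (x : ℝ) :: X)
    (hy : m.ys = (y : ℝ) :: Y) (ho : m.o = [(o : ℝ)]) (hxl : x ≤ vmax) (hyl : y ≤ vmax)
    (hol : o ≤ vmax) (hT : 1 ≤ s.T) (hT2 : s.T + 2 ≤ tmax) (hv : s.v + 1 ≤ vmax)
    (hw : 1 / 2 ≤ w) (hw2 : w ≤ wmax) :
    Does B G.copyProg (m.withPartial s [w]) (m.withPartial (G.copy o x y s) [w * G.lam])
      G.copyCost := by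
  have hB := h.one
  have hlx := h.v x hxl
  have hly := h.v y hyl
  have hlo := h.v o hol
  have t1 : s.T + 1 ≤ tmax := le_trans (by gcongr; norm_num) hT2
  have t0 : s.T ≤ tmax := le_trans le_self_add t1
  have e2 : s.T + 1 + 1 = s.T + 2 := by ring
  obtain ⟨l1, l2, -⟩ := h.t s.T hT t0
  obtain ⟨l3, -, l4⟩ := h.t (s.T + 1) (le_trans hT le_self_add) t1
  obtain ⟨l5, -, -⟩ := h.t (s.T + 2) (le_trans hT le_self_add) hT2
  rw [← e2] at l5
  push_cast at l3 l5
  have a1 := does_scaledUnary hB (m := m.withPartial s [w]) (r := G.alpha) (i := 11) (x := x)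
    (Or.inl rfl) (by simp [Store.top, Mem.store, Mem.withPartial, hx]) rfl h.alpha hlx l1 l2 l3
  have a2 := does_scaledUnary hB (m := {m.withPartial s [w] with
    q := (unaryRaw s.T (s.T * G.alpha) x).code ++ s.L.flatMap Raw.code,
    t := [((s.T + 1 : ℝ≥0) : ℝ)]}) (r := G.beta) (i := 12) (x := y)
    (Or.inr rfl) (by simp [Store.top, Mem.store, Mem.withPartial, hy]) rfl h.beta hly
    (by push_cast; exact l3) l4 (by push_cast; exact l5)
  have lv := h.v s.v (by omega)
  set m3 : Mem := {m.withPartial s [w] with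
    q := (unaryRaw (s.T + 1) ((s.T + 1) * G.beta) y).code ++
      ((unaryRaw s.T (s.T * G.alpha) x).code ++ s.L.flatMap Raw.code),
    t := [((s.T + 1 + 1 : ℝ≥0) : ℝ)]} with hm3
  have a3 := does_emit hB (m := m3)
    (l := [.inr 6, .inl (-1), .inl 1, .inl (G.alpha * G.beta : ℝ), .inl (-1)])
    (by simp) (by
      intro a ha
      simp only [List.mem_cons, List.not_mem_nil, or_false] at ha
      rcases ha with rfl | rfl | rfl | rfl | rfl
      · exact lv
      · change len (-1) ≤ B; rw [len_neg_one]; exact hB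
      · change len 1 ≤ B; rw [len_one]; exact hB
      · exact h.alpha_beta
      · change len (-1) ≤ B; rw [len_neg_one]; exact hB)
  have e3 : ([.inr 6, .inl (-1), .inl 1, .inl (G.alpha * G.beta : ℝ), .inl (-1)] :
      List (ℝ ⊕ ℕ)).map m3.item = (unaryRaw 1 (G.alpha * G.beta) s.v).code := by
    rw [unaryRaw_code]
    push_cast
    rfl
  rw [e3] at a3
  set m4 : Mem := {m3 with q := (unaryRaw 1 (G.alpha * G.beta) s.v).code ++ m3.q} with hm4
  have a4 := G.does_items hB (m := m4) (rx := 11) (ry := 6) (x := x) (y := s.v) (o := o)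
    (by norm_num) (by norm_num) (by simp [Store.top, Mem.store, Mem.withPartial, hm4, hm3, hx])
    (by simp [Store.top, Mem.store, Mem.withPartial, hm4, hm3]) ho hlx lv hlo h.table
  set m5 : Mem := {m4 with q := (G.app x s.v o).code ++ m4.q} with hm5
  have a5 := G.does_items hB (m := m5) (rx := 6) (ry := 12) (x := s.v) (y := y) (o := o)
    (by norm_num) (by norm_num) (by simp [Store.top, Mem.store, Mem.withPartial, hm5, hm4, hm3])
    (by simp [Store.top, Mem.store, Mem.withPartial, hm5, hm4, hm3, hy]) ho lv hly hlo h.table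
  set m6 : Mem := {m5 with q := (G.app s.v y o).code ++ m5.q} with hm6
  have a6 := does_newVar hB (m := m6) (v := s.v) rfl rfl (h.v _ hv)
  have hwl : len (w * G.lam) ≤ B := by
    have hl := G.lam_pos
    have hl' : (0 : ℝ) < G.lam := by exact_mod_cast hl
    have hl1 : (G.lam : ℝ) ≤ 1 := by exact_mod_cast G.lam_lt_one.le
    refine h.w _ ?_ ?_ <;> nlinarith
  have a7 := does_decay hB (m := {m6 with
    v := [((s.v + 1 : ℕ) : ℝ)], vs := List.replicate (s.v + 1) 1}) (w := w) rfl h.lam hwl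
  have a8 := does_seqs_cons hB a1 (does_seqs_cons hB a2 (does_seqs_cons hB a3 (does_seqs_cons hB a4
    (does_seqs_cons hB a5 (does_seqs_cons hB a6 (does_seqs_cons hB a7 (does_seqs_nil hB _)))))))
  have e : m.withPartial (G.copy o x y s) [w * G.lam] = {m6 with
    v := [((s.v + 1 : ℕ) : ℝ)], vs := List.replicate (s.v + 1) 1, w := [w * (G.lam : ℝ)]} := by
    simp only [Mem.withPartial, copy, copyApps, List.flatMap_append, List.flatMap_cons,
      List.flatMap_nil, List.append_assoc, List.nil_append, hm6, hm5, hm4, hm3, e2]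
  rw [e]
  refine Runs.mono a8 ?_
  simp only [copyCost, List.length_cons, List.length_nil]
  omega

/-- Write copies until the weight on `w` is below `1/2`. -/
def copiesProg (G : Pinnable) : Prog := .loop (.le 18 13) G.copyProg

/-- The machine does not know `k`; the bounds on `w * lam ^ i` say that the test of the loop
succeeds exactly `k` times. -/
lemma Bounds.does_copies {B : ℕ} {tmax : ℝ≥0} {vmax : ℕ} {wmax : ℝ} (h : G.Bounds B tmax vmax wmax)
    {m : Mem} {s : Partial} {w : ℝ} {x y o k : ℕ} {X Y : List ℝ} (hx : m.xs = (x : ℝ) :: X)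
    (hy : m.ys = (y : ℝ) :: Y) (ho : m.o = [(o : ℝ)]) (hh : m.h = [1 / 2]) (hxl : x ≤ vmax)
    (hyl : y ≤ vmax) (hol : o ≤ vmax) (hT : 1 ≤ s.T) (hT2 : s.T + 2 * k ≤ tmax)
    (hv : s.v + k ≤ vmax) (hlo : ∀ i < k, 1 / 2 ≤ w * G.lam ^ i) (hhi : w * G.lam ^ k < 1 / 2)
    (hw2 : w ≤ wmax) :
    Does B G.copiesProg (m.withPartial s [w])
      (m.withPartial (G.copies o k x y s) [w * G.lam ^ k]) ((G.copyCost + 1) * k + 1) := by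
  induction k generalizing s w with
  | zero =>
    simp only [pow_zero, mul_one] at hhi ⊢
    refine runs_loop_done h.one ?_
    simpa [Test.Holds, Store.top, Mem.store, Mem.withPartial, hh] using hhi
  | succ k ih =>
    have h0 := hlo 0 (by omega)
    rw [pow_zero, mul_one] at h0
    have hl0 : (0 : ℝ) < G.lam := by exact_mod_cast G.lam_pos
    have hl1 : (G.lam : ℝ) ≤ 1 := by exact_mod_cast G.lam_lt_one.le
    push_cast at hT2
    have h1 := h.does_copy (s := s) (w := w) hx hy ho hxl hyl hol hT
      (le_trans (by gcongr; exact le_mul_of_one_le_right' le_add_self) hT2) (by omega) h0 hw2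
    have h2 := ih (s := G.copy o x y s) (w := w * G.lam) (le_trans hT (by simp [copy]))
      (le_trans (le_of_eq (by simp only [copy]; ring)) hT2) (by simp only [copy]; omega)
      (fun i hi => by
        have := hlo (i + 1) (by omega)
        rwa [pow_succ', ← mul_assoc] at this)
      (by rwa [pow_succ', ← mul_assoc] at hhi) (by nlinarith)
    have h3 := runs_loop_step (t := .le 18 13) h.one
      (by simpa [Test.Holds, Store.top, Mem.store, Mem.withPartial, hh] using h0) h1 h2
    rw [copies, Function.iterate_succ_apply, pow_succ', ← mul_assoc]
    refine Runs.mono h3 ?_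
    ring_nf
    omega

def replaceProg (G : Pinnable) : Prog :=
  untilEmpty 11 (seqs [.arith .mul 4 4 13, G.copiesProg, .pop 13, .pop 11, .pop 12])

/-- The weight restarts at `z * z` for each implication, so all of them get the same number `k` of
copies. -/
lemma Bounds.does_replace {B : ℕ} {tmax : ℝ≥0} {vmax : ℕ} {wmax : ℝ}
    (h : G.Bounds B tmax vmax wmax) {m : Mem} {s : Partial} {z : ℝ} {o k : ℕ} {l : List (ℕ × ℕ)}
    (hx : m.xs = fsts l) (hy : m.ys = snds l) (ho : m.o = [(o : ℝ)]) (hh : m.h = [1 / 2])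
    (hg : m.g = []) (hz : m.z = [z]) (hl : ∀ p ∈ l, p.1 ≤ vmax ∧ p.2 ≤ vmax)
    (hol : o ≤ vmax) (hT : 1 ≤ s.T) (hT2 : s.T + 2 * (k * l.length) ≤ tmax)
    (hv : s.v + k * l.length ≤ vmax) (hz1 : 1 ≤ z) (hlo : ∀ i < k, 1 / 2 ≤ z * z * G.lam ^ i)
    (hhi : z * z * G.lam ^ k < 1 / 2) (hw2 : z * z ≤ wmax) :
    Does B G.replaceProg (m.withPartial s [])
      ({m with xs := [], ys := []}.withPartial (G.replaceAll o k l s) [])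
      (((G.copyCost + 1) * k + 20) * l.length + 6) := by
  have hB := h.one
  refine UntilLoop.does hB hg (c := ((G.copyCost + 1) * k + 20) * l.length + 4) ?_
  induction l generalizing m s with
  | nil =>
    have e : {m with xs := [], ys := []} = m := by
      obtain ⟨⟩ := m
      simp only at hx hy
      subst hx hy
      rfl
    rw [e]
    exact untilLoop_done hB hg hx
  | cons p l ih =>
    simp only [List.length_cons, Nat.mul_add, mul_one] at hT2 hv
    push_cast at hT2
    have hl1 : (G.lam : ℝ) ≤ 1 := by exact_mod_cast G.lam_lt_one.le
    have hzz : len (z * z) ≤ B := h.w _ (by nlinarith) hw2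
    have a1 : Does B (.arith .mul 4 4 13) (m.withPartial s []) (m.withPartial s [z * z]) 1 :=
      Does.of_ok hB (by simpa [Prog.Ok, Op.eval, Store.top, Mem.store, Mem.withPartial, hz] using hzz)
        (by simp [Prog.ev, Op.eval, Store.push, Store.top, Mem.store, Mem.withPartial, hz]) le_rfl
    have hp := hl p (by simp)
    have a2 := h.does_copies (m := m) (s := s) (w := z * z) (k := k) (X := fsts l) (Y := snds l) hx hy
      ho hh hp.1 hp.2 hol hT
      (le_trans (by gcongr; exact le_mul_of_one_le_right' le_add_self) hT2) (by omega) hlo hhi hw2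
    have a3 : Does B (seqs [.pop 13, .pop 11, .pop 12])
        (m.withPartial (G.copies o k p.1 p.2 s) [z * z * G.lam ^ k])
        ({m with xs := fsts l, ys := snds l}.withPartial (G.copies o k p.1 p.2 s) []) 7 :=
      Does.of_ok hB (by simp [seqs, Prog.Ok])
        (by simp [seqs, Prog.ev, Mem.store, Mem.withPartial, hx, hy, fsts, snds])
        (by simp [Prog.count, seqs])
    have a4 := ih (m := {m with xs := fsts l, ys := snds l}) (s := G.copies o k p.1 p.2 s) rfl rfl
      ho hh hg hz (fun r hr => hl r (by simp [hr]))
      (by rw [copies_T]; exact le_trans hT le_self_add)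
      (by rw [copies_T]; exact le_trans (le_of_eq (by ring)) hT2) (by rw [copies_v]; omega)
    have a5 := untilLoop_step hB (m := m.withPartial s []) (i := 11) hg
      (by simp [Mem.store, Mem.withPartial, hx, fsts])
      (does_seqs_cons hB a1 (does_seqs_cons hB a2 a3)) a4
    refine Runs.mono a5 ?_
    simp only [List.length_cons]
    ring_nf
    omega

end Pinnable

/-! ### The program -/

def prologue : Prog := seqs [.copy 0 3, .pop 0, .push 1 4, .push 0 6]

def Mem.empty : Mem := ⟨[], [], [], [], [], [], [], [], [], [], [], [], [], [], [], [], [], []⟩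

lemma Mem.empty_store : Mem.empty.store = fun _ => [] := by
  funext i
  simp only [Mem.store, Mem.empty]
  split <;> rfl

/-- Write the question: the number of variables and the error tolerance. -/
def finish : Prog := seqs [.push (-1) 2, moveStack 7 2, .copy 3 2]

/-- Copy the first bits of the answer, as many as stack `8` has entries. -/
def readBits : Prog := untilEmpty 8 (seqs [.copy 9 10, .pop 9, .pop 8])

def epilogue : Prog := seqs [readBits, moveStack 10 1]

lemma firstBits_succ (n : ℕ) (y : List Bool) :
    firstBits (n + 1) y = y.headD false :: firstBits n y.tail := by
  cases y <;> simp [firstBits, List.ofFn_succ]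

lemma bits_headD (y : List Bool) : (bits y).headD 0 = if y.headD false then 1 else 0 := by
  cases y <;> simp [bits]

lemma len_of_mem_bits {B : ℕ} (hB : 1 ≤ B) {y : List Bool} : ∀ r ∈ bits y, len r ≤ B := by
  intro r hr
  simp only [bits, List.mem_map] at hr
  obtain ⟨b, -, rfl⟩ := hr
  cases b <;> simp [len_one, len_zero, hB]

/-- The oracle may return a string of any length. An empty stack reads as zero, in agreement with
the padding in `firstBits`, and the number of rounds does not depend on the answer. -/
lemma does_readBits {B : ℕ} (hB : 1 ≤ B) {m : Mem} {n : ℕ} {y : List Bool} (hg : m.g = [])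
    (hn : m.ns = List.replicate n 1) (ha : m.a = bits y) :
    Does B readBits m {m with
      ns := [], a := bits (y.drop n), b := (bits (firstBits n y)).reverse ++ m.b} (9 * n + 6) := by
  refine UntilLoop.does hB hg (c := 9 * n + 4) ?_
  induction n generalizing m y with
  | zero =>
    have e : {m with
        ns := [], a := bits (y.drop 0), b := (bits (firstBits 0 y)).reverse ++ m.b} = m := by
      obtain ⟨⟩ := m
      simp only [List.replicate_zero] at hn ha
      subst hn ha
      simp [firstBits, bits]
    rw [e]
    exact untilLoop_done hB hg hn
  | succ n ih =>
    have htop : m.a.headD 0 = if y.headD false then 1 else 0 := by rw [ha, bits_headD]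
    have hl : len (m.a.headD 0) ≤ B := by
      rw [htop]
      split_ifs <;> simp [len_one, len_zero, hB]
    have h1 : Does B (seqs [.copy 9 10, .pop 9, .pop 8]) m {m with
        ns := List.replicate n 1, a := bits y.tail,
        b := (if y.headD false then 1 else 0) :: m.b} 7 := by
      refine Does.of_ok hB ?_ ?_ (by simp [Prog.count, seqs])
      · simpa [seqs, Prog.Ok, Store.top, Mem.store] using hl
      · rw [← htop]
        simp [seqs, Prog.ev, Store.push, Store.top, Mem.store, hn, ha, List.replicate_succ, bits,
          List.map_tail]
    have h2 := untilLoop_step hB (i := 8) hg (by simp [Mem.store, hn, List.replicate_succ]) h1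
      (ih (m := {m with
        ns := List.replicate n 1, a := bits y.tail,
        b := (if y.headD false then 1 else 0) :: m.b}) hg rfl rfl)
    rw [firstBits_succ]
    have e1 : y.tail.drop n = y.drop (n + 1) := by simp
    rw [e1] at h2
    simp only [bits, List.map_cons, List.reverse_cons, List.append_assoc, List.cons_append,
      List.nil_append] at h2 ⊢
    exact Runs.mono h2 (by omega)

lemma does_epilogue {B : ℕ} (hB : 1 ≤ B) {m : Mem} {n : ℕ} {y : List Bool} (hg : m.g = [])
    (hn : m.ns = List.replicate n 1) (ha : m.a = bits y) (hb : m.b = []) (ho : m.out = []) :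
    ∃ m', m'.out = bits (firstBits n y) ∧ Does B epilogue m m' (16 * n + 15) := by
  have h1 := does_readBits hB hg hn ha
  rw [hb, List.append_nil] at h1
  have h2 := does_moveStack hB (i := 10) (j := 1) (fun a b => {m with
    ns := [], a := bits (y.drop n), b := a, out := b}) (fun _ _ => hg) (fun _ _ => rfl)
    (fun _ _ => rfl) (fun _ _ _ => by simp) (fun _ _ _ => by simp)
    (l := (bits (firstBits n y)).reverse) (by simpa using len_of_mem_bits hB) m.out
  refine ⟨_, ?_, Runs.mono (does_seqs_cons hB h1 (does_seqs_cons hB h2 (does_seqs_nil hB _))) ?_⟩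
  · simp [ho]
  · simp [bits, firstBits]
    omega

/-! ### The question as a whole -/

namespace Pinnable
variable (G : Pinnable)

/-- Write the pinned variable, and prepare the constants. -/
def setup : Prog := seqs [
  seqs [.push (1 / 2) 18, .copy 6 17, .push G.base 14, .arith .add 4 14 5, .pop 14],
  emit [.inr 6, .inl (-1), .inl 1, .inl 0, .inl (-1)], newVar]

/-- The question grows from the bottom of its stack: first the applications, then the separator, the
number of variables in unary, and the tolerance on top. The number of variables is known only at the
end, hence the running count on stack 7. -/
def question : Prog := seqs [prologue, readUnary, .pop 0, parse, G.setup, G.replaceProg, finish]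

/-- The reduction. -/
def program : Prog := .seq G.question (.seq (.query 2 9) epilogue)

variable {G}

lemma Bounds.does_setup {B : ℕ} {tmax : ℝ≥0} {vmax : ℕ} {wmax : ℝ} (h : G.Bounds B tmax vmax wmax)
    {m : Mem} {n : ℕ} {L : List Raw} (hz : m.z = [(totalSpread L : ℝ)]) (hv : m.v = [(n : ℝ)])
    (hvs : m.vs = List.replicate n 1) (hq : m.q = (others L).flatMap Raw.code) (ht : m.t = [])
    (hw : m.w = []) (ho : m.o = []) (hh : m.h = []) (hT : totalSpread L + G.base ≤ tmax)
    (hn : n + 1 ≤ vmax) :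
    Does B G.setup m ({m with o := [(n : ℝ)], h := [1 / 2]}.withPartial (G.initial n L) []) 41 := by
  have hB := h.one
  have hlT := (h.t (totalSpread L + G.base) (le_trans (one_le_totalSpread L) le_self_add) hT).1
  have hln := h.v n (by omega)
  have a1 : Does B (seqs [.push (1 / 2) 18, .copy 6 17, .push G.base 14, .arith .add 4 14 5, .pop 14])
      m {m with o := [(n : ℝ)], h := [1 / 2], t := [((totalSpread L + G.base : ℝ≥0) : ℝ)]} 11 := by
    have h2 := h.half
    push_cast at hlT
    refine Does.of_ok hB ?_ ?_ (by simp [Prog.count, seqs])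
    · simp [seqs, Prog.Ok, Prog.ev, Store.push, Store.top, Mem.store, Op.eval, hz, hv, hlT, hln,
        h.base]
      simpa using h2
    · simp [seqs, Prog.ev, Store.push, Store.top, Mem.store, Op.eval, hz, hv, ht, ho, hh]
  set m2 : Mem := {m with
    o := [(n : ℝ)], h := [1 / 2], t := [((totalSpread L + G.base : ℝ≥0) : ℝ)]} with hm2
  have a2 := does_emit hB (m := m2) (l := [.inr 6, .inl (-1), .inl 1, .inl 0, .inl (-1)])
    (by simp) (by
      intro a ha
      simp only [List.mem_cons, List.not_mem_nil, or_false] at ha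
      rcases ha with rfl | rfl | rfl | rfl | rfl
      · simpa [Mem.item, Store.top, Mem.store, hm2, hv] using hln
      · change len (-1) ≤ B; rw [len_neg_one]; exact hB
      · change len 1 ≤ B; rw [len_one]; exact hB
      · change len 0 ≤ B; rw [len_zero]; exact hB
      · change len (-1) ≤ B; rw [len_neg_one]; exact hB)
  have e2 : ([.inr 6, .inl (-1), .inl 1, .inl 0, .inl (-1)] : List (ℝ ⊕ ℕ)).map m2.item =
      (unaryRaw 1 0 n).code := by
    rw [unaryRaw_code]
    simp [Mem.item, Store.top, Mem.store, hm2, hv]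
  rw [e2] at a2
  have a3 := does_newVar hB (m := {m2 with q := (unaryRaw 1 0 n).code ++ m2.q}) (v := n) hv hvs
    (h.v _ hn)
  have e : ({m with o := [(n : ℝ)], h := [1 / 2]} : Mem).withPartial (G.initial n L) [] = {m2 with
      q := (unaryRaw 1 0 n).code ++ m2.q, v := [((n + 1 : ℕ) : ℝ)],
      vs := List.replicate (n + 1) 1} := by
    simp only [Mem.withPartial, initial, List.flatMap_cons, hm2, hq, hw]
  rw [e]
  exact does_seqs_cons hB a1 (does_seqs_cons hB a2 (does_seqs_cons hB a3 (does_seqs_nil hB _)))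

lemma does_prologue {B : ℕ} (hB : 1 ≤ B) {ε : ℝ} (hε : len ε ≤ B) (I : List ℝ) :
    Does B prologue {Mem.empty with inp := ε :: I}
      {Mem.empty with inp := I, e := [ε], z := [1], v := [0]} 9 := by
  refine Does.of_ok hB ?_ ?_ (by simp [prologue, Prog.count, seqs])
  · simp [prologue, seqs, Prog.Ok, Store.top, Mem.store, hε, len_one, len_zero, hB]
  · simp [prologue, seqs, Prog.ev, Store.push, Store.top, Mem.store, Mem.empty]

lemma does_finish {B : ℕ} (hB : 1 ≤ B) {m : Mem} {v : ℕ} {ε : ℝ} (hvs : m.vs = List.replicate v 1)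
    (hg : m.g = []) (he : m.e = [ε]) (hε : len ε ≤ B) :
    Does B finish m {m with
      vs := [], q := ε :: (List.replicate v 1 ++ -1 :: m.q)} (7 * v + 12) := by
  have h1 := does_push_q hB m (r := -1) (by rw [len_neg_one]; exact hB)
  have h2 := does_moveStack hB (i := 7) (j := 2) (fun a b => {m with vs := a, q := b})
    (fun _ _ => hg) (fun _ _ => rfl) (fun _ _ => rfl) (fun _ _ _ => by simp) (fun _ _ _ => by simp)
    (l := m.vs) (by rw [hvs]; intro r hr; rw [List.eq_of_mem_replicate hr, len_one]; exact hB)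
    (-1 :: m.q)
  have e : m.vs.reverse = List.replicate v 1 := by rw [hvs, List.reverse_replicate]
  have hl : m.vs.length = v := by simp [hvs]
  rw [e, hl] at h2
  have h3 : Does B (.copy 3 2) {m with vs := [], q := List.replicate v 1 ++ -1 :: m.q}
      {m with vs := [], q := ε :: (List.replicate v 1 ++ -1 :: m.q)} 1 :=
    Does.of_ok hB (by simpa [Prog.Ok, Store.top, Mem.store, he] using hε)
      (by simp [Prog.ev, Store.push, Store.top, Mem.store, he]) le_rfl
  exact Runs.mono (does_seqs_cons hB h1 (does_seqs_cons hB h2 (does_seqs_cons hB h3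
    (does_seqs_nil hB _)))) (by omega)

/-- The number of steps up to the question. -/
def questionCost (G : Pinnable) (n k p l : ℕ) : ℕ :=
  16 * n + 62 * l + ((G.copyCost + 1) * k + 20) * p + 7 * (n + 1 + k * p) + 100

lemma replaceAll_v (o k : ℕ) (l : List (ℕ × ℕ)) (s : Partial) :
    (G.replaceAll o k l s).v = s.v + k * l.length := by
  induction l generalizing s with
  | nil => rfl
  | cons p l ih =>
    refine (ih _).trans ?_
    rw [copies_v, List.length_cons]
    ring

lemma Bounds.does_question {B N : ℕ} {tmax : ℝ≥0} {vmax : ℕ} {wmax : ℝ}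
    (h : G.Bounds B tmax vmax wmax) {n k : ℕ} {L : List Raw} {ε : ℝ} (hε : len ε ≤ B)
    (hL : ∀ c ∈ L, ∀ j, c.scope j < n) (hN : (totalSpread L : ℝ) ≤ 2 ^ N) (hNB : N + 1 ≤ B)
    (hT : totalSpread L + G.base + 2 * (k * (impPairs L).length) ≤ tmax)
    (hv : n + 1 + k * (impPairs L).length ≤ vmax)
    (hlo : ∀ i < k, 1 / 2 ≤ totalSpread L * totalSpread L * (G.lam : ℝ) ^ i)
    (hhi : totalSpread L * totalSpread L * (G.lam : ℝ) ^ k < 1 / 2)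
    (hw : (totalSpread L * totalSpread L : ℝ) ≤ wmax) :
    ∃ m, m.q = ε :: (List.replicate (G.result n k L).v 1 ++
        -1 :: (G.result n k L).L.flatMap Raw.code) ∧
      m.ns = List.replicate n 1 ∧ m.a = [] ∧ m.b = [] ∧ m.out = [] ∧ m.g = [] ∧
      Does B G.question {Mem.empty with
        inp := ε :: (List.replicate n 1 ++ -1 :: L.flatMap Raw.code)} m
        (G.questionCost n k (impPairs L).length (L.flatMap Raw.code).length) := by
  have hB := h.one
  have hp := impPairs_lt hL
  have a1 := does_prologue hB hε (List.replicate n 1 ++ -1 :: L.flatMap Raw.code)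
  have a2 := does_readUnary hB (m := {Mem.empty with
    inp := List.replicate n 1 ++ -1 :: L.flatMap Raw.code, e := [ε], z := [1], v := [0]}) (n := n)
    (v := 0) rfl (by simp) (fun u hu => h.v u (by omega))
  simp only [Nat.zero_add, Mem.empty, List.append_nil] at a2
  have a3 := does_pop_inp hB (m := {Mem.empty with
    inp := -1 :: L.flatMap Raw.code, e := [ε], z := [1], v := [(n : ℝ)],
    vs := List.replicate n 1, ns := List.replicate n 1}) rfl
  have a4 := does_parse hNB (m := {Mem.empty with
    inp := L.flatMap Raw.code, e := [ε], z := [1], v := [(n : ℝ)],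
    vs := List.replicate n 1, ns := List.replicate n 1}) (z := 1) rfl rfl rfl rfl rfl le_rfl
    (by rwa [one_mul]) (fun c hc j => h.v _ (by have := hL c hc j; omega))
  simp only [one_mul, Mem.empty, List.append_nil] at a4
  have a5 := h.does_setup (m := {Mem.empty with
    e := [ε], z := [(totalSpread L : ℝ)], v := [(n : ℝ)],
    vs := List.replicate n 1, ns := List.replicate n 1, q := (others L).flatMap Raw.code,
    xs := fsts (impPairs L), ys := snds (impPairs L)}) rfl rfl rfl rfl rfl rfl rfl rfl
    (le_trans le_self_add hT) (by omega)
  have a6 := h.does_replace (m := {Mem.empty with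
    e := [ε], z := [(totalSpread L : ℝ)], v := [(n : ℝ)],
    vs := List.replicate n 1, ns := List.replicate n 1, q := (others L).flatMap Raw.code,
    xs := fsts (impPairs L), ys := snds (impPairs L), o := [(n : ℝ)], h := [1 / 2]})
    (s := G.initial n L) (k := k) (o := n) (l := impPairs L) rfl rfl rfl rfl rfl rfl
    (fun p hp' => by have := hp p hp'; omega) (by omega)
    (le_trans (one_le_totalSpread L) le_self_add) hT hv (by exact_mod_cast one_le_totalSpread L)
    hlo hhi hw
  have a7 := does_finish hB (m := ({Mem.empty with
    e := [ε], z := [(totalSpread L : ℝ)], v := [(n : ℝ)],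
    vs := List.replicate n 1, ns := List.replicate n 1, q := (others L).flatMap Raw.code,
    xs := [], ys := [], o := [(n : ℝ)], h := [1 / 2]} : Mem).withPartial (G.result n k L) [])
    (v := (G.result n k L).v) rfl rfl rfl hε
  refine ⟨_, ?_, ?_, ?_, ?_, ?_, ?_, Runs.mono (does_seqs_cons hB a1 (does_seqs_cons hB a2
    (does_seqs_cons hB a3 (does_seqs_cons hB a4 (does_seqs_cons hB a5 (does_seqs_cons hB a6
    (does_seqs_cons hB a7 (does_seqs_nil hB _)))))))) ?_⟩
  · rfl
  · rfl
  · rfl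
  · rfl
  · rfl
  · rfl
  · rw [result, replaceAll_v, questionCost]
    simp only [initial]
    omega

end Pinnable

/-! ### Running the program -/

/-- Randomness enters through the oracle's answer only, so the final configuration is distributed as
the image of that answer. The extra 3 in the time pays for two sequencing steps and the query. -/
lemma Pinnable.run_program {G : Pinnable} {B c n : ℕ} (hB : 1 ≤ B) {w : List ℝ} {ε : ℝ} {m : Mem}
    (hm : Does B G.question {Mem.empty with inp := ε :: w} m c) (hns : m.ns = List.replicate n 1)
    (hb : m.b = []) (ho : m.out = []) (hg : m.g = []) (M : Oracle) :
    (∀ t, ∀ d ∈ (run M (start G.program ε w) t).support, ∀ q a k, d.todo = .query q a :: k →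
      d.store q = m.q) ∧
    ∃ (fin : List Bool → Config) (t : ℕ),
      run M (start G.program ε w) t = (M m.q.tail (m.q.headD 0)).map fin ∧
      ∀ y, (fin y).todo = [] ∧ (fin y).clock ≤ (c + (16 * n + 15)) * B + 3 ∧
        (fin y).store 1 = bits (firstBits n y) := by
  obtain ⟨n₁, t₁, -, ht₁, p₁⟩ := hm [.seq (.query 2 9) epilogue] 1
  have hstart : start G.program ε w =
      ⟨[G.program], ({Mem.empty with inp := ε :: w} : Mem).store, 0⟩ := by
    rw [start, ← Mem.empty_store, Mem.upd_inp]
  have p₂ : DetPath (1 + n₁ + 1) (start G.program ε w)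
      ⟨[.query 2 9, epilogue], m.store, t₁ + 1⟩ := by
    rw [hstart]
    refine (DetPath.trans (.head ⟨fun M => rfl, by simp, by simp [Pinnable.program]⟩ (.refl _))
      p₁).trans (.head ⟨fun M => rfl, by simp, by simp⟩ (.refl _))
  have hpost : ∀ y, ∃ (m' : Mem) (n' t' : ℕ), m'.out = bits (firstBits n y) ∧ n' ≤ (16 * n + 15) * B ∧
      t' ≤ t₁ + 2 + (16 * n + 15) * B ∧
      DetPath n' ⟨[epilogue], ({m with q := [], a := bits y} : Mem).store, t₁ + 2⟩
        ⟨[], m'.store, t'⟩ := by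
    intro y
    obtain ⟨m', h1, h2⟩ := does_epilogue hB (m := {m with q := [], a := bits y}) (n := n) (y := y)
      hg hns rfl hb ho
    obtain ⟨n', t', h3, h4, h5⟩ := h2 [] (t₁ + 2)
    exact ⟨m', n', t', h1, h3, h4, h5⟩
  choose m' n' t' h1 h2 h3 h4 using hpost
  have hquery : run M (start G.program ε w) (1 + n₁ + 1 + 1) =
      (M m.q.tail (m.q.headD 0)).map fun y =>
        ⟨[epilogue], ({m with q := [], a := bits y} : Mem).store, t₁ + 2⟩ := by
    rw [run_add, p₂.run_eq M, PMF.pure_bind, run_one]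
    simp only [step]
    simp only [Mem.upd_q, Mem.upd_a]
    rfl
  have hafter : ∀ u, run M (start G.program ε w) (1 + n₁ + 1 + 1 + u) =
      (M m.q.tail (m.q.headD 0)).bind fun y =>
        run M ⟨[epilogue], ({m with q := [], a := bits y} : Mem).store, t₁ + 2⟩ u := by
    intro u
    rw [run_add, hquery, PMF.bind_map]
    rfl
  constructor
  · intro t d hd q a k hk
    -- Before and after the query the computation is deterministic, so this is the only moment at
    -- which a question is asked.
    rcases lt_trichotomy t (1 + n₁ + 1) with ht | rfl | ht
    · exact absurd hk (p₂.run_lt M t ht d hd q a k)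
    · rw [p₂.run_eq M, PMF.support_pure, Set.mem_singleton_iff] at hd
      subst hd
      simp only [List.cons.injEq, Prog.query.injEq] at hk
      obtain ⟨⟨rfl, -⟩, -⟩ := hk
      rfl
    · obtain ⟨u, rfl⟩ := Nat.exists_eq_add_of_le ht
      rw [Nat.succ_eq_add_one, hafter, PMF.mem_support_bind_iff] at hd
      obtain ⟨y, -, hd⟩ := hd
      by_cases hu : u < n' y
      · exact absurd hk ((h4 y).run_lt M u hu d hd q a k)
      · rw [(h4 y).run_of_final M rfl (not_lt.1 hu), PMF.support_pure,
          Set.mem_singleton_iff] at hd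
        subst hd
        simp at hk
  -- The number of steps after the answer depends on `y`; a uniform bound serves as the common time.
  · refine ⟨fun y => ⟨[], (m' y).store, t' y⟩, 1 + n₁ + 1 + 1 + (16 * n + 15) * B, ?_, fun y =>
      ⟨rfl, ?_, h1 y⟩⟩
    · rw [hafter, PMF.map]
      congr 1
      funext y
      rw [(h4 y).run_of_final M rfl (h2 y)]
      rfl
    · have := h3 y
      simp only
      rw [add_mul]
      omega

/-! ### Bounds -/

lemma length_le_sum_len (l : List ℝ) : l.length ≤ (l.map len).sum := by
  induction l with
  | nil => simp
  | cons r l ih =>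
    have := one_le_len r
    simp only [List.length_cons, List.map_cons, List.sum_cons]
    omega

lemma prod_growth_le {l : List ℝ} (h : ∀ r ∈ l, 0 ≤ r) :
    (l.map growth).prod ≤ 4 ^ (l.map len).sum := by
  induction l with
  | nil => simp
  | cons r l ih =>
    simp only [List.map_cons, List.prod_cons, List.sum_cons, pow_add]
    have h0 := one_le_growth (h r (by simp))
    exact mul_le_mul (growth_le (h r (by simp))) (ih fun s hs => h s (by simp [hs]))
      (List.prod_nonneg (by
        intro s hs
        obtain ⟨r, hr, rfl⟩ := List.mem_map.1 hs
        linarith [one_le_growth (h r (by simp [hr]))])) (by positivity)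

/-- Each table entry contributes a factor of at most 4 to the power of its length, and these lengths
are part of the instance size. -/
lemma totalSpread_le (L : List Raw) :
    (totalSpread L : ℝ) ≤ 4 ^ ((L.flatMap Raw.code).map len).sum := by
  induction L with
  | nil => simp [totalSpread]
  | cons c L ih =>
    have e : (totalSpread (c :: L) : ℝ) = spread c.con * totalSpread L := by simp [totalSpread]
    rw [e, List.flatMap_cons, List.map_append, List.sum_append, pow_add]
    refine mul_le_mul ?_ ih (by positivity) (by positivity)
    rw [coe_spread]
    refine (prod_growth_le fun r hr => ?_).trans (pow_le_pow_right₀ (by norm_num) ?_)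
    · simp only [Constraint.table, List.mem_map] at hr
      obtain ⟨x, -, rfl⟩ := hr
      exact (c.con.val x).2
    · simp only [Raw.code, List.map_append, List.sum_append, List.map_cons, List.sum_cons]
      omega

lemma length_le_flatMap_code (L : List Raw) : L.length ≤ (L.flatMap Raw.code).length := by
  induction L with
  | nil => simp
  | cons c L ih =>
    have : 1 ≤ c.code.length := by simp [Raw.code]; omega
    simp only [List.flatMap_cons, List.length_append, List.length_cons]
    omega

lemma len_natCast_le (v : ℕ) : len (v : ℝ) ≤ v + 1 := by
  rcases Nat.eq_zero_or_pos v with rfl | h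
  · simp [len_zero]
  · refine len_le_of_one_le (by exact_mod_cast h) ?_
    exact_mod_cast Nat.lt_two_pow_self.le

/-- Copying `ε` is charged with its length, which is logarithmic in `1/ε`; a linear bound is enough.
-/
lemma len_le_of_lt_one {ε : ℝ} (h0 : 0 < ε) (h1 : ε < 1) : (len ε : ℝ) ≤ 1 / ε + 2 := by
  have h : len ε ≤ ⌈1 / ε⌉₊ + 1 := by
    refine len_le_of_bounds h0 ?_ (h1.le.trans (one_le_pow₀ (by norm_num)))
    have h2 : 1 / ε ≤ (2 : ℝ) ^ ⌈1 / ε⌉₊ :=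
      (Nat.le_ceil _).trans (by exact_mod_cast Nat.lt_two_pow_self.le)
    rw [div_le_iff₀ h0] at h2
    linarith
  have h2 := (Nat.ceil_lt_add_one (show 0 ≤ 1 / ε by positivity)).le
  have h3 : (len ε : ℝ) ≤ (⌈1 / ε⌉₊ : ℝ) + 1 := by exact_mod_cast h
  linarith

namespace Pinnable
variable (G : Pinnable)

/-- The total length of the constants of the program. -/
def constLen : ℕ := (G.f.table.map len).sum + len (G.alpha : ℝ) + len (G.beta : ℝ) +
  len (G.alpha * G.beta : ℝ) + len (G.lam : ℝ) + len (G.base : ℝ)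

lemma inv_two_pow_len {r : ℝ} (h : 0 < r) : 2 ≤ r * 2 ^ len r := by
  have := le_two_pow_len (inv_pos.2 h)
  rw [len_inv] at this
  calc (2 : ℝ) = r * (2 * r⁻¹) := by field_simp
    _ ≤ _ := by gcongr

lemma len_scaled_le {N : ℕ} {T r : ℝ} (h1 : 1 ≤ T) (hT : T ≤ 2 ^ N) (hr : 0 < r) :
    len (T * r) ≤ N + len r + 1 := by
  have h2 := inv_two_pow_len hr
  have h3 := le_two_pow_len hr
  have hN : (1 : ℝ) ≤ 2 ^ N := one_le_pow₀ (by norm_num)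
  refine len_le_of_bounds (by positivity) ?_ ?_
  · rw [pow_add]
    calc (1 : ℝ) ≤ T * (2 ^ N * (r * 2 ^ len r)) := by
          refine one_le_mul_of_one_le_of_one_le h1 (one_le_mul_of_one_le_of_one_le hN (by linarith))
      _ = _ := by ring
  · rw [pow_add]
    exact mul_le_mul hT (by linarith) hr.le (by positivity)

/-- `S` stands for the instance size and `Q` for the total number of copies. Scales stay below `Z +
base + 2kp`, as each copy raises `T` by 2; the weight starts at `Z²`, whose exponent is `4S`. -/
lemma bounds {B S Q k p n : ℕ} {Z : ℝ≥0} (hZ : (Z : ℝ) ≤ 4 ^ S) (hkp : k * p ≤ Q)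
    (hn : n ≤ S) (hB : 5 * S + 3 * Q + G.constLen + 11 ≤ B) :
    G.Bounds B (Z + G.base + 2 * (k * p)) (n + 1 + k * p) (Z * Z) := by
  have hc := hB
  have e4 : (4 : ℝ) ^ S = 2 ^ (2 * S) := by rw [pow_mul]; norm_num
  rw [e4] at hZ
  have ha : (0 : ℝ) < G.alpha := by exact_mod_cast G.alpha_pos
  have hb : (0 : ℝ) < G.beta := by exact_mod_cast G.beta_pos
  have hl : (0 : ℝ) < G.lam := by exact_mod_cast G.lam_pos
  have hbase : (0 : ℝ) < G.base := by exact_mod_cast G.base_pos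
  simp only [constLen] at hc
  refine ⟨by omega, ?_, ?_, by omega, by omega, by omega, by omega, by omega, ?_, ?_, ?_⟩
  · refine (len_le_of_bounds (N := 1) (by norm_num) (by norm_num) (by norm_num)).trans (by omega)
  · intro r hr
    have := List.single_le_sum (l := G.f.table.map len) (by simp) _ (List.mem_map_of_mem hr)
    omega
  · intro T h1 h2
    have h1' : (1 : ℝ) ≤ T := by exact_mod_cast h1
    have h2' : (T : ℝ) ≤ 2 ^ (2 * S + len (G.base : ℝ) + 2 * Q + 2) := by
      have h3 : (T : ℝ) ≤ Z + G.base + 2 * (k * p) := by exact_mod_cast h2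
      have h4 := le_two_pow_len hbase
      have h5 : (2 * (k * p) : ℝ) ≤ 2 ^ (2 * Q) := by
        have : 2 * (k * p) ≤ 2 ^ (2 * Q) := (Nat.mul_le_mul_left 2 hkp).trans Nat.lt_two_pow_self.le
        exact_mod_cast this
      have o1 : (1 : ℝ) ≤ 2 ^ (2 * S) := one_le_pow₀ (by norm_num)
      have o2 : (1 : ℝ) ≤ 2 ^ len (G.base : ℝ) := one_le_pow₀ (by norm_num)
      have o3 : (1 : ℝ) ≤ 2 ^ (2 * Q) := one_le_pow₀ (by norm_num)
      rw [pow_add, pow_add, pow_add]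
      generalize (2 : ℝ) ^ (2 * S) = a at *
      generalize (2 : ℝ) ^ len (G.base : ℝ) = b at *
      generalize (2 : ℝ) ^ (2 * Q) = c at *
      have i1 : a ≤ a * b * c := by nlinarith [one_le_mul_of_one_le_of_one_le o2 o3]
      have i2 : b ≤ a * b * c := by nlinarith [one_le_mul_of_one_le_of_one_le o1 o3]
      have i3 : c ≤ a * b * c := by nlinarith [one_le_mul_of_one_le_of_one_le o1 o2]
      linarith
    refine ⟨(len_le_of_one_le h1' h2').trans (by omega), (len_scaled_le h1' h2' ha).trans (by omega),
      (len_scaled_le h1' h2' hb).trans (by omega)⟩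
  · intro v hv
    exact (len_natCast_le v).trans (by omega)
  · intro w h1 h2
    have hw : 0 < w := lt_of_lt_of_le (by positivity) h1
    have h3 := inv_two_pow_len hl
    have h4 : w ≤ 2 ^ (4 * S) := by
      refine h2.trans ?_
      rw [show 4 * S = 2 * S + 2 * S by ring, pow_add]
      exact mul_le_mul hZ hZ (by positivity) (by positivity)
    have o1 : (1 : ℝ) ≤ 2 ^ (4 * S) := one_le_pow₀ (by norm_num)
    have o2 : (1 : ℝ) ≤ 2 ^ len (G.lam : ℝ) := one_le_pow₀ (by norm_num)
    refine (len_le_of_bounds (N := 4 * S + len (G.lam : ℝ)) hw ?_ ?_).trans (by omega)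
    · rw [pow_add]
      have : (1 : ℝ) ≤ w * 2 ^ len (G.lam : ℝ) := by nlinarith
      calc (1 : ℝ) ≤ 2 ^ (4 * S) * (w * 2 ^ len (G.lam : ℝ)) :=
            one_le_mul_of_one_le_of_one_le o1 this
        _ = _ := by ring
    · rw [pow_add]
      exact h4.trans (le_mul_of_one_le_right (by positivity) o2)

/-- The number of copies that make a violated implication negligible. -/
lemma exists_copies {D S : ℕ} (hD : (G.lam : ℝ) ^ D ≤ 1 / 2) {Z : ℝ} (h0 : 0 ≤ Z) (hZ : Z ≤ 4 ^ S) :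
    ∃ k ≤ D * (4 * S + 2), (∀ i < k, 1 / 2 ≤ Z * Z * (G.lam : ℝ) ^ i) ∧
      Z * Z * (G.lam : ℝ) ^ k < 1 / 2 := by
  -- Since `Z² ≤ 2^(4S)`, the exponent `4S + 2` of `1/2` leaves `1/4`.
  have hex : Z * Z * (G.lam : ℝ) ^ (D * (4 * S + 2)) < 1 / 2 := by
    have h1 : ((G.lam : ℝ) ^ D) ^ (4 * S + 2) ≤ (1 / 2) ^ (4 * S + 2) :=
      pow_le_pow_left₀ (by positivity) hD _
    rw [pow_mul]
    calc _ ≤ 4 ^ S * 4 ^ S * (1 / 2 : ℝ) ^ (4 * S + 2) := by gcongr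
      _ = 1 / 4 := by
        rw [pow_add, pow_mul, ← mul_assoc, ← mul_pow, ← mul_pow]
        norm_num
      _ < _ := by norm_num
  classical
  have hex' : ∃ k : ℕ, Z * Z * (G.lam : ℝ) ^ k < 1 / 2 := ⟨_, hex⟩
  -- The least such number is taken because the loop must not have stopped earlier.
  exact ⟨Nat.find hex', Nat.find_min' hex' hex, fun i hi => not_lt.1 (Nat.find_min hex' hi),
    Nat.find_spec hex'⟩

end Pinnable

lemma CSPInst.size_code {F : Set Constraint} (x : CSPInst F) :
    (x.code.map len).sum = x.n + 1 + ((x.raws.flatMap Raw.code).map len).sum := by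
  rw [x.code_eq]
  simp [len_one, len_neg_one]
  omega

/-- The number of copies is quadratic in the size. Hence both the number of steps and the length
bound are quadratic in `s + 1/ε + 1`, and their product has degree 4. -/
lemma time_bound (D a b s : ℕ) {ε : ℝ} (h0 : 0 < ε) (h1 : ε < 1) :
    (((122 + 121 * s + (b + 8) * (D * (4 * s + 2) * s)) *
      (len ε + 5 * s + 3 * (D * (4 * s + 2) * s) + a + 11) + 3 : ℕ) : ℝ) ≤
    (((243 + 6 * D * (b + 8)) * (18 * D + a + 20) + 3 : ℕ) : ℝ) * (s + 1 / ε + 1) ^ 4 := by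
  have hs0 : (0 : ℝ) ≤ s := Nat.cast_nonneg s
  have hε : 0 < 1 / ε := by positivity
  have h7 := len_le_of_lt_one h0 h1
  set u : ℝ := s + 1 / ε + 1 with hu
  have hsu : (s : ℝ) ≤ u := by linarith
  have hu1 : 1 ≤ u := by linarith
  have hu2 : u ≤ u ^ 2 := le_self_pow₀ hu1 (by norm_num)
  have hu3 : 1 ≤ u ^ 2 := by linarith
  have hQ : ((D * (4 * s + 2) * s : ℕ) : ℝ) ≤ 6 * D * u ^ 2 := by
    have h5 : (4 * (s : ℝ) + 2) * s ≤ 6 * u ^ 2 := by nlinarith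
    have h6 := mul_le_mul_of_nonneg_left h5 (Nat.cast_nonneg (α := ℝ) D)
    push_cast
    linarith
  generalize D * (4 * s + 2) * s = Q at hQ ⊢
  have ha : (a : ℝ) ≤ a * u ^ 2 := le_mul_of_one_le_right (Nat.cast_nonneg _) hu3
  have hB : ((len ε + 5 * s + 3 * Q + a + 11 : ℕ) : ℝ) ≤ ((18 * D + a + 20 : ℕ) : ℝ) * u ^ 2 := by
    push_cast
    linarith
  have hC : ((122 + 121 * s + (b + 8) * Q : ℕ) : ℝ) ≤
      ((243 + 6 * D * (b + 8) : ℕ) : ℝ) * u ^ 2 := by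
    have h9 := mul_le_mul_of_nonneg_left hQ (show (0 : ℝ) ≤ b + 8 by positivity)
    push_cast
    linarith
  have h := mul_le_mul hC hB (Nat.cast_nonneg _) (by positivity)
  have h4 : 1 ≤ u ^ 4 := one_le_pow₀ hu1
  push_cast at h ⊢
  linarith

/-! ### The reduction -/

/-- An implication can be replaced by a pinnable constraint. -/
theorem Pinnable.aptReduces (G : Pinnable) {A S : Set Constraint} (hf : G.f ∈ S) (hU : Unary ⊆ S)
    (hA : ∀ c ∈ A, c ≠ Implies → c ∈ S) : APTReduces (maxProdCSP A) (maxProdCSP S) := by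
  -- `D` copies halve the weight of a violation; it depends on the constraint alone, so it may enter
  -- the polynomial.
  obtain ⟨D, hD⟩ := exists_pow_lt_of_lt_one (show (0 : ℝ) < 1 / 2 by norm_num)
    (show (G.lam : ℝ) < 1 by exact_mod_cast G.lam_lt_one)
  refine ⟨G.program, MvPolynomial.C (((243 + 6 * D * (G.copyCost + 8)) * (18 * D + G.constLen + 20) + 3 : ℕ) : ℝ) *
    (MvPolynomial.X 0 + MvPolynomial.X 1 + 1) ^ 4, fun M hM x ε h0 h1 => ?_⟩
  have hsize : (maxProdCSP A).size x = x.n + 1 + ((x.raws.flatMap Raw.code).map len).sum :=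
    x.size_code
  set s := (maxProdCSP A).size x with hs
  set u : ℝ := s + 1 / ε + 1 with hu
  have hpoly : MvPolynomial.eval ![(s : ℝ), 1 / ε] (MvPolynomial.C (((243 + 6 * D * (G.copyCost + 8)) * (18 * D + G.constLen + 20) + 3 : ℕ) : ℝ) *
      (MvPolynomial.X 0 + MvPolynomial.X 1 + 1) ^ 4) = (((243 + 6 * D * (G.copyCost + 8)) * (18 * D + G.constLen + 20) + 3 : ℕ) : ℝ) * u ^ 4 := by
    simp [hu]
  rw [hpoly]
  have hε1 : 0 < 1 / ε := by positivity
  have hu1 : 1 ≤ u := by rw [hu]; have : (0 : ℝ) ≤ s := Nat.cast_nonneg s; linarith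
  have hZ : (totalSpread x.raws : ℝ) ≤ 4 ^ s :=
    (totalSpread_le _).trans (pow_le_pow_right₀ (by norm_num) (by omega))
  obtain ⟨k, hk, hlo, hhi⟩ := G.exists_copies hD.le (by positivity) hZ
  have hl : (x.raws.flatMap Raw.code).length ≤ s :=
    (length_le_sum_len _).trans (by omega)
  have hp : (impPairs x.raws).length ≤ s :=
    ((impPairs_length_le _).trans (length_le_flatMap_code _)).trans hl
  set Q := D * (4 * s + 2) * s with hQ
  have hkp : k * (impPairs x.raws).length ≤ Q := Nat.mul_le_mul hk hp
  set B := len ε + 5 * s + 3 * Q + G.constLen + 11 with hB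
  have hn : x.n ≤ s := by omega
  have hbd := G.bounds (B := B) (n := x.n) hZ hkp hn (by omega)
  have hZ2 : (totalSpread x.raws : ℝ) ≤ 2 ^ (2 * s) := by
    rw [pow_mul]; norm_num; exact hZ
  obtain ⟨m, hq, hns, -, hmb, hmo, hmg, hrun⟩ := hbd.does_question (ε := ε) (k := k) (by omega)
    x.raws_scope_lt hZ2 (by omega) le_rfl le_rfl hlo hhi le_rfl
  rw [← x.code_eq] at hrun
  have hval := G.result_valid x k hf hU hA
  rw [← Partial.inst_code _ hval] at hq
  obtain ⟨hfirst, fin, t, ht, hfin⟩ := Pinnable.run_program (by omega) hrun hns hmb hmo hmg M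
  have hcode : (maxProdCSP A).code x = x.code := rfl
  rw [hcode]
  refine ⟨fun t c hc q a k hk => ⟨(G.result x.n _ x.raws).inst hval, ε, ?_, h0, h1, ?_⟩, t, ?_, ?_⟩
  · rw [hfirst t c hc q a k hk, hq]
    rfl
  · have h2 : 1 / ε ≤ u := by rw [hu]; have : (0 : ℝ) ≤ s := Nat.cast_nonneg s; linarith
    have h3 : u ≤ u ^ 4 := le_self_pow₀ hu1 (by norm_num)
    refine h2.trans (h3.trans (le_mul_of_one_le_left (by positivity) ?_))
    exact_mod_cast Nat.le_add_left_of_le (by norm_num)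
  · intro c hc
    rw [ht, PMF.support_map] at hc
    obtain ⟨y, -, rfl⟩ := hc
    refine ⟨(hfin y).1, ?_⟩
    have hclock := (hfin y).2.1
    have hcount : G.questionCost x.n k (impPairs x.raws).length (x.raws.flatMap Raw.code).length +
        (16 * x.n + 15) ≤ 122 + 121 * s + (G.copyCost + 8) * Q := by
      rw [Pinnable.questionCost]
      have : ((G.copyCost + 1) * k + 20) * (impPairs x.raws).length =
        (G.copyCost + 1) * (k * (impPairs x.raws).length) + 20 * (impPairs x.raws).length := by ring
      rw [this]
      have := Nat.mul_le_mul_left (G.copyCost + 1) hkp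
      have e2 : (G.copyCost + 8) * Q = (G.copyCost + 1) * Q + 7 * Q := by ring
      omega
    refine le_trans ?_ (time_bound D G.constLen G.copyCost s h0 h1)
    have := hclock.trans (Nat.add_le_add_right (Nat.mul_le_mul_right B hcount) 3)
    exact_mod_cast this
  · rw [ht, PMF.toOuterMeasure_map_apply, hq]
    -- Every good answer of the oracle leads to a good output, so the probability `3/4` carries over
    -- without repetition.
    refine (hM ((G.result x.n k x.raws).inst hval) ε h0 h1).trans (MeasureTheory.measure_mono ?_)
    intro y hy
    refine ⟨firstBits x.n y, (hfin y).2.2, ?_⟩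
    have hK1 : (1 : ℝ) ≤ 2 ^ ε := Real.one_le_rpow (by norm_num) h0.le
    have hK2 : (2 : ℝ) ^ ε < 2 := by
      calc (2 : ℝ) ^ ε < 2 ^ (1 : ℝ) := Real.rpow_lt_rpow_of_exponent_lt (by norm_num) h1
        _ = 2 := Real.rpow_one 2
    refine G.isApprox_firstBits x hval ?_ (K := ⟨2 ^ ε, by positivity⟩) hK1 hK2 hy
    rw [mul_comm]
    exact_mod_cast hhi

end MaxProd

end

theorem mainTheorem6 (F : Set MaxProd.Constraint) (f : MaxProd.Constraint)
    (hIM : f ∈ MaxProd.IMopt) (hdeg : ¬ MaxProd.Degenerate f)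
    (himp : ¬ MaxProd.HasImpSupport f) :
    MaxProd.APTReduces (MaxProd.maxProdCSPStar ({MaxProd.Implies} ∪ F))
      (MaxProd.maxProdCSPStar ({f} ∪ F)) := by
  have hpos := MaxProd.IMopt.val_ne_zero hIM himp
  obtain ⟨i, j, hij, hlt⟩ := MaxProd.IMopt.exists_pin hIM hdeg hpos
  refine MaxProd.Pinnable.aptReduces ⟨f, i, j, hij, hpos, hlt⟩ (Or.inl (Or.inl rfl))
    Set.subset_union_right ?_
  -- `Implies` may also belong to `F`; the reduction replaces all its occurrences, so only
  -- constraints different from it must be available in the target.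
  rintro c ((hc | hc) | hc) hne
  · exact absurd hc hne
  · exact Or.inl (Or.inr hc)
  · exact Or.inr hc
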